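/- Let $F$ be a continuous distribution function on $\mathbb{R}$ with $F(0)=0$ that has a density $f$ equal to its Maclaurin series on the positive half-line, that is, $$f(x)=\sum_{q=0}^{\infty}\frac{f^{(q)}(0)}{q!}\,x^{q}\qquad\text{for all } x>0,$$ where $f^{(q)}(0)$ denotes the $q$-th right derivative at $0$. Let $k,n$ be fixed integers with $1<k\le n$, and let $X_1,\dots,X_n$ be independent random variables with distribution function $F$. For $1\le j\le m\le n$ let $X_{(j;m)}$ denote the $j$-th smallest of $X_1,\dots,X_m$. If $$X_{(k-1;n-1)}+\frac1n X_n\overset{d}{=}X_{(k;n)},$$ then $F$ is an exponential distribution: there is $\lambda>0$ such that $F(x)=1-e^{-\lambda x}$ for all $x\ge 0$. -/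

import Mathlib

open MeasureTheory ProbabilityTheory

/-- `f` equals its Maclaurin series at every `x > 0`; the derivatives at `0` are taken from the
right, since a density of a distribution on `[0, ∞)` need not be smooth across `0`. -/
def HasMaclaurinExpansion (f : ℝ → ℝ) : Prop :=
  ∀ x : ℝ, 0 < x →
    HasSum (fun q : ℕ => iteratedDerivWithin q f (Set.Ici 0) 0 / (q.factorial : ℝ) * x ^ q) (f x)

/-- The class `𝓕`: the distribution function `F` of `ν` is continuous, `F 0 = 0`, and `ν` has a
density that equals its Maclaurin series for all `x > 0`. -/
structure InClassF (ν : Measure ℝ) : Prop where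
  continuous_cdf : Continuous (cdf ν)
  cdf_zero : cdf ν 0 = 0
  exists_density : ∃ f : ℝ → ℝ, Measurable f ∧ (∀ x, 0 ≤ f x) ∧
    ν = volume.withDensity (fun x => ENNReal.ofReal (f x)) ∧ HasMaclaurinExpansion f

/-- The `k`-th smallest (counted from `1`) of the `n` values `x 0, …, x (n - 1)`. -/
noncomputable def orderStat {n : ℕ} (x : Fin n → ℝ) (k : ℕ) (hk : 1 ≤ k) (hkn : k ≤ n) : ℝ :=
  x (Tuple.sort x ⟨k - 1, by omega⟩)

/-- The probability that at least `k` of `n` independent events of probability `u` occur. -/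
def binomTail {R : Type*} [CommRing R] (k n : ℕ) (u : R) : R :=
  ∑ j ∈ Finset.Icc k n, (n.choose j : R) * u ^ j * (1 - u) ^ (n - j)

theorem orderStat_le_iff {n : ℕ} (x : Fin n → ℝ) (k : ℕ) (hk : 1 ≤ k) (hkn : k ≤ n) (t : ℝ) :
    orderStat x k hk hkn ≤ t ↔ k ≤ (Finset.univ.filter fun i => x i ≤ t).card := by
  have h := Tuple.lt_card_le_iff_apply_le_of_monotone (j := (⟨k - 1, by omega⟩ : Fin n)) (a := t)
    (Tuple.monotone_sort x)
  have hc : (Finset.univ.filter fun i => (x ∘ Tuple.sort x) i ≤ t).card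
      = (Finset.univ.filter fun i => x i ≤ t).card :=
    Finset.card_equiv (Tuple.sort x) (by simp)
  rw [hc] at h
  unfold orderStat
  rw [← Function.comp_apply (f := x), ← h]
  simp only
  omega

theorem orderStat_le_set_eq {n : ℕ} (k : ℕ) (hk : 1 ≤ k) (hkn : k ≤ n) (t : ℝ) :
    {x : Fin n → ℝ | orderStat x k hk hkn ≤ t} =
      ⋃ s ∈ (Finset.univ : Finset (Finset (Fin n))).filter (fun s => k ≤ s.card),
        Set.univ.pi fun i => if i ∈ s then Set.Iic t else Set.Ioi t := by
  ext x
  simp only [Set.mem_ofPred_eq, orderStat_le_iff, Finset.mem_filter, Finset.mem_univ, true_and,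
    Set.mem_iUnion, Set.mem_pi, exists_prop]
  constructor
  · intro h
    refine ⟨_, h, fun i => ?_⟩
    by_cases hi : x i ≤ t
    · simp [hi]
    · simp [hi, not_le.mp hi]
  · rintro ⟨s, hs, hx⟩
    refine hs.trans (Finset.card_le_card fun i hi => ?_)
    have := hx i
    simp only [hi, if_true, Set.mem_Iic] at this
    simpa using this

theorem measurable_orderStat {n : ℕ} (k : ℕ) (hk : 1 ≤ k) (hkn : k ≤ n) :
    Measurable fun x : Fin n → ℝ => orderStat x k hk hkn := by
  refine measurable_of_Iic fun t => ?_
  change MeasurableSet {x : Fin n → ℝ | orderStat x k hk hkn ≤ t}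
  rw [orderStat_le_set_eq]
  refine Finset.measurableSet_biUnion _ fun s _ => MeasurableSet.univ_pi fun i => ?_
  split_ifs
  · exact measurableSet_Iic
  · exact measurableSet_Ioi

theorem pi_orderStat_le (ν : Measure ℝ) [IsProbabilityMeasure ν] {n : ℕ} (k : ℕ) (hk : 1 ≤ k)
    (hkn : k ≤ n) (t : ℝ) :
    (Measure.pi fun _ : Fin n => ν).real {x | orderStat x k hk hkn ≤ t}
      = binomTail k n (cdf ν t) := by
  rw [orderStat_le_set_eq, measureReal_biUnion_finset]
  · have h : ∀ s : Finset (Fin n), (Measure.pi fun _ : Fin n => ν).real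
        (Set.univ.pi fun i => if i ∈ s then Set.Iic t else Set.Ioi t)
        = (cdf ν t) ^ s.card * (1 - cdf ν t) ^ (n - s.card) := by
      intro s
      have h1 : ∀ i, ν.real (if i ∈ s then Set.Iic t else Set.Ioi t)
          = if i ∈ s then cdf ν t else 1 - cdf ν t := by
        intro i
        split_ifs
        · rw [cdf_eq_real]
        · rw [cdf_eq_real, ← Set.compl_Iic, probReal_compl_eq_one_sub measurableSet_Iic]
      rw [measureReal_def, Measure.pi_pi, ENNReal.toReal_prod]
      simp_rw [← measureReal_def, h1]
      rw [Finset.prod_ite]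
      simp only [Finset.filter_univ_mem, Finset.prod_const]
      congr 2
      have : (Finset.univ.filter fun i => i ∉ s) = sᶜ := by ext; simp
      rw [this, Finset.card_compl, Fintype.card_fin]
    simp_rw [h]
    rw [Finset.sum_filter]
    have := Finset.sum_powerset_apply_card (x := (Finset.univ : Finset (Fin n)))
      (fun j => if k ≤ j then (cdf ν t) ^ j * (1 - cdf ν t) ^ (n - j) else 0)
    rw [Finset.powerset_univ] at this
    rw [this, Finset.card_univ, Fintype.card_fin, binomTail]
    have h2 : Finset.Icc k n = (Finset.range (n + 1)).filter fun j => k ≤ j := by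
      ext j; simp only [Finset.mem_Icc, Finset.mem_filter, Finset.mem_range]; omega
    rw [h2, Finset.sum_filter]
    refine Finset.sum_congr rfl fun j _ => ?_
    split_ifs
    · simp [mul_assoc]
    · simp
  · intro s _ s' _ hss'
    obtain ⟨i, hi⟩ : ∃ i, ¬(i ∈ s ↔ i ∈ s') := by
      by_contra hcon
      push Not at hcon
      exact hss' (Finset.ext hcon)
    refine Set.disjoint_left.mpr fun x hx hx' => ?_
    have h1 := hx i (Set.mem_univ i)
    have h2 := hx' i (Set.mem_univ i)
    by_cases hs : i ∈ s <;> by_cases hs' : i ∈ s' <;> simp_all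
    · linarith
    · linarith
  · intro s _
    refine MeasurableSet.univ_pi fun i => ?_
    split_ifs
    · exact measurableSet_Iic
    · exact measurableSet_Ioi

theorem cdf_map_orderStat (ν : Measure ℝ) [IsProbabilityMeasure ν] {n : ℕ} (k : ℕ) (hk : 1 ≤ k)
    (hkn : k ≤ n) (t : ℝ) :
    cdf ((Measure.pi fun _ : Fin n => ν).map fun x => orderStat x k hk hkn) t
      = binomTail k n (cdf ν t) := by
  have := Measure.isProbabilityMeasure_map (μ := Measure.pi fun _ : Fin n => ν)
    (measurable_orderStat k hk hkn).aemeasurable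
  rw [cdf_eq_real, map_measureReal_apply (measurable_orderStat k hk hkn) measurableSet_Iic,
    ← pi_orderStat_le ν k hk hkn t]
  rfl

/-- The laws of the two order statistics, and the distributional identity between them. -/
theorem exists_laws_of_identDistrib {Ω : Type*} [MeasurableSpace Ω] (μ : Measure Ω)
    [IsProbabilityMeasure μ] (ν : Measure ℝ) [IsProbabilityMeasure ν]
    (n k : ℕ) (hkn : k ≤ n)
    (X : Fin n → Ω → ℝ) (hlaw : ∀ i, HasLaw (X i) ν μ) (hindep : iIndepFun X μ)
    (h₁ : 1 ≤ k - 1) (h₂ : k - 1 ≤ n - 1) (h₃ : n - 1 < n) (h₄ : 1 ≤ k)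
    (heq : IdentDistrib
      (fun ω => orderStat (fun i : Fin (n - 1) => X (Fin.castLE (Nat.sub_le n 1) i) ω)
          (k - 1) h₁ h₂ + (1 / (n : ℝ)) * X ⟨n - 1, h₃⟩ ω)
      (fun ω => orderStat (fun i : Fin n => X i ω) k h₄ hkn) μ μ) :
    ∃ γ κ : Measure ℝ, IsProbabilityMeasure γ ∧ IsProbabilityMeasure κ ∧
      (∀ t, cdf γ t = binomTail (k - 1) (n - 1) (cdf ν t)) ∧
      (∀ t, cdf κ t = binomTail k n (cdf ν t)) ∧
      κ = (ν.prod γ).map fun p => p.2 + 1 / (n : ℝ) * p.1 := by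
  obtain ⟨N, rfl⟩ : ∃ N, n = N + 1 := ⟨n - 1, by omega⟩
  have hX : ∀ i, AEMeasurable (X i) μ := fun i => (hlaw i).aemeasurable
  have hjoint : μ.map (fun ω i => X i ω) = Measure.pi fun _ => ν := by
    rw [hindep.map_fun_eq_pi_map hX]
    congr 1
    ext1 i
    exact (hlaw i).map_eq
  have hXj : AEMeasurable (fun ω i => X i ω) μ := aemeasurable_pi_lambda _ hX
  have hmG := measurable_orderStat (n := N) (k - 1) (by omega) (by omega)
  have hmK := measurable_orderStat (n := N + 1) k (by omega) hkn
  have hmL : Measurable fun x : Fin (N + 1) → ℝ =>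
      orderStat (fun i : Fin N => x (Fin.last N |>.succAbove i)) (k - 1) (by omega) (by omega)
        + 1 / ((N + 1 : ℕ) : ℝ) * x (Fin.last N) := by
    have h : Measurable fun (x : Fin (N + 1) → ℝ) (i : Fin N) => x (Fin.last N |>.succAbove i) :=
      measurable_pi_lambda _ fun i => measurable_pi_apply _
    exact (hmG.comp h).add ((measurable_pi_apply _).const_mul _)
  refine ⟨(Measure.pi fun _ : Fin N => ν).map fun x => orderStat x (k - 1) (by omega) (by omega),
    (Measure.pi fun _ : Fin (N + 1) => ν).map fun x => orderStat x k (by omega) hkn,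
    Measure.isProbabilityMeasure_map hmG.aemeasurable,
    Measure.isProbabilityMeasure_map hmK.aemeasurable,
    fun t => cdf_map_orderStat ν _ (by omega) (by omega) t,
    fun t => cdf_map_orderStat ν _ (by omega) hkn t, ?_⟩
  have h1 := heq.map_eq
  have h2 : μ.map (fun ω => orderStat (fun i : Fin (N + 1) => X i ω) k (by omega) hkn)
      = (Measure.pi fun _ : Fin (N + 1) => ν).map fun x => orderStat x k (by omega) hkn := by
    rw [← hjoint, AEMeasurable.map_map_of_aemeasurable hmK.aemeasurable hXj]
    rfl
  have h3 : μ.map (fun ω => orderStat (fun i : Fin N =>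
          X (Fin.castLE (Nat.sub_le (N + 1) 1) i) ω) (k - 1) (by omega) (by omega)
          + (1 / ((N + 1 : ℕ) : ℝ)) * X ⟨N + 1 - 1, by omega⟩ ω)
      = (Measure.pi fun _ : Fin (N + 1) => ν).map fun x =>
          orderStat (fun i : Fin N => x (Fin.last N |>.succAbove i)) (k - 1) (by omega) (by omega)
        + 1 / ((N + 1 : ℕ) : ℝ) * x (Fin.last N) := by
    rw [← hjoint, AEMeasurable.map_map_of_aemeasurable hmL.aemeasurable hXj]
    congr 1
    ext ω
    simp only [Function.comp_apply, Fin.succAbove_last]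
    rfl
  have h4 := measurePreserving_piFinSuccAbove (fun _ : Fin (N + 1) => ν) (Fin.last N)
  rw [← h2, ← h1]
  refine h3.trans ?_
  have hmS : Measurable fun p : ℝ × ℝ => p.2 + 1 / ((N + 1 : ℕ) : ℝ) * p.1 := by fun_prop
  have h5 : ν.prod ((Measure.pi fun _ : Fin N => ν).map
        fun x => orderStat x (k - 1) (by omega) (by omega))
      = (ν.prod (Measure.pi fun _ : Fin N => ν)).map
        (Prod.map id fun x => orderStat x (k - 1) (by omega) (by omega)) := by
    rw [← Measure.map_prod_map _ _ measurable_id hmG, Measure.map_id]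
  rw [h5, Measure.map_map hmS (by fun_prop), ← h4.map_eq, Measure.map_map _ h4.measurable]
  · rfl
  · exact hmS.comp (measurable_id.prodMap hmG)

/-- The power series `P` converges to `g` on the positive half-line. -/
def PowerSeries.EntireSum (P : PowerSeries ℝ) (g : ℝ → ℝ) : Prop :=
  ∀ x : ℝ, 0 < x → HasSum (fun q : ℕ => PowerSeries.coeff q P * x ^ q) (g x)

namespace PowerSeries.EntireSum

open PowerSeries

variable {P Q : PowerSeries ℝ} {g h : ℝ → ℝ}

theorem summable_abs (hP : P.EntireSum g) {x : ℝ} (hx : 0 ≤ x) :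
    Summable fun q : ℕ => |coeff q P| * x ^ q := by
  rcases hx.eq_or_lt with rfl | hx
  · refine summable_of_ne_finset_zero (s := {0}) fun q hq => ?_
    simp only [Finset.mem_singleton] at hq
    simp [hq]
  · have := (hP x hx).summable.norm
    simpa [abs_of_pos hx] using this

theorem congr (hP : P.EntireSum g) (hgh : ∀ x, 0 < x → g x = h x) : P.EntireSum h :=
  fun x hx => hgh x hx ▸ hP x hx

theorem add (hP : P.EntireSum g) (hQ : Q.EntireSum h) : (P + Q).EntireSum fun x => g x + h x :=
  fun x hx => by simpa [add_mul] using (hP x hx).add (hQ x hx)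

theorem sub (hP : P.EntireSum g) (hQ : Q.EntireSum h) : (P - Q).EntireSum fun x => g x - h x :=
  fun x hx => by simpa [sub_mul] using (hP x hx).sub (hQ x hx)

theorem C (c : ℝ) : (PowerSeries.C c).EntireSum fun _ => c := by
  intro x _
  convert hasSum_single 0 ?_ using 1
  · simp
  · intro q hq
    simp [coeff_C, hq]

theorem one : (1 : PowerSeries ℝ).EntireSum fun _ => 1 := by
  simpa using C 1

theorem mul (hP : P.EntireSum g) (hQ : Q.EntireSum h) : (P * Q).EntireSum fun x => g x * h x := by
  intro x hx
  have h1 := (hP x hx).summable.norm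
  have h2 := (hQ x hx).summable.norm
  have h3 := tsum_mul_tsum_eq_tsum_sum_antidiagonal_of_summable_norm h1 h2
  have h4 := (summable_norm_sum_mul_antidiagonal_of_summable_norm h1 h2).of_norm.hasSum
  rw [← h3, (hP x hx).tsum_eq, (hQ x hx).tsum_eq] at h4
  refine (congrArg (HasSum · _) (funext fun q => ?_)).mpr h4
  rw [coeff_mul, Finset.sum_mul]
  refine Finset.sum_congr rfl fun p hp => ?_
  rw [← Finset.HasAntidiagonal.mem_antidiagonal.mp hp]
  ring

theorem pow (hP : P.EntireSum g) (r : ℕ) : (P ^ r).EntireSum fun x => g x ^ r := by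
  induction r with
  | zero => simpa using one
  | succ r ih => simpa [pow_succ] using ih.mul hP

theorem sum {ι : Type*} (s : Finset ι) {P : ι → PowerSeries ℝ} {g : ι → ℝ → ℝ}
    (h : ∀ i ∈ s, (P i).EntireSum (g i)) : (∑ i ∈ s, P i).EntireSum fun x => ∑ i ∈ s, g i x := by
  classical
  induction s using Finset.induction_on with
  | empty => simpa using C 0
  | insert a s ha ih =>
    simp only [Finset.sum_insert ha]
    exact (h a (by simp)).add (ih fun i hi => h i (by simp [hi]))

theorem binomTail (hP : P.EntireSum g) (k n : ℕ) :
    (_root_.binomTail k n P).EntireSum fun x => _root_.binomTail k n (g x) := by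
  refine sum _ fun j _ => ((?_ : EntireSum _ fun _ => (n.choose j : ℝ)).mul (hP.pow j)).mul
    ((one.sub hP).pow _)
  simpa using C (n.choose j : ℝ)

theorem eq_zero (hP : P.EntireSum fun _ => 0) : P = 0 := by
  ext q
  rw [map_zero]
  induction q using Nat.strong_induction_on with
  | _ q ih =>
  have hs : Summable fun i : ℕ => |coeff (i + (q + 1)) P| := by
    have := (summable_nat_add_iff (q + 1)).mpr (hP.summable_abs zero_le_one)
    simpa using this
  set S := ∑' i : ℕ, |coeff (i + (q + 1)) P| with hS
  have key : ∀ x : ℝ, 0 < x → x ≤ 1 → |coeff q P| ≤ x * S := by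
    intro x hx hx1
    have h0 := hP x hx
    have h1 := (hasSum_nat_add_iff' (q + 1)).mpr h0
    rw [Finset.sum_range_succ, Finset.sum_eq_zero (fun i hi => by
      rw [ih i (Finset.mem_range.mp hi), zero_mul]), zero_add, zero_sub] at h1
    have h2 : |coeff q P| * x ^ q ≤ x ^ q * (x * S) := by
      have h3 : |-(coeff q P * x ^ q)| ≤ ∑' i : ℕ, x ^ (q + 1) * |coeff (i + (q + 1)) P| := by
        rw [← Real.norm_eq_abs]
        refine h1.norm_le_of_bounded (hs.mul_left _).hasSum fun i => ?_
        rw [norm_mul, norm_pow, Real.norm_eq_abs, Real.norm_eq_abs, abs_of_pos hx, pow_add x i,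
          mul_comm]
        refine mul_le_mul_of_nonneg_right ?_ (abs_nonneg _)
        exact mul_le_of_le_one_left (by positivity) (pow_le_one₀ hx.le hx1)
      rw [tsum_mul_left, abs_neg, abs_mul, abs_of_pos (pow_pos hx q), pow_succ, mul_assoc] at h3
      exact h3
    rw [mul_comm] at h2
    exact le_of_mul_le_mul_left h2 (pow_pos hx q)
  have hS0 : 0 ≤ S := tsum_nonneg fun _ => abs_nonneg _
  by_contra hne
  have hpos : 0 < |coeff q P| := abs_pos.mpr hne
  have hx : 0 < |coeff q P| / (2 * (S + |coeff q P|)) := by positivity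
  have := key _ hx (by rw [div_le_one (by positivity)]; linarith)
  rw [div_mul_eq_mul_div, le_div_iff₀ (by positivity)] at this
  nlinarith

theorem unique (hP : P.EntireSum g) (hQ : Q.EntireSum g) : P = Q := by
  have : (P - Q).EntireSum fun _ => 0 := (hP.sub hQ).congr fun x _ => sub_self _
  exact sub_eq_zero.mp this.eq_zero

end PowerSeries.EntireSum

/-- The series with `D! · coeff D = ∑ i! j! · coeff i P · coeff j Q`: if `Q` vanishes at `0`, it
is the convolution of `P` with the derivative of `Q`. -/
noncomputable def PowerSeries.borelMul {K : Type*} [Field K] (P Q : PowerSeries K) :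
    PowerSeries K :=
  PowerSeries.mk fun D => ∑ p ∈ Finset.HasAntidiagonal.antidiagonal D,
    ((p.1.factorial : K) * p.2.factorial / D.factorial) * (coeff p.1 P * coeff p.2 Q)

theorem integral_pow_mul_sub_pow (i j : ℕ) (x : ℝ) :
    ∫ w in (0 : ℝ)..x, w ^ i * ((j + 1 : ℝ) * (x - w) ^ j)
      = (i.factorial * (j + 1).factorial / (i + (j + 1)).factorial : ℝ) * x ^ (i + (j + 1)) := by
  induction i generalizing j with
  | zero =>
    have h : ∀ w ∈ Set.uIcc 0 x, HasDerivAt (fun w : ℝ => -(x - w) ^ (j + 1))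
        ((j + 1 : ℝ) * (x - w) ^ j) w := by
      intro w _
      have := (((hasDerivAt_id w).const_sub x).pow (j + 1)).neg
      refine this.congr_deriv ?_
      simp
    simp only [pow_zero, one_mul]
    rw [intervalIntegral.integral_eq_sub_of_hasDerivAt h
      (Continuous.intervalIntegrable (by fun_prop) _ _)]
    have : ((j + 1).factorial : ℝ) ≠ 0 := by positivity
    simp [this]
  | succ i ih =>
    have hu : ∀ w ∈ Set.uIcc 0 x, HasDerivAt (fun w : ℝ => w ^ (i + 1)) ((i + 1 : ℝ) * w ^ i) w := by
      intro w _
      simpa using hasDerivAt_pow (i + 1) w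
    have hv : ∀ w ∈ Set.uIcc 0 x, HasDerivAt (fun w : ℝ => -(x - w) ^ (j + 1))
        ((j + 1 : ℝ) * (x - w) ^ j) w := by
      intro w _
      have := (((hasDerivAt_id w).const_sub x).pow (j + 1)).neg
      refine this.congr_deriv ?_
      simp
    rw [intervalIntegral.integral_mul_deriv_eq_deriv_mul hu hv
      (Continuous.intervalIntegrable (by fun_prop) _ _)
      (Continuous.intervalIntegrable (by fun_prop) _ _)]
    have h2 := ih (j + 1)
    have h3 : (∫ w in (0 : ℝ)..x, (i + 1 : ℝ) * w ^ i * -(x - w) ^ (j + 1))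
        = -((i + 1 : ℝ) / (j + 2)) * ∫ w in (0 : ℝ)..x,
          w ^ i * (((j + 1 : ℕ) + 1 : ℝ) * (x - w) ^ (j + 1)) := by
      rw [← intervalIntegral.integral_const_mul]
      congr 1
      ext w
      push_cast
      field_simp
      ring
    rw [h3, h2]
    have e : i + (j + 1 + 1) = i + 1 + (j + 1) := by ring
    rw [e, Nat.factorial_succ i, Nat.factorial_succ (j + 1)]
    push_cast
    field_simp
    simp
    left
    ring_nf
    simp

theorem hasSum_mul_prod {a b : ℕ → ℝ} {s t : ℝ} (ha : HasSum a s) (hb : HasSum b t) :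
    HasSum (fun p : ℕ × ℕ => a p.1 * b p.2) (s * t) :=
  ha.mul hb (summable_mul_of_summable_norm ha.summable.norm hb.summable.norm)

theorem hasSum_integral_convolution {a b : ℕ → ℝ} {g h : ℝ → ℝ} {x : ℝ} (hx : 0 < x)
    (ha : ∀ w : ℝ, 0 < w → HasSum (fun i : ℕ => a i * w ^ i) (g w))
    (hb : ∀ w : ℝ, 0 < w → HasSum (fun j : ℕ => b j * (j * w ^ (j - 1))) (h w)) :
    HasSum (fun p : ℕ × ℕ => ∫ w in (0 : ℝ)..x,
      (a p.1 * w ^ p.1) * (b p.2 * (p.2 * (x - w) ^ (p.2 - 1))))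
      (∫ w in (0 : ℝ)..x, g w * h (x - w)) := by
  have hs := (hasSum_mul_prod (ha x hx).summable.norm.hasSum
    (hb x hx).summable.norm.hasSum).summable
  refine intervalIntegral.hasSum_integral_of_dominated_convergence
    (fun p _ => ‖a p.1 * x ^ p.1‖ * ‖b p.2 * (p.2 * x ^ (p.2 - 1))‖) ?_ ?_ ?_ ?_ ?_
  · intro p
    exact (Continuous.aestronglyMeasurable (by fun_prop))
  · intro p
    refine Filter.Eventually.of_forall fun w hw => ?_
    rw [Set.uIoc_of_le hx.le] at hw
    have h1 : |x - w| ≤ |x| := by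
      rw [abs_of_nonneg (sub_nonneg.mpr hw.2), abs_of_pos hx]
      linarith [hw.1]
    have h2 : |w| ≤ |x| := by
      rw [abs_of_pos hw.1, abs_of_pos hx]
      exact hw.2
    simp only [norm_mul, norm_pow, Real.norm_eq_abs]
    have h3 := pow_le_pow_left₀ (abs_nonneg _) h2 p.1
    have h4 := pow_le_pow_left₀ (abs_nonneg _) h1 (p.2 - 1)
    exact mul_le_mul (mul_le_mul_of_nonneg_left h3 (abs_nonneg _))
      (mul_le_mul_of_nonneg_left (mul_le_mul_of_nonneg_left h4 (abs_nonneg _)) (abs_nonneg _))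
      (by positivity) (by positivity)
  · exact Filter.Eventually.of_forall fun w _ => hs
  · exact intervalIntegrable_const
  · have hne : ∀ᵐ w : ℝ, w ≠ x := by simp [ae_iff]
    filter_upwards [hne] with w hwx hw
    rw [Set.uIoc_of_le hx.le] at hw
    exact hasSum_mul_prod (ha w hw.1) (hb (x - w) (sub_pos.mpr (lt_of_le_of_ne hw.2 hwx)))

theorem PowerSeries.EntireSum.convolution {P Q : PowerSeries ℝ} {g h : ℝ → ℝ}
    (hP : P.EntireSum g)
    (hQ : ∀ x : ℝ, 0 < x → HasSum (fun j : ℕ => coeff j Q * (j * x ^ (j - 1))) (h x))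
    (hQ0 : constantCoeff Q = 0) :
    (P.borelMul Q).EntireSum fun x => ∫ w in (0 : ℝ)..x, g w * h (x - w) := by
  intro x hx
  have hmain := hasSum_integral_convolution hx hP hQ
  have hterm : ∀ p : ℕ × ℕ, (∫ w in (0 : ℝ)..x,
      (coeff p.1 P * w ^ p.1) * (coeff p.2 Q * (p.2 * (x - w) ^ (p.2 - 1))))
      = (if p.2 = 0 then 0 else
        ((p.1.factorial : ℝ) * p.2.factorial / (p.1 + p.2).factorial) * (coeff p.1 P * coeff p.2 Q))
          * x ^ (p.1 + p.2) := by
    rintro ⟨i, j⟩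
    rcases j with _ | j
    · simp
    · have := integral_pow_mul_sub_pow i j x
      simp only [Nat.add_eq_zero_iff, one_ne_zero, and_false, if_false, Nat.add_sub_cancel]
      rw [mul_right_comm, ← this, mul_comm, ← intervalIntegral.integral_const_mul]
      congr 1
      ext w
      push_cast
      ring
  simp_rw [hterm] at hmain
  have hsig := (Finset.HasAntidiagonal.sigmaAntidiagonalEquivProd (A := ℕ)).hasSum_iff.mpr hmain
  refine (congrArg (HasSum · _) (funext fun D => ?_)).mpr (hsig.sigma fun D => hasSum_fintype _)
  rw [PowerSeries.borelMul, coeff_mk, Finset.sum_mul, ← Finset.sum_coe_sort]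
  refine Finset.sum_congr rfl fun p _ => ?_
  have := Finset.HasAntidiagonal.mem_antidiagonal.mp p.2
  simp only [Function.comp_apply, Finset.HasAntidiagonal.sigmaAntidiagonalEquivProd_apply]
  rw [this]
  split_ifs with h0
  · rw [h0, coeff_zero_eq_constantCoeff, hQ0]
    simp
  · rfl

theorem PowerSeries.one_borelMul (Q : PowerSeries ℝ) : (1 : PowerSeries ℝ).borelMul Q = Q := by
  ext D
  rw [PowerSeries.borelMul, coeff_mk, Finset.sum_eq_single (0, D)]
  · have : (D.factorial : ℝ) ≠ 0 := by positivity
    simp [this]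
  · rintro ⟨i, j⟩ hij hne
    have h := Finset.HasAntidiagonal.mem_antidiagonal.mp hij
    have hi : i ≠ 0 := by
      rintro rfl
      simp only [zero_add] at h
      exact hne (by rw [h])
    simp [coeff_one, hi]
  · intro h
    exact absurd (Finset.HasAntidiagonal.mem_antidiagonal.mpr (zero_add D)) h

theorem ae_Ioi_zero_of_cdf {ν : Measure ℝ} [IsProbabilityMeasure ν] (h0 : cdf ν 0 = 0) :
    ∀ᵐ b ∂ν, b ∈ Set.Ioi (0 : ℝ) := by
  have : ν (Set.Iic 0) = 0 := by rw [← ofReal_cdf, h0, ENNReal.ofReal_zero]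
  rw [ae_iff]
  convert this using 2
  ext b
  simp

theorem cdf_eq_zero_of_nonpos {ν : Measure ℝ} (h0 : cdf ν 0 = 0) {x : ℝ} (hx : x ≤ 0) :
    cdf ν x = 0 :=
  le_antisymm (h0 ▸ monotone_cdf ν hx) (cdf_nonneg ν x)

theorem integral_eq_intervalIntegral_mul_density {ν : Measure ℝ} [IsProbabilityMeasure ν]
    (h0 : cdf ν 0 = 0) {f : ℝ → ℝ} (hfm : Measurable f) (hf0 : ∀ x, 0 ≤ f x)
    (hf : ν = volume.withDensity fun x => ENNReal.ofReal (f x)) {h : ℝ → ℝ} {c : ℝ} (hc : 0 ≤ c)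
    (hh : ∀ b, c < b → h b = 0) :
    ∫ b, h b ∂ν = ∫ b in (0 : ℝ)..c, f b * h b := by
  have h1 : ∫ b, h b ∂ν = ∫ b in Set.Ioc 0 c, h b ∂ν := by
    rw [← integral_indicator measurableSet_Ioc]
    refine integral_congr_ae ?_
    filter_upwards [ae_Ioi_zero_of_cdf h0] with b hb
    by_cases hbc : b ≤ c
    · rw [Set.indicator_of_mem (Set.mem_Ioc.mpr ⟨hb, hbc⟩)]
    · rw [Set.indicator_of_notMem (fun hm => hbc hm.2), hh b (not_le.mp hbc)]
  rw [h1, intervalIntegral.integral_of_le hc, hf]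
  rw [setIntegral_withDensity_eq_setIntegral_toReal_smul (by fun_prop)
    (Filter.Eventually.of_forall fun _ => ENNReal.ofReal_lt_top) _ measurableSet_Ioc]
  simp [ENNReal.toReal_ofReal, hf0]

/-- A distribution function in the class is given by a power series on the positive half-line. -/
theorem InClassF.exists_powerSeries {ν : Measure ℝ} [IsProbabilityMeasure ν] (hν : InClassF ν) :
    ∃ (f : ℝ → ℝ) (P : PowerSeries ℝ), Measurable f ∧ (∀ x, 0 ≤ f x) ∧
      ν = volume.withDensity (fun x => ENNReal.ofReal (f x)) ∧
      PowerSeries.constantCoeff P = 0 ∧ P.EntireSum (cdf ν) ∧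
      ∀ x : ℝ, 0 < x → HasSum (fun j : ℕ => PowerSeries.coeff j P * (j * x ^ (j - 1))) (f x) := by
  obtain ⟨f, hfm, hf0, hf, hser⟩ := hν.exists_density
  set a : ℕ → ℝ := fun q => iteratedDerivWithin q f (Set.Ici 0) 0 / (q.factorial : ℝ) with ha
  set P : PowerSeries ℝ := PowerSeries.mk fun q => if q = 0 then 0 else a (q - 1) / q with hP
  have hP0 : PowerSeries.constantCoeff P = 0 := by
    rw [← PowerSeries.coeff_zero_eq_constantCoeff_apply, hP, PowerSeries.coeff_mk, if_pos rfl]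
  have hder : ∀ x : ℝ, 0 < x →
      HasSum (fun j : ℕ => PowerSeries.coeff j P * (j * x ^ (j - 1))) (f x) := by
    intro x hx
    rw [← hasSum_nat_add_iff' 1]
    simp only [Finset.range_one, Finset.sum_singleton, CharP.cast_eq_zero, zero_mul, mul_zero,
      sub_zero]
    refine (congrArg (HasSum · _) (funext fun q => ?_)).mpr (hser x hx)
    rw [hP, PowerSeries.coeff_mk, if_neg (by omega)]
    have : ((q + 1 : ℕ) : ℝ) ≠ 0 := by positivity
    rw [Nat.add_sub_cancel, ← mul_assoc, div_mul_cancel₀ _ this]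
  refine ⟨f, P, hfm, hf0, hf, hP0, ?_, hder⟩
  have hconv := PowerSeries.EntireSum.one.convolution hder hP0
  rw [PowerSeries.one_borelMul] at hconv
  refine hconv.congr fun x hx => ?_
  simp only [one_mul]
  have h1 := integral_eq_intervalIntegral_mul_density hν.cdf_zero hfm hf0 hf
    (h := (Set.Iic x).indicator 1) hx.le (fun b hb => by simp [hb])
  rw [integral_indicator_one measurableSet_Iic, ← cdf_eq_real] at h1
  rw [h1, intervalIntegral.integral_comp_sub_left (fun w => f w) x, sub_self, sub_zero]
  refine intervalIntegral.integral_congr fun w hw => ?_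
  rw [Set.uIcc_of_le hx.le] at hw
  simp [hw.2]

theorem binomTail_zero {R : Type*} [CommRing R] {k : ℕ} (hk : 1 ≤ k) (n : ℕ) :
    binomTail k n (0 : R) = 0 := by
  refine Finset.sum_eq_zero fun j hj => ?_
  have : j ≠ 0 := by have := (Finset.mem_Icc.mp hj).1; omega
  simp [this]

theorem cdf_map_add_mul {ν γ κ : Measure ℝ} [IsProbabilityMeasure ν] [IsProbabilityMeasure γ]
    [IsProbabilityMeasure κ] {c : ℝ} (hκ : κ = (ν.prod γ).map fun p => p.2 + c * p.1) (x : ℝ) :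
    cdf κ x = ∫ b, cdf γ (x - c * b) ∂ν := by
  have hm : Measurable fun p : ℝ × ℝ => p.2 + c * p.1 := by fun_prop
  have h1 : κ (Set.Iic x) = ∫⁻ b, γ (Set.Iic (x - c * b)) ∂ν := by
    rw [hκ, Measure.map_apply hm measurableSet_Iic, Measure.prod_apply (hm measurableSet_Iic)]
    refine lintegral_congr fun b => ?_
    congr 1
    ext a
    simp only [Set.mem_preimage, Set.mem_Iic]
    constructor <;> intro h <;> linarith
  rw [cdf_eq_real, measureReal_def, h1, ← integral_toReal]
  · simp_rw [cdf_eq_real, measureReal_def]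
  · have : (fun b => γ (Set.Iic (x - c * b))) = fun b => ENNReal.ofReal (cdf γ (x - c * b)) := by
      ext b; rw [ofReal_cdf]
    rw [this]
    exact ((monotone_cdf γ).measurable.comp (by fun_prop)).ennreal_ofReal.aemeasurable
  · exact Filter.Eventually.of_forall fun b => measure_lt_top _ _

open PowerSeries in
/-- The distributional identity as an identity between formal power series. -/
theorem borelMul_binomTail_eq {ν γ κ : Measure ℝ} [IsProbabilityMeasure ν]
    [IsProbabilityMeasure γ] [IsProbabilityMeasure κ] {n k : ℕ} (hk : 1 < k) (hkn : k ≤ n)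
    (hγ : ∀ t, cdf γ t = binomTail (k - 1) (n - 1) (cdf ν t))
    (hκ : ∀ t, cdf κ t = binomTail k n (cdf ν t))
    (hsum : κ = (ν.prod γ).map fun p => p.2 + 1 / (n : ℝ) * p.1) (h0 : cdf ν 0 = 0)
    {f : ℝ → ℝ} (hfm : Measurable f) (hf0 : ∀ x, 0 ≤ f x)
    (hf : ν = volume.withDensity fun x => ENNReal.ofReal (f x))
    {P : PowerSeries ℝ} (hP0 : constantCoeff P = 0) (hP : P.EntireSum (cdf ν))
    (hder : ∀ x : ℝ, 0 < x → HasSum (fun j : ℕ => coeff j P * (j * x ^ (j - 1))) (f x)) :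
    (binomTail (k - 1) (n - 1) P).borelMul (rescale (n : ℝ) P) = binomTail k n P := by
  have hn : (0 : ℝ) < n := by exact_mod_cast (by omega : 0 < n)
  have hder' : ∀ x : ℝ, 0 < x → HasSum
      (fun j : ℕ => coeff j (rescale (n : ℝ) P) * (j * x ^ (j - 1))) (n * f (n * x)) := by
    intro x hx
    refine (congrArg (HasSum · _) (funext fun j => ?_)).mpr
      ((hder (n * x) (by positivity)).mul_left (n : ℝ))
    rw [coeff_rescale]
    rcases j with _ | j
    · simp
    · rw [Nat.add_sub_cancel]
      ring
  have h1 := (hP.binomTail (k - 1) (n - 1)).convolution hder' (by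
    rw [← coeff_zero_eq_constantCoeff_apply, coeff_rescale, coeff_zero_eq_constantCoeff_apply,
      hP0, mul_zero])
  refine h1.unique ((hP.binomTail k n).congr fun x hx => ?_)
  rw [← hκ, cdf_map_add_mul hsum]
  have hcx : (0 : ℝ) ≤ n * x := by positivity
  rw [integral_eq_intervalIntegral_mul_density h0 hfm hf0 hf hcx]
  · have h2 := intervalIntegral.integral_comp_sub_mul (a := 0) (b := x)
      (fun b => n * (f b * cdf γ (x - 1 / n * b))) hn.ne' (n * x)
    rw [sub_self, mul_zero, sub_zero, intervalIntegral.integral_const_mul,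
      intervalIntegral.integral_const_mul, smul_eq_mul, inv_mul_cancel_left₀ hn.ne'] at h2
    rw [← h2, ← intervalIntegral.integral_const_mul]
    refine intervalIntegral.integral_congr fun w _ => ?_
    have e1 : x - 1 / n * (n * x - n * w) = w := by field_simp; ring
    have e2 : (n : ℝ) * x - n * w = n * (x - w) := by ring
    rw [e1, e2, hγ]
    ring
  · intro b hb
    rw [hγ, cdf_eq_zero_of_nonpos h0, binomTail_zero (by omega)]
    have : x < b / n := by rwa [lt_div_iff₀ hn, mul_comm]
    rw [one_div_mul_eq_div]
    linarith

/-- `binomTail k n u = u ^ k * binomCore k n u`. -/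
def binomCore {R : Type*} [CommRing R] (k n : ℕ) (u : R) : R :=
  ∑ j ∈ Finset.Icc k n, (n.choose j : R) * u ^ (j - k) * (1 - u) ^ (n - j)

theorem binomTail_eq_pow_mul {R : Type*} [CommRing R] (k n : ℕ) (u : R) :
    binomTail k n u = u ^ k * binomCore k n u := by
  rw [binomTail, binomCore, Finset.mul_sum]
  refine Finset.sum_congr rfl fun j hj => ?_
  have h : u ^ j = u ^ k * u ^ (j - k) := by
    rw [← pow_add, Nat.add_sub_of_le (Finset.mem_Icc.mp hj).1]
  rw [h]
  ring

theorem map_binomTail {R S : Type*} [CommRing R] [CommRing S] (φ : R →+* S) (k n : ℕ) (u : R) :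
    φ (binomTail k n u) = binomTail k n (φ u) := by
  simp [binomTail]

theorem map_binomCore {R S : Type*} [CommRing R] [CommRing S] (φ : R →+* S) (k n : ℕ) (u : R) :
    φ (binomCore k n u) = binomCore k n (φ u) := by
  simp [binomCore]

theorem binomCore_zero {R : Type*} [CommRing R] {k n : ℕ} (hkn : k ≤ n) :
    binomCore k n (0 : R) = n.choose k := by
  rw [binomCore, Finset.sum_eq_single k]
  · simp
  · intro j hj hjk
    have : j - k ≠ 0 := by have := (Finset.mem_Icc.mp hj).1; omega
    simp [this]
  · intro h
    exact absurd (Finset.mem_Icc.mpr ⟨le_rfl, hkn⟩) h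

namespace PowerSeries

variable {K : Type*} [Field K]

/-- The formal version of `X_(k-1;n-1) + X_n / n =ᵈ X_(k;n)` for a distribution function given by
the power series `F`. -/
def IsOrderStatSolution (k n : ℕ) (F : PowerSeries K) : Prop :=
  (binomTail (k - 1) (n - 1) F).borelMul (rescale (n : K) F) = binomTail k n F

theorem coeff_borelMul_X_pow_mul (a b d : ℕ) (c : K) (U E : PowerSeries K) :
    coeff (a + b + d) ((X ^ a * U).borelMul (rescale c (X ^ b * E))) =
      (∑ p ∈ Finset.HasAntidiagonal.antidiagonal d, ((a + p.1).factorial * (b + p.2).factorial : K) *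
        c ^ (b + p.2) * (coeff p.1 U * coeff p.2 E)) / (a + b + d).factorial := by
  rw [borelMul, coeff_mk, Finset.sum_div]
  symm
  refine Finset.sum_of_injOn (fun p => (a + p.1, b + p.2)) ?_ ?_ ?_ ?_
  · intro p _ q _ h
    simp only [Prod.mk.injEq, add_right_inj] at h
    exact Prod.ext h.1 h.2
  · intro p hp
    simp only [Finset.mem_coe, Finset.HasAntidiagonal.mem_antidiagonal] at hp ⊢
    omega
  · rintro ⟨i, j⟩ hij hn
    simp only [Finset.HasAntidiagonal.mem_antidiagonal] at hij
    simp only [coeff_rescale, coeff_X_pow_mul']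
    split_ifs with h1 h2
    · exfalso
      refine hn ⟨(i - a, j - b), ?_, ?_⟩
      · simp only [Finset.mem_coe, Finset.HasAntidiagonal.mem_antidiagonal]
        omega
      · simp only [Prod.mk.injEq]
        omega
    all_goals simp
  · rintro ⟨i, j⟩ _
    simp only [coeff_rescale, coeff_X_pow_mul', le_add_iff_nonneg_right, zero_le, if_true,
      Nat.add_sub_cancel_left]
    ring

theorem constantCoeff_X_pow_mul {m : ℕ} (hm : 1 ≤ m) (E : PowerSeries K) :
    constantCoeff (X ^ m * E) = 0 := by
  simp [show m ≠ 0 by omega]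

/-- The coefficients of the formal equation in terms of `E = F / X ^ m`. -/
theorem IsOrderStatSolution.coeff_eq [CharZero K] {k n m : ℕ} (hk : 1 ≤ k) {E : PowerSeries K}
    (h : IsOrderStatSolution k n (X ^ m * E)) (d : ℕ) :
    ∑ p ∈ Finset.HasAntidiagonal.antidiagonal d,
      ((m * (k - 1) + p.1).factorial * (m + p.2).factorial : K) * (n : K) ^ (m + p.2) *
        (coeff p.1 (E ^ (k - 1) * binomCore (k - 1) (n - 1) (X ^ m * E)) * coeff p.2 E)
      = (m * k + d).factorial * coeff d (E ^ k * binomCore k n (X ^ m * E)) := by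
  have e : m * (k - 1) + m = m * k := by
    rw [← Nat.mul_succ]; congr 1; omega
  have h1 := congrArg (coeff (m * (k - 1) + m + d)) h
  rw [binomTail_eq_pow_mul, binomTail_eq_pow_mul, mul_pow, mul_pow, ← pow_mul, ← pow_mul,
    mul_assoc, mul_assoc, coeff_borelMul_X_pow_mul, e, coeff_X_pow_mul'] at h1
  have h2 : ((m * k + d).factorial : K) ≠ 0 := by exact_mod_cast Nat.factorial_ne_zero _
  rw [div_eq_iff h2, if_pos (Nat.le_add_right _ _), Nat.add_sub_cancel_left] at h1
  rw [h1, mul_comm]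

/-- `U` and `U'` agree below degree `d`, and their coefficients of degree `d` differ by `δ`. -/
def AgreeAt (d : ℕ) (U U' : PowerSeries K) (δ : K) : Prop :=
  ∃ Z, U = U' + X ^ d * Z ∧ constantCoeff Z = δ

namespace AgreeAt

variable {d : ℕ} {U U' W W' : PowerSeries K} {δ ε : K}

theorem refl (d : ℕ) (U : PowerSeries K) : AgreeAt d U U 0 := ⟨0, by simp, by simp⟩

theorem sub (h : AgreeAt d U U' δ) (h' : AgreeAt d W W' ε) : AgreeAt d (U - W) (U' - W') (δ - ε) := by
  obtain ⟨Z, rfl, rfl⟩ := h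
  obtain ⟨Z', rfl, rfl⟩ := h'
  exact ⟨Z - Z', by ring, by simp⟩

theorem add (h : AgreeAt d U U' δ) (h' : AgreeAt d W W' ε) : AgreeAt d (U + W) (U' + W') (δ + ε) := by
  obtain ⟨Z, rfl, rfl⟩ := h
  obtain ⟨Z', rfl, rfl⟩ := h'
  exact ⟨Z + Z', by ring, by simp⟩

theorem mul (hd : 1 ≤ d) (h : AgreeAt d U U' δ) (h' : AgreeAt d W W' ε) :
    AgreeAt d (U * W) (U' * W') (δ * constantCoeff W' + constantCoeff U' * ε) := by
  obtain ⟨Z, rfl, rfl⟩ := h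
  obtain ⟨Z', rfl, rfl⟩ := h'
  refine ⟨Z * W' + U' * Z' + X ^ d * (Z * Z'), by ring, ?_⟩
  simp [show d ≠ 0 by omega]

theorem mul_zero (hd : 1 ≤ d) (h : AgreeAt d U U' 0) (h' : AgreeAt d W W' 0) :
    AgreeAt d (U * W) (U' * W') 0 := by
  simpa using h.mul hd h'

theorem pow (hd : 1 ≤ d) (h : AgreeAt d U U' δ) (p : ℕ) :
    AgreeAt d (U ^ (p + 1)) (U' ^ (p + 1)) ((p + 1) * constantCoeff U' ^ p * δ) := by
  induction p with
  | zero => simpa using h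
  | succ p ih =>
    have h2 := ih.mul hd h
    rw [← pow_succ, ← pow_succ] at h2
    convert h2 using 1
    rw [map_pow]
    push_cast
    ring

theorem pow_zero (hd : 1 ≤ d) (h : AgreeAt d U U' 0) (p : ℕ) : AgreeAt d (U ^ p) (U' ^ p) 0 := by
  rcases p with _ | p
  · simpa using refl d 1
  · simpa using h.pow hd p

theorem sum {ι : Type*} (s : Finset ι) {U U' : ι → PowerSeries K}
    (h : ∀ i ∈ s, AgreeAt d (U i) (U' i) 0) : AgreeAt d (∑ i ∈ s, U i) (∑ i ∈ s, U' i) 0 := by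
  classical
  induction s using Finset.induction_on with
  | empty => simpa using refl d 0
  | insert a s ha ih =>
    simp only [Finset.sum_insert ha]
    simpa using (h a (by simp)).add (ih fun i hi => h i (by simp [hi]))

theorem binomCore (hd : 1 ≤ d) (h : AgreeAt d U U' 0) (k n : ℕ) :
    AgreeAt d (_root_.binomCore k n U) (_root_.binomCore k n U') 0 :=
  sum _ fun _ _ => ((refl d _).mul_zero hd (h.pow_zero hd _)).mul_zero hd
    ((by simpa using (refl d 1).sub h : AgreeAt d (1 - U) (1 - U') 0).pow_zero hd _)

theorem X_pow_mul {m : ℕ} (hm : 1 ≤ m) (h : AgreeAt d U U' δ) :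
    AgreeAt d (X ^ m * U) (X ^ m * U') 0 := by
  obtain ⟨Z, rfl, rfl⟩ := h
  exact ⟨X ^ m * Z, by ring, constantCoeff_X_pow_mul hm Z⟩

theorem coeff_lt (h : AgreeAt d U U' δ) {i : ℕ} (hi : i < d) : coeff i U = coeff i U' := by
  obtain ⟨Z, rfl, rfl⟩ := h
  simp [coeff_X_pow_mul', hi]

theorem coeff_self (h : AgreeAt d U U' δ) : coeff d U = coeff d U' + δ := by
  obtain ⟨Z, rfl, rfl⟩ := h
  simp [coeff_X_pow_mul']

theorem of_coeff (h : ∀ i < d, coeff i U = coeff i U') :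
    AgreeAt d U U' (coeff d U - coeff d U') := by
  obtain ⟨Z, hZ⟩ := (X_pow_dvd_iff (n := d) (φ := U - U')).mpr fun i hi => by
    rw [map_sub, h i hi, sub_self]
  refine ⟨Z, by rw [← hZ]; ring, ?_⟩
  rw [← map_sub, hZ, coeff_X_pow_mul', if_pos le_rfl, Nat.sub_self,
    coeff_zero_eq_constantCoeff_apply]

end AgreeAt

theorem coeff_zero_mul_binomCore {k n m r : ℕ} (hm : 1 ≤ m) (hkn : k ≤ n) (E : PowerSeries K) :
    constantCoeff (E ^ r * binomCore k n (X ^ m * E)) = constantCoeff E ^ r * n.choose k := by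
  rw [map_mul, map_pow, map_binomCore, constantCoeff_X_pow_mul hm, binomCore_zero hkn]

/-- The leading coefficients of the formal equation restrict `m`. -/
theorem IsOrderStatSolution.leading [CharZero K] {k n m : ℕ} (hk : 2 ≤ k) (hkn : k ≤ n)
    (hm : 1 ≤ m) {E : PowerSeries K} (hE : constantCoeff E ≠ 0)
    (h : IsOrderStatSolution k n (X ^ m * E)) :
    (m * (k - 1)).factorial * m.factorial * n ^ m * k = (m * k).factorial * n := by
  have h1 := h.coeff_eq (by omega) 0
  simp only [Finset.HasAntidiagonal.antidiagonal_zero, Finset.sum_singleton, add_zero,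
    coeff_zero_eq_constantCoeff_apply] at h1
  rw [coeff_zero_mul_binomCore hm (by omega), coeff_zero_mul_binomCore hm hkn] at h1
  have hE' : constantCoeff E ^ k ≠ 0 := pow_ne_zero _ hE
  have e : constantCoeff E ^ k = constantCoeff E ^ (k - 1) * constantCoeff E := by
    rw [← pow_succ]; congr 1; omega
  have h2 : (((m * (k - 1)).factorial * m.factorial * n ^ m * (n - 1).choose (k - 1) : ℕ) : K)
      = ((m * k).factorial * n.choose k : ℕ) := by
    refine mul_left_cancel₀ hE' ?_
    push_cast
    rw [e] at h1 ⊢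
    linear_combination h1
  have h3 : (m * (k - 1)).factorial * m.factorial * n ^ m * (n - 1).choose (k - 1)
      = (m * k).factorial * n.choose k := by exact_mod_cast h2
  have h4 := Nat.add_one_mul_choose_eq (n - 1) (k - 1)
  rw [show n - 1 + 1 = n by omega, show k - 1 + 1 = k by omega] at h4
  have h5 : 0 < (n - 1).choose (k - 1) := Nat.choose_pos (by omega)
  refine Nat.eq_of_mul_eq_mul_right h5 ?_
  calc _ = ((m * (k - 1)).factorial * m.factorial * n ^ m * (n - 1).choose (k - 1)) * k := by ring
    _ = (m * k).factorial * (n.choose k * k) := by rw [h3]; ring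
    _ = _ := by rw [← h4]; ring

/-- A solution of the formal equation is determined by its leading coefficient and those
coefficients at which the linearised equation is degenerate. -/
theorem IsOrderStatSolution.unique [CharZero K] {k n m : ℕ} (hk : 2 ≤ k) (hkn : k ≤ n)
    (hm : 1 ≤ m) {E E' : PowerSeries K} (hE : constantCoeff E ≠ 0)
    (h : IsOrderStatSolution k n (X ^ m * E)) (h' : IsOrderStatSolution k n (X ^ m * E'))
    (h0 : constantCoeff E = constantCoeff E')
    (hres : ∀ d, 1 ≤ d → coeff d E = coeff d E' ∨
      (m * k + d).factorial * n < (m * (k - 1) + d).factorial * m.factorial * n ^ m * (k - 1)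
        + (m * (k - 1)).factorial * (m + d).factorial * n ^ (m + d)) :
    E = E' := by
  ext d
  induction d using Nat.strong_induction_on with
  | _ d ih =>
  rcases Nat.eq_zero_or_pos d with rfl | hd
  · simpa using h0
  rcases hres d hd with hc | hlt
  · exact hc
  have hA := AgreeAt.of_coeff ih
  set δ := coeff d E - coeff d E' with hδ
  set e := constantCoeff E' with he
  have hEe : constantCoeff E = e := h0
  have hF := (hA.X_pow_mul hm)
  obtain ⟨r, rfl⟩ : ∃ r, k = r + 2 := ⟨k - 2, by omega⟩
  have hk1 : r + 2 - 1 = r + 1 := by omega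
  have hU := (hA.pow hd r).mul hd (hF.binomCore hd (r + 1) (n - 1))
  have hW := (hA.pow hd (r + 1)).mul hd (hF.binomCore hd (r + 2) n)
  rw [map_binomCore, constantCoeff_X_pow_mul hm, binomCore_zero (by omega), mul_zero,
    add_zero] at hU hW
  have h1 := h.coeff_eq (by omega) d
  have h2 := h'.coeff_eq (by omega) d
  rw [hk1] at h1 h2
  rw [show r + 2 = r + 1 + 1 by rfl] at h1 h2
  rw [show r + 2 = r + 1 + 1 by rfl] at hW
  rw [hW.coeff_self] at h1
  have hsub := congrArg₂ (· - ·) h1 h2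
  rw [← Finset.sum_sub_distrib] at hsub
  have hne : ((d, 0) : ℕ × ℕ) ≠ (0, d) := by
    intro h; rw [Prod.mk.injEq] at h; omega
  rw [Finset.sum_eq_add_of_mem (d, 0) (0, d)
    (Finset.HasAntidiagonal.mem_antidiagonal.mpr (by simp))
    (Finset.HasAntidiagonal.mem_antidiagonal.mpr (by simp)) hne] at hsub
  swap
  · rintro ⟨i, j⟩ hij ⟨hn1, hn2⟩
    have hij' := Finset.HasAntidiagonal.mem_antidiagonal.mp hij
    simp only at hij'
    have hi : i < d := by
      rcases Nat.eq_zero_or_pos j with rfl | hj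
      · exact absurd (by rw [← hij', add_zero]) hn1
      · omega
    have hj : j < d := by
      rcases Nat.eq_zero_or_pos i with rfl | hi
      · exact absurd (by rw [← hij', zero_add]) hn2
      · omega
    rw [hU.coeff_lt hi, ih j hj, sub_self]
  simp only [add_zero] at hsub
  rw [hU.coeff_self, hA.coeff_self] at hsub
  simp only [coeff_zero_eq_constantCoeff_apply] at hsub
  rw [coeff_zero_mul_binomCore hm (by omega), coeff_zero_mul_binomCore hm (by omega), hEe] at hsub
  by_contra hcon
  have hδ0 : δ ≠ 0 := sub_ne_zero.mpr hcon
  have he0 : e ^ (r + 1) ≠ 0 := pow_ne_zero _ (hEe ▸ hE)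
  have h4 := Nat.add_one_mul_choose_eq (n - 1) (r + 1)
  rw [show n - 1 + 1 = n by omega] at h4
  have h4' : ((n : K) * (n - 1).choose (r + 1)) = n.choose (r + 2) * (r + 2) := by exact_mod_cast h4
  have h5 : ((n - 1).choose (r + 1) : K) ≠ 0 := by
    exact_mod_cast (Nat.choose_pos (by omega)).ne'
  have hfin : (((m * (r + 2) + d).factorial * n : ℕ) : K) =
      ((m * (r + 1) + d).factorial * m.factorial * n ^ m * (r + 1)
        + (m * (r + 1)).factorial * (m + d).factorial * n ^ (m + d) : ℕ) := by
    refine mul_left_cancel₀ (mul_ne_zero (mul_ne_zero hδ0 he0) h5) ?_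
    push_cast at hsub ⊢
    linear_combination -hsub + (m * (r + 2) + d).factorial * δ * e ^ (r + 1) * h4'
  rw [Nat.cast_inj] at hfin
  simp only [hk1] at hlt
  omega

end PowerSeries

theorem factorial_mul_factorial_mul_pow_gt {k n d : ℕ} (hk : 2 ≤ k) (hkn : k ≤ n) (hd : 1 ≤ d)
    (h : k < n ∨ 2 ≤ d) :
    (k - 1 + d).factorial < (k - 1).factorial * d.factorial * n ^ d := by
  obtain ⟨r, rfl⟩ : ∃ r, k = r + 2 := ⟨k - 2, by omega⟩
  rw [show r + 2 - 1 = r + 1 by omega]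
  have hstep : ∀ d, (r + 1 + d + 1) ≤ (d + 1) * n := fun d => by nlinarith [Nat.zero_le (d * r)]
  have hle : ∀ d, (r + 1 + d).factorial ≤ (r + 1).factorial * d.factorial * n ^ d := by
    intro d
    induction d with
    | zero => simp
    | succ d ih =>
      rw [← add_assoc, Nat.factorial_succ, Nat.factorial_succ d, pow_succ]
      calc _ ≤ ((d + 1) * n) * ((r + 1).factorial * d.factorial * n ^ d) :=
            Nat.mul_le_mul (hstep d) ih
        _ = _ := by ring
  obtain ⟨d, rfl⟩ : ∃ e, d = e + 1 := ⟨d - 1, by omega⟩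
  rw [← add_assoc, Nat.factorial_succ, Nat.factorial_succ d, pow_succ]
  have hlt : r + 1 + d + 1 < (d + 1) * n := by
    rcases h with h | h
    · nlinarith [Nat.zero_le (d * r)]
    · nlinarith [Nat.zero_le (d * r)]
  calc _ < ((d + 1) * n) * (r + 1 + d).factorial :=
        Nat.mul_lt_mul_of_pos_right hlt (Nat.factorial_pos _)
    _ ≤ ((d + 1) * n) * ((r + 1).factorial * d.factorial * n ^ d) :=
        Nat.mul_le_mul_left _ (hle d)
    _ = _ := by ring

/-- Nondegeneracy of the linearised equation at a simple zero. -/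
theorem nondegenerate_of_simple {k n d : ℕ} (hk : 2 ≤ k) (hkn : k ≤ n) (hd : 1 ≤ d)
    (h : k < n ∨ 2 ≤ d) :
    (1 * k + d).factorial * n < (1 * (k - 1) + d).factorial * Nat.factorial 1 * n ^ 1 * (k - 1)
        + (1 * (k - 1)).factorial * (1 + d).factorial * n ^ (1 + d) := by
  have h1 := factorial_mul_factorial_mul_pow_gt hk hkn hd h
  obtain ⟨r, rfl⟩ : ∃ r, k = r + 2 := ⟨k - 2, by omega⟩
  simp only [one_mul, Nat.factorial_one, mul_one, pow_one,
    show r + 2 - 1 = r + 1 by omega] at h1 ⊢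
  rw [show r + 2 + d = (r + 1 + d) + 1 by ring, Nat.factorial_succ, add_comm 1 d,
    Nat.factorial_succ d, pow_succ]
  have hn : 0 < n := by omega
  have h2 : (d + 1) * n * (r + 1 + d).factorial
      < (d + 1) * n * ((r + 1).factorial * d.factorial * n ^ d) :=
    Nat.mul_lt_mul_of_pos_left h1 (by positivity)
  nlinarith [h2]

theorem two_mul_sub_one_pow_mul_le (r m : ℕ) :
    (2 * r + 1) ^ m * (r + 1) * ((m + 1) * r).factorial * (m + 1).factorial
      ≤ ((m + 1) * (r + 1)).factorial := by
  have hprod : ∀ m s, (r + 1 + s) * ∏ i ∈ Finset.range s, ((m + 1) * r + 1 + i)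
      ≤ (r + 1) * ∏ i ∈ Finset.range s, ((m + 1) * (r + 1) + 1 + i) := by
    intro m s
    induction s with
    | zero => simp
    | succ s ih =>
      rw [Finset.prod_range_succ, Finset.prod_range_succ]
      have h1 : (r + 1 + (s + 1)) * ((m + 1) * r + 1 + s)
          ≤ (r + 1 + s) * ((m + 1) * (r + 1) + 1 + s) := by nlinarith [Nat.zero_le (m * s)]
      calc _ = ((r + 1 + (s + 1)) * ((m + 1) * r + 1 + s)) *
              ∏ i ∈ Finset.range s, ((m + 1) * r + 1 + i) := by ring
        _ ≤ ((r + 1 + s) * ((m + 1) * (r + 1) + 1 + s)) *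
              ∏ i ∈ Finset.range s, ((m + 1) * r + 1 + i) := Nat.mul_le_mul_right _ h1
        _ = ((m + 1) * (r + 1) + 1 + s) *
              ((r + 1 + s) * ∏ i ∈ Finset.range s, ((m + 1) * r + 1 + i)) := by ring
        _ ≤ ((m + 1) * (r + 1) + 1 + s) *
              ((r + 1) * ∏ i ∈ Finset.range s, ((m + 1) * (r + 1) + 1 + i)) :=
            Nat.mul_le_mul_left _ ih
        _ = _ := by ring
  induction m with
  | zero => simp [Nat.factorial_succ]
  | succ m ih =>
    have e1 : ((m + 1 + 1) * r).factorial = ((m + 1) * r).factorial *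
        ∏ i ∈ Finset.range r, ((m + 1) * r + 1 + i) := by
      rw [← Nat.ascFactorial_eq_prod_range, Nat.factorial_mul_ascFactorial]
      congr 1; ring
    have e2 : ((m + 1 + 1) * (r + 1)).factorial = ((m + 1) * (r + 1)).factorial *
        ((∏ i ∈ Finset.range r, ((m + 1) * (r + 1) + 1 + i)) * ((m + 1) * (r + 1) + 1 + r)) := by
      rw [← Finset.prod_range_succ, ← Nat.ascFactorial_eq_prod_range,
        Nat.factorial_mul_ascFactorial]
      congr 1; ring
    rw [e1, e2, Nat.factorial_succ (m + 1)]
    have h2 := hprod m r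
    rw [show r + 1 + r = 2 * r + 1 by ring] at h2
    calc _ = ((2 * r + 1) ^ m * (r + 1) * ((m + 1) * r).factorial * (m + 1).factorial) *
          (((2 * r + 1) * ∏ i ∈ Finset.range r, ((m + 1) * r + 1 + i)) * (m + 2)) := by ring
      _ ≤ ((m + 1) * (r + 1)).factorial *
          (((r + 1) * ∏ i ∈ Finset.range r, ((m + 1) * (r + 1) + 1 + i)) * (m + 2)) :=
          Nat.mul_le_mul ih (Nat.mul_le_mul_right _ h2)
      _ = _ := by ring

theorem two_mul_le_of_leading {k n m : ℕ} (hk : 2 ≤ k) (hn : 1 ≤ n) (hm : 2 ≤ m)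
    (h : (m * (k - 1)).factorial * m.factorial * n ^ m * k = (m * k).factorial * n) :
    2 * k ≤ n + 1 := by
  obtain ⟨r, rfl⟩ : ∃ r, k = r + 1 := ⟨k - 1, by omega⟩
  obtain ⟨s, rfl⟩ : ∃ s, m = s + 1 := ⟨m - 1, by omega⟩
  rw [Nat.add_sub_cancel] at h
  have h1 := two_mul_sub_one_pow_mul_le r s
  have h2 : n ^ s * (r + 1) * ((s + 1) * r).factorial * (s + 1).factorial
      = ((s + 1) * (r + 1)).factorial := by
    refine Nat.eq_of_mul_eq_mul_right (show 0 < n by omega) ?_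
    rw [← h, pow_succ]; ring
  rw [← h2] at h1
  have h3 : (2 * r + 1) ^ s ≤ n ^ s := by
    refine Nat.le_of_mul_le_mul_right (c := (r + 1) * ((s + 1) * r).factorial * (s + 1).factorial)
      ?_ (by positivity)
    calc _ = _ := by ring
      _ ≤ _ := h1
      _ = _ := by ring
  have h4 := (Nat.pow_le_pow_iff_left (show s ≠ 0 by omega)).mp h3
  omega

/-- Nondegeneracy of the linearised equation at a multiple zero. -/
theorem nondegenerate_of_multiple {k n m d : ℕ} (hk : 2 ≤ k) (hm : 1 ≤ m) (hd : 1 ≤ d)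
    (hn : 2 * k ≤ n + 1)
    (h : (m * (k - 1)).factorial * m.factorial * n ^ m * k = (m * k).factorial * n) :
    (m * k + d).factorial * n < (m * (k - 1) + d).factorial * m.factorial * n ^ m * (k - 1)
        + (m * (k - 1)).factorial * (m + d).factorial * n ^ (m + d) := by
  obtain ⟨r, rfl⟩ : ∃ r, k = r + 1 := ⟨k - 1, by omega⟩
  rw [Nat.add_sub_cancel] at h ⊢
  have hn' : 2 * r + 1 ≤ n := by omega
  have hr : 1 ≤ r := by omega
  set a : ℕ → ℕ := fun d => (m * r + d).factorial * m.factorial * n ^ m with ha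
  set b : ℕ → ℕ := fun d => (m * r).factorial * (m + d).factorial * n ^ (m + d) with hb
  set c : ℕ → ℕ := fun d => (m * (r + 1) + d).factorial * n with hc
  have ha1 : ∀ d, a (d + 1) = (m * r + d + 1) * a d := fun d => by
    simp only [ha]; rw [← add_assoc, Nat.factorial_succ]; ring
  have hb1 : ∀ d, b (d + 1) = n * (m + d + 1) * b d := fun d => by
    simp only [hb]; rw [← add_assoc, Nat.factorial_succ, pow_succ]; ring
  have hc1 : ∀ d, c (d + 1) = (m * (r + 1) + d + 1) * c d := fun d => by
    simp only [hc]; rw [← add_assoc, Nat.factorial_succ]; ring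
  have hbpos : ∀ d, 0 < b d := fun d => by
    have : 0 < n := by omega
    simp only [hb]; positivity
  have hstep : ∀ d, (2 * r + 1) * (m + d + 1) ≤ n * (m + d + 1) := fun d =>
    Nat.mul_le_mul_right _ hn'
  have hab : ∀ d, a d ≤ b d := by
    intro d
    induction d with
    | zero => simp only [ha, hb, add_zero, le_refl]
    | succ d ih =>
      rw [ha1, hb1]
      refine Nat.mul_le_mul (le_trans ?_ (hstep d)) ih
      nlinarith [Nat.zero_le (m * r), Nat.zero_le (r * d)]
  have hinc : ∀ d, c d ≤ r * a d + b d → c (d + 1) < r * a (d + 1) + b (d + 1) := by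
    intro d hle
    rw [ha1, hb1, hc1]
    have h1 : (m * (r + 1) + d + 1) * c d ≤ (m * (r + 1) + d + 1) * (r * a d + b d) :=
      Nat.mul_le_mul_left _ hle
    have h2 : (2 * r + 1) * (m + d + 1) * b d ≤ n * (m + d + 1) * b d :=
      Nat.mul_le_mul_right _ (hstep d)
    have h3 : r * m * a d ≤ r * m * b d := Nat.mul_le_mul_left _ (hab d)
    have h4 : 0 < r * b d := Nat.mul_pos hr (hbpos d)
    nlinarith [Nat.zero_le (r * d * b d)]
  have h0 : c 0 ≤ r * a 0 + b 0 := by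
    simp only [ha, hb, hc, add_zero]
    rw [← h]
    apply le_of_eq; ring
  have hall : ∀ d, c d ≤ r * a d + b d := by
    intro d
    induction d with
    | zero => exact h0
    | succ d ih => exact (hinc d ih).le
  obtain ⟨e, rfl⟩ : ∃ e, d = e + 1 := ⟨d - 1, by omega⟩
  have := hinc e (hall e)
  simp only [ha, hb, hc] at this
  rw [mul_comm r] at this
  exact this

theorem binomTail_sub_succ {R : Type*} [CommRing R] {k n : ℕ} (hkn : k ≤ n) (u : R) :
    binomTail k n u = n.choose k * u ^ k * (1 - u) ^ (n - k) + binomTail (k + 1) n u := by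
  rw [binomTail, binomTail, ← Finset.insert_Icc_add_one_left_eq_Icc hkn,
    Finset.sum_insert (by simp)]

theorem binomTail_self {R : Type*} [CommRing R] (n : ℕ) (u : R) : binomTail n n u = u ^ n := by
  simp [binomTail]

theorem binomTail_sub_binomTail_succ {R : Type*} [CommRing R] {k n : ℕ} (hkn : k ≤ n) (u : R) :
    binomTail k n u - binomTail (k + 1) (n + 1) u
      = n.choose k * u ^ k * (1 - u) ^ (n + 1 - k) := by
  obtain ⟨s, rfl⟩ := Nat.exists_eq_add_of_le hkn
  induction s generalizing k with
  | zero => simp [binomTail_self]; ring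
  | succ s ih =>
    have h1 := ih (k := k + 1) (by omega)
    rw [show k + 1 + s = k + (s + 1) by ring] at h1
    rw [binomTail_sub_succ hkn, binomTail_sub_succ (k := k + 1) (n := k + (s + 1) + 1) (by omega)]
    have h2 : ((k + (s + 1) + 1).choose (k + 1) : R) =
        (k + (s + 1)).choose k + (k + (s + 1)).choose (k + 1) := by
      rw [← Nat.cast_add]
      exact congrArg _ (Nat.choose_succ_succ _ _)
    rw [h2]
    have e1 : k + (s + 1) - k = s + 1 := by omega
    have e2 : k + (s + 1) + 1 - (k + 1) = s + 1 := by omega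
    have e3 : k + (s + 1) + 1 - k = s + 2 := by omega
    rw [e2] at h1
    rw [e1, e2, e3]
    linear_combination h1

theorem derivation_binomTail {S A : Type*} [CommRing S] [CommRing A] [Algebra S A]
    (D : Derivation S A A) {k n : ℕ} (hkn : k ≤ n) (u : A) :
    D (binomTail (k + 1) (n + 1) u) = (n + 1) * n.choose k * u ^ k * (1 - u) ^ (n - k) * D u := by
  obtain ⟨s, rfl⟩ := Nat.exists_eq_add_of_le hkn
  induction s generalizing k with
  | zero =>
    rw [add_zero, binomTail_self, Derivation.leibniz_pow]
    simp
    ring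
  | succ s ih =>
    have h1 := ih (k := k + 1) (by omega)
    rw [show k + 1 + s = k + (s + 1) by ring] at h1
    rw [binomTail_sub_succ (by omega), map_add, h1]
    have e1 : k + (s + 1) - k = s + 1 := by omega
    have e2 : k + (s + 1) + 1 - (k + 1) = s + 1 := by omega
    have e3 : k + (s + 1) - (k + 1) = s := by omega
    rw [e1, e2, e3]
    have h3 : ((k + (s + 1) + 1) * (k + (s + 1)).choose k : A)
        = (k + (s + 1) + 1).choose (k + 1) * (k + 1) := by
      simpa using congrArg (Nat.cast (R := A)) (Nat.add_one_mul_choose_eq (k + (s + 1)) k)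
    have h4 : ((k + (s + 1) + 1 : A) * (k + (s + 1)).choose (k + 1))
        = (k + (s + 1) + 1).choose (k + 1) * (s + 1) := by
      have h := Nat.choose_mul_succ_eq (k + (s + 1)) (k + 1)
      rw [e2] at h
      rw [mul_comm]
      simpa using congrArg (Nat.cast (R := A)) h
    rw [Derivation.leibniz, Derivation.leibniz, Derivation.leibniz_pow, Derivation.leibniz_pow,
      map_sub, Derivation.map_natCast, Derivation.map_one_eq_zero]
    simp only [smul_eq_mul, nsmul_eq_mul, Nat.add_sub_cancel]
    push_cast at h3 h4 ⊢
    linear_combination (-(u ^ k * (1 - u) ^ (s + 1) * D u)) * h3 + (u ^ (k + 1) * (1 - u) ^ s * D u) * h4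

namespace PowerSeries

theorem rescale_borelMul {K : Type*} [Field K] (c : K) (P Q : PowerSeries K) :
    rescale c (P.borelMul Q) = (rescale c P).borelMul (rescale c Q) := by
  ext D
  rw [coeff_rescale, borelMul, borelMul, coeff_mk, coeff_mk, Finset.mul_sum]
  refine Finset.sum_congr rfl fun p hp => ?_
  rw [coeff_rescale, coeff_rescale, ← Finset.HasAntidiagonal.mem_antidiagonal.mp hp]
  ring

theorem map_borelMul {K L : Type*} [Field K] [Field L] (φ : K →+* L) (P Q : PowerSeries K) :
    map φ (P.borelMul Q) = (map φ P).borelMul (map φ Q) := by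
  ext D
  simp [borelMul, coeff_mk]

theorem IsOrderStatSolution.rescale {K : Type*} [Field K] {k n : ℕ} {F : PowerSeries K}
    (h : IsOrderStatSolution k n F) (c : K) : IsOrderStatSolution k n (PowerSeries.rescale c F) := by
  unfold IsOrderStatSolution at h ⊢
  rw [← map_binomTail, ← map_binomTail, ← h, rescale_borelMul, rescale_rescale, rescale_rescale,
    mul_comm]

theorem IsOrderStatSolution.map {K L : Type*} [Field K] [Field L] (φ : K →+* L) {k n : ℕ}
    {F : PowerSeries K} (h : IsOrderStatSolution k n F) :
    IsOrderStatSolution k n (PowerSeries.map φ F) := by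
  unfold IsOrderStatSolution at h ⊢
  rw [← map_binomTail, ← map_binomTail, ← h, map_borelMul]
  congr 1
  ext q
  simp [coeff_rescale]

/-- A solution with a zero of order `m ≥ 2` at the origin is a power series in `X ^ m`. -/
theorem IsOrderStatSolution.coeff_eq_zero_of_not_dvd {k n m : ℕ} (hk : 2 ≤ k) (hkn : k ≤ n)
    (hm : 2 ≤ m) {E : PowerSeries ℝ} (hE : constantCoeff E ≠ 0)
    (h : IsOrderStatSolution k n (X ^ m * E)) {d : ℕ} (hd : ¬m ∣ d) : coeff d E = 0 := by
  have hlead := h.leading hk hkn (by omega) hE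
  have hζ := Complex.isPrimitiveRoot_exp m (by omega)
  set ζ := Complex.exp (2 * Real.pi * Complex.I / m)
  set E₁ := PowerSeries.map Complex.ofRealHom E with hE₁
  have h1 : IsOrderStatSolution k n (X ^ m * E₁) := by
    have := h.map Complex.ofRealHom
    rwa [map_mul, map_pow, map_X] at this
  have h2 : IsOrderStatSolution k n (X ^ m * PowerSeries.rescale ζ E₁) := by
    have := h1.rescale ζ
    rw [map_mul, map_pow, rescale_X, mul_pow, ← map_pow, hζ.pow_eq_one, map_one, one_mul] at this
    exact this
  have h0 : constantCoeff E₁ ≠ 0 := by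
    rw [hE₁, ← coeff_zero_eq_constantCoeff_apply, coeff_map, coeff_zero_eq_constantCoeff_apply]
    simpa using hE
  have h3 : E₁ = PowerSeries.rescale ζ E₁ := by
    refine IsOrderStatSolution.unique hk hkn (by omega) h0 h1 h2 ?_ fun d hd => Or.inr
      (nondegenerate_of_multiple hk (by omega) hd
        (two_mul_le_of_leading hk (by omega) hm hlead) hlead)
    rw [← coeff_zero_eq_constantCoeff_apply, ← coeff_zero_eq_constantCoeff_apply, coeff_rescale,
      pow_zero, one_mul]
  have h4 := congrArg (coeff d) h3
  rw [coeff_rescale, hE₁, coeff_map] at h4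
  have h5 : (1 - ζ ^ d) * ((coeff d E : ℝ) : ℂ) = 0 := by
    rw [sub_mul, one_mul, sub_eq_zero]
    exact h4
  rcases mul_eq_zero.mp h5 with h6 | h6
  · exact absurd (hζ.dvd_of_pow_eq_one d (sub_eq_zero.mp h6).symm) hd
  · exact_mod_cast h6

/-- The power series of `c (1 - exp (-l x)) / l`. -/
noncomputable def expSol (c l : ℝ) : PowerSeries ℝ :=
  mk fun q => if q = 0 then 0 else c * (-l) ^ (q - 1) / q.factorial

theorem coeff_expSol_zero (c l : ℝ) : coeff 0 (expSol c l) = 0 := by simp [expSol]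

theorem coeff_expSol_succ (c l : ℝ) (q : ℕ) :
    coeff (q + 1) (expSol c l) = c * (-l) ^ q / (q + 1).factorial := by simp [expSol]

theorem derivative_expSol (c l : ℝ) :
    PowerSeries.derivative ℝ (expSol c l) = C c - C l * expSol c l := by
  ext q
  rw [coeff_derivative, map_sub, coeff_C_mul, coeff_C,
    coeff_expSol_succ]
  rcases q with _ | q
  · simp [coeff_expSol_zero]
  · rw [coeff_expSol_succ, if_neg (by omega), Nat.factorial_succ (q + 1)]
    push_cast
    field_simp
    ring

theorem coeff_succ_borelMul_rescale_expSol (c l a : ℝ) (P : PowerSeries ℝ) (D : ℕ) :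
    coeff (D + 1) (P.borelMul (rescale a (expSol c l)))
      = a * c * (∑ p ∈ Finset.HasAntidiagonal.antidiagonal D,
          p.1.factorial * coeff p.1 P * (-(a * l)) ^ p.2) / (D + 1).factorial := by
  rw [borelMul, coeff_mk, Finset.Nat.sum_antidiagonal_succ', Finset.mul_sum, Finset.sum_div]
  simp only [coeff_rescale, coeff_expSol_zero, mul_zero, zero_add]
  refine Finset.sum_congr rfl fun p _ => ?_
  rw [coeff_expSol_succ]
  have : ((p.2 + 1).factorial : ℝ) ≠ 0 := by positivity
  field_simp
  ring

theorem coeff_zero_borelMul_rescale_expSol (c l a : ℝ) (P : PowerSeries ℝ) :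
    coeff 0 (P.borelMul (rescale a (expSol c l))) = 0 := by
  rw [borelMul, coeff_mk, Finset.HasAntidiagonal.antidiagonal_zero, Finset.sum_singleton,
    coeff_rescale, coeff_expSol_zero]
  simp

theorem derivative_borelMul_rescale_expSol (c l a : ℝ) (P : PowerSeries ℝ) :
    PowerSeries.derivative ℝ (P.borelMul (rescale a (expSol c l)))
      = C (a * c) * P - C (a * l) * P.borelMul (rescale a (expSol c l)) := by
  ext D
  rw [coeff_derivative, map_sub, coeff_C_mul, coeff_C_mul,
    coeff_succ_borelMul_rescale_expSol]
  rcases D with _ | D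
  · rw [coeff_zero_borelMul_rescale_expSol, Finset.HasAntidiagonal.antidiagonal_zero,
      Finset.sum_singleton]
    simp
  · rw [coeff_succ_borelMul_rescale_expSol, Finset.Nat.sum_antidiagonal_succ']
    have h : ∑ p ∈ Finset.HasAntidiagonal.antidiagonal D,
        (p.1.factorial * coeff p.1 P * (-(a * l)) ^ (p.2 + 1) : ℝ)
        = -(a * l) * ∑ p ∈ Finset.HasAntidiagonal.antidiagonal D,
          p.1.factorial * coeff p.1 P * (-(a * l)) ^ p.2 := by
      rw [Finset.mul_sum]
      refine Finset.sum_congr rfl fun p _ => ?_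
      ring
    rw [h, Nat.factorial_succ (D + 1)]
    push_cast
    have : ((D + 1).factorial : ℝ) ≠ 0 := by positivity
    field_simp
    ring

theorem eq_of_derivative_add_eq {b : ℝ} {Y Z W : PowerSeries ℝ} (h0 : coeff 0 Y = coeff 0 Z)
    (hY : PowerSeries.derivative ℝ Y = W - C b * Y)
    (hZ : PowerSeries.derivative ℝ Z = W - C b * Z) : Y = Z := by
  ext q
  induction q with
  | zero => exact h0
  | succ q ih =>
    have h1 := congrArg (coeff q) hY
    have h2 := congrArg (coeff q) hZ
    rw [coeff_derivative, map_sub, coeff_C_mul] at h1 h2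
    have h3 : (q + 1 : ℝ) ≠ 0 := by positivity
    refine mul_right_cancel₀ h3 ?_
    rw [h1, h2, ih]

theorem isOrderStatSolution_expSol {k n : ℕ} (hk : 2 ≤ k) (hkn : k ≤ n) {c l : ℝ}
    (h : n = k ∨ l = c) : IsOrderStatSolution k n (expSol c l) := by
  obtain ⟨r, rfl⟩ : ∃ r, k = r + 1 := ⟨k - 1, by omega⟩
  obtain ⟨s, rfl⟩ : ∃ s, n = s + 1 := ⟨n - 1, by omega⟩
  unfold IsOrderStatSolution
  rw [Nat.add_sub_cancel, Nat.add_sub_cancel]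
  refine eq_of_derivative_add_eq (b := ((s + 1 : ℕ) : ℝ) * l)
    (W := C (((s + 1 : ℕ) : ℝ) * c) * binomTail r s (expSol c l)) ?_
    (derivative_borelMul_rescale_expSol _ _ _ _) ?_
  · rw [coeff_zero_borelMul_rescale_expSol, coeff_zero_eq_constantCoeff_apply, map_binomTail,
      ← coeff_zero_eq_constantCoeff_apply, coeff_expSol_zero, binomTail_zero (by omega)]
  · rw [derivation_binomTail _ (by omega), derivative_expSol]
    have hsr : r ≤ s := by omega
    have h1 := binomTail_sub_binomTail_succ hsr (expSol c l)
    have e : s + 1 - r = (s - r) + 1 := by omega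
    rw [e, pow_succ] at h1
    rw [map_mul, map_mul, map_natCast]
    push_cast
    rcases h with h | rfl
    · have hrs : s = r := by omega
      subst hrs
      rw [binomTail_self, binomTail_self]
      simp
      ring
    · linear_combination ((s : PowerSeries ℝ) + 1) * C l * (-h1)

theorem hasSum_expSol (c l x : ℝ) :
    HasSum (fun q : ℕ => l * (coeff q (expSol c l) * x ^ q)) (c * (1 - Real.exp (-(l * x)))) := by
  have h1 : HasSum (fun q : ℕ => (-(l * x)) ^ q / q.factorial) (Real.exp (-(l * x))) := by
    rw [Real.exp_eq_exp_ℝ]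
    exact NormedSpace.expSeries_div_hasSum_exp _
  have h2 := ((hasSum_ite_eq (0 : ℕ) (1 : ℝ)).sub h1).mul_left c
  refine (congrArg (HasSum · _) (funext fun q => ?_)).mpr h2
  rcases q with _ | q
  · simp [coeff_expSol_zero]
  · rw [coeff_expSol_succ, if_neg (by omega)]
    field_simp
    ring

/-- A solution with a simple zero at the origin is of exponential form. -/
theorem IsOrderStatSolution.exists_eq_expSol {k n : ℕ} (hk : 2 ≤ k) (hkn : k ≤ n)
    {E : PowerSeries ℝ} (hE : constantCoeff E ≠ 0) (h : IsOrderStatSolution k n (X ^ 1 * E)) :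
    ∃ l : ℝ, X ^ 1 * E = expSol (constantCoeff E) l := by
  set c := constantCoeff E with hc
  obtain ⟨l, hl, hl2⟩ : ∃ l : ℝ, (n = k ∨ l = c) ∧ (k < n ∨ coeff 1 E = c * (-l) / 2) := by
    rcases hkn.eq_or_lt with heq | hlt
    · refine ⟨-(2 * coeff 1 E / c), Or.inl heq.symm, Or.inr ?_⟩
      field_simp
    · exact ⟨c, Or.inr rfl, Or.inl hlt⟩
  have hsol := isOrderStatSolution_expSol hk hkn hl
  set E' : PowerSeries ℝ := mk fun q => c * (-l) ^ q / (q + 1).factorial with hE'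
  have hX : X ^ 1 * E' = expSol c l := by
    ext q
    rcases q with _ | q
    · simp [coeff_expSol_zero]
    · rw [coeff_expSol_succ, pow_one, coeff_succ_X_mul, hE', coeff_mk]
  refine ⟨l, ?_⟩
  rw [← hX] at hsol ⊢
  congr 1
  refine IsOrderStatSolution.unique hk hkn le_rfl hE h hsol ?_ fun d hd => ?_
  · rw [← coeff_zero_eq_constantCoeff_apply E', hE', coeff_mk]
    simp [hc]
  · rcases hl2 with hlt | h1
    · exact Or.inr (nondegenerate_of_simple hk hkn hd (Or.inl hlt))
    · rcases hd.eq_or_lt with rfl | hd2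
      · left
        rw [h1, hE', coeff_mk]
        simp
      · exact Or.inr (nondegenerate_of_simple hk hkn hd (Or.inr hd2))

end PowerSeries

theorem eq_expMeasure_of_entireSum_expSol {ν : Measure ℝ} [IsProbabilityMeasure ν]
    (h0 : cdf ν 0 = 0) {c l : ℝ} (hc : 0 < c) (h : (PowerSeries.expSol c l).EntireSum (cdf ν)) :
    ∃ r : ℝ, 0 < r ∧ ν = expMeasure r := by
  have key : ∀ x : ℝ, 0 < x → l * cdf ν x = c * (1 - Real.exp (-(l * x))) := fun x hx =>
    ((h x hx).mul_left l).unique (PowerSeries.hasSum_expSol c l x)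
  have hl : 0 < l := by
    by_contra hl
    have hx : 0 < 2 / c := by positivity
    have h1 : (2 : ℝ) ≤ cdf ν (2 / c) := by
      rcases (not_lt.mp hl).eq_or_lt with rfl | hl
      · have h2 := h _ hx
        have h3 : HasSum (fun q : ℕ => PowerSeries.coeff q (PowerSeries.expSol c 0) * (2 / c) ^ q)
            (PowerSeries.coeff 1 (PowerSeries.expSol c 0) * (2 / c) ^ 1) := by
          refine hasSum_single 1 fun q hq => ?_
          rcases q with _ | q
          · simp [PowerSeries.coeff_expSol_zero]
          · rw [PowerSeries.coeff_expSol_succ]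
            have : q ≠ 0 := by omega
            simp [this]
        have h4 := h2.unique h3
        rw [PowerSeries.coeff_expSol_succ] at h4
        rw [h4]
        simp
        field_simp
        rfl
      · have h2 := key _ hx
        have h3 := Real.add_one_le_exp (-(l * (2 / c)))
        have h4 : l * (2 / c) * c = l * 2 := by field_simp
        nlinarith
    linarith [cdf_le_one ν (2 / c)]
  have hlim : Filter.Tendsto (fun x => c * (1 - Real.exp (-(l * x)))) Filter.atTop
      (nhds (c * (1 - 0))) := by
    refine ((Filter.Tendsto.const_sub 1 ?_)).const_mul c
    exact Real.tendsto_exp_neg_atTop_nhds_zero.comp (Filter.tendsto_id.const_mul_atTop hl)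
  have hlim2 : Filter.Tendsto (fun x => l * cdf ν x) Filter.atTop (nhds (l * 1)) :=
    (tendsto_cdf_atTop ν).const_mul l
  have hlc : l = c := by
    have := tendsto_nhds_unique (hlim2.congr' ?_) hlim
    · simpa using this
    · filter_upwards [Filter.eventually_gt_atTop 0] with x hx using key x hx
  refine ⟨l, hl, ?_⟩
  have := isProbabilityMeasure_expMeasure hl
  refine Measure.eq_of_cdf _ _ ?_
  ext x
  rw [cdf_expMeasure_eq hl]
  rcases lt_or_ge 0 x with hx | hx
  · rw [if_pos hx.le]
    have := key x hx
    rw [← hlc] at this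
    exact mul_left_cancel₀ hl.ne' this
  · rw [cdf_eq_zero_of_nonpos h0 hx]
    split_ifs with hx'
    · rw [le_antisymm hx hx']; simp
    · rfl

namespace PowerSeries

/-- Up to degree `N`, the coefficients of `f` are bounded by those of `g`. -/
def MajUpTo (N : ℕ) (f g : PowerSeries ℝ) : Prop := ∀ i ≤ N, |coeff i f| ≤ coeff i g

namespace MajUpTo

variable {N : ℕ} {f g f' g' h : PowerSeries ℝ}

theorem add (h₁ : MajUpTo N f g) (h₂ : MajUpTo N f' g') : MajUpTo N (f + f') (g + g') := by
  intro i hi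
  rw [map_add, map_add]
  exact (abs_add_le _ _).trans (add_le_add (h₁ i hi) (h₂ i hi))

theorem mul (h₁ : MajUpTo N f g) (h₂ : MajUpTo N f' g') : MajUpTo N (f * f') (g * g') := by
  intro i hi
  rw [coeff_mul, coeff_mul]
  refine (Finset.abs_sum_le_sum_abs _ _).trans (Finset.sum_le_sum fun p hp => ?_)
  have hp' := Finset.HasAntidiagonal.mem_antidiagonal.mp hp
  rw [abs_mul]
  have h3 := h₁ p.1 (by omega)
  exact mul_le_mul h3 (h₂ p.2 (by omega)) (abs_nonneg _) ((abs_nonneg _).trans h3)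

theorem one : MajUpTo N (1 : PowerSeries ℝ) 1 := by
  intro i _
  rw [coeff_one]
  split_ifs <;> simp

theorem pow (h₁ : MajUpTo N f g) (p : ℕ) : MajUpTo N (f ^ p) (g ^ p) := by
  induction p with
  | zero => simpa using one
  | succ p ih => rw [pow_succ, pow_succ]; exact ih.mul h₁

theorem C_mul {c : ℝ} (hc : 0 ≤ c) (h₁ : MajUpTo N f g) : MajUpTo N (C c * f) (C c * g) := by
  intro i hi
  rw [coeff_C_mul, coeff_C_mul, abs_mul, abs_of_nonneg hc]
  exact mul_le_mul_of_nonneg_left (h₁ i hi) hc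

theorem trans (h₁ : MajUpTo N f g) (h₂ : MajUpTo N g h) : MajUpTo N f h := fun i hi =>
  (h₁ i hi).trans ((le_abs_self _).trans (h₂ i hi))

end MajUpTo

/-- `X ^ m * expTail m A` is the tail of `m! / A ^ m * exp (A X)`. -/
noncomputable def expTail (m : ℕ) (A : ℝ) : PowerSeries ℝ :=
  mk fun i => m.factorial * A ^ i / (m + i).factorial

theorem coeff_one_add_expTail_pow {m i p : ℕ} {A η : ℝ} (hA : 0 < A) (hη : 0 ≤ η) (hη1 : η ≤ 1)
    (hi : 1 ≤ i) :
    coeff i ((1 + C η * expTail m A) ^ p) * (m * p + i).factorial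
      ≤ η * (3 ^ p * m.factorial ^ p) * (A ^ i * (p : ℝ) ^ (m * p + i)) := by
  set g : PowerSeries ℝ := C (m.factorial / A ^ m) * rescale A (exp ℝ) with hg
  have hfac : ∀ j : ℕ, (0 : ℝ) < (j.factorial : ℝ) := fun j => by positivity
  have hgc : ∀ j, coeff j g = m.factorial / A ^ m * (A ^ j / j.factorial) := by
    intro j
    rw [hg, coeff_C_mul, coeff_rescale, coeff_exp]
    simp [div_eq_mul_inv]
  have hu : ∀ N, MajUpTo N (X ^ m) g := by
    intro N j _
    rw [hgc, coeff_X_pow]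
    split_ifs with h
    · rw [h, abs_one]
      have := hfac m
      apply le_of_eq
      field_simp
    · rw [abs_zero]; positivity
  have hv : ∀ N, MajUpTo N (X ^ m * expTail m A) g := by
    intro N j _
    rw [hgc, coeff_X_pow_mul']
    split_ifs with h
    · rw [expTail, coeff_mk, Nat.add_sub_of_le h, abs_of_nonneg (by positivity)]
      apply le_of_eq
      have e : A ^ j = A ^ m * A ^ (j - m) := by rw [← pow_add, Nat.add_sub_of_le h]
      have := hfac j
      rw [e]
      field_simp
    · rw [abs_zero]; positivity
  have hkey : ∀ N p, MajUpTo N ((X ^ m + C η * (X ^ m * expTail m A)) ^ p)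
      ((X ^ m) ^ p + C (η * 3 ^ p) * g ^ p) := by
    intro N p
    induction p with
    | zero =>
      intro j _
      simp only [pow_zero, map_add, mul_one, coeff_one, coeff_C]
      split_ifs
      · rw [abs_one]; linarith
      · simp
    | succ p ih =>
      have h1 := ih.mul (show MajUpTo N (X ^ m + C η * (X ^ m * expTail m A))
        (X ^ m + C η * (X ^ m * expTail m A)) from fun j _ => by
          refine le_of_eq (abs_of_nonneg ?_)
          rw [map_add, coeff_C_mul, coeff_X_pow, coeff_X_pow_mul', expTail]
          have : 0 ≤ if m ≤ j then coeff (j - m)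
              (mk fun i => m.factorial * A ^ i / (m + i).factorial : PowerSeries ℝ) else 0 := by
            split_ifs
            · rw [coeff_mk]; positivity
            · exact le_rfl
          have h2 : (0 : ℝ) ≤ if j = m then 1 else 0 := by split_ifs <;> norm_num
          positivity)
      rw [← pow_succ] at h1
      refine h1.trans ?_
      have e : ((X ^ m) ^ p + C (η * 3 ^ p) * g ^ p) * (X ^ m + C η * (X ^ m * expTail m A))
          = (X ^ m) ^ (p + 1) + (C η * ((X ^ m) ^ p * (X ^ m * expTail m A))
            + C (η * 3 ^ p) * (g ^ p * X ^ m)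
            + C (η * 3 ^ p * η) * (g ^ p * (X ^ m * expTail m A))) := by
        simp only [map_mul]; ring
      rw [e]
      refine MajUpTo.add (MajUpTo.pow (fun j _ => ?_) _) ?_
      · rw [coeff_X_pow]; split_ifs <;> simp
      have hgg : MajUpTo N g g := (fun j _ => by rw [abs_of_nonneg]; rw [hgc]; positivity)
      have h2 := (((hu N).pow p).mul (hv N)).C_mul hη
      have h3 := ((hgg.pow p).mul (hu N)).C_mul (show 0 ≤ η * 3 ^ p by positivity)
      have h4 := ((hgg.pow p).mul (hv N)).C_mul (show 0 ≤ η * 3 ^ p * η by positivity)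
      have h5 := (h2.add h3).add h4
      refine h5.trans fun j hj => ?_
      have hgp : 0 ≤ coeff j (g ^ p * g) :=
        (abs_nonneg _).trans ((hgg.pow p).mul hgg j hj)
      rw [pow_succ g p, map_add, map_add, coeff_C_mul, coeff_C_mul, coeff_C_mul, coeff_C_mul,
        abs_of_nonneg (by positivity)]
      have h6 : η + η * 3 ^ p + η * 3 ^ p * η ≤ η * 3 ^ (p + 1) := by
        have h7 : (1 : ℝ) ≤ 3 ^ p := one_le_pow₀ (by norm_num)
        have h8 : η * 3 ^ p * η ≤ η * 3 ^ p := mul_le_of_le_one_right (by positivity) hη1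
        have h9 : η * 1 ≤ η * 3 ^ p := mul_le_mul_of_nonneg_left h7 hη
        rw [pow_succ]; linarith
      calc _ = (η + η * 3 ^ p + η * 3 ^ p * η) * coeff j (g ^ p * g) := by ring
        _ ≤ _ := mul_le_mul_of_nonneg_right h6 hgp
  have h1 := hkey (m * p + i) p (m * p + i) le_rfl
  have e1 : (X ^ m + C η * (X ^ m * expTail m A)) ^ p
      = X ^ (m * p) * (1 + C η * expTail m A) ^ p := by
    rw [pow_mul, ← mul_pow]; congr 1; ring
  have e2 : g ^ p = C ((m.factorial / A ^ m) ^ p) * rescale (p * A) (exp ℝ) := by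
    rw [hg, mul_pow, ← map_pow, ← map_pow, exp_pow_eq_rescale_exp, rescale_rescale]
  rw [e1, coeff_X_pow_mul', if_pos (Nat.le_add_right _ _), Nat.add_sub_cancel_left, map_add,
    ← pow_mul, coeff_X_pow, if_neg (by omega), zero_add, coeff_C_mul, e2, coeff_C_mul,
    coeff_rescale, coeff_exp] at h1
  have h2 := (le_abs_self _).trans h1
  have hf := hfac (m * p + i)
  calc _ ≤ (η * 3 ^ p * ((m.factorial / A ^ m) ^ p * ((p * A) ^ (m * p + i) *
        (algebraMap ℚ ℝ) (1 / ((m * p + i).factorial : ℚ))))) * (m * p + i).factorial :=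
        mul_le_mul_of_nonneg_right h2 hf.le
    _ = _ := by
      simp only [one_div, map_inv₀, map_natCast, div_pow, mul_pow, ← pow_mul, pow_add]
      field_simp

/-- Bounds `(m + i)! |coeff i E| ≤ η e₀ m! A ^ i` are inherited by the powers of `E`. -/
theorem abs_coeff_pow_le {m d p i : ℕ} {A η : ℝ} (hA : 0 < A) (hη : 0 ≤ η) (hη1 : η ≤ 1)
    {E : PowerSeries ℝ} (hE : 0 < constantCoeff E)
    (h : ∀ i, 1 ≤ i → i ≤ d →
      (m + i).factorial * |coeff i E| ≤ η * (constantCoeff E * m.factorial) * A ^ i)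
    (hi : 1 ≤ i) (hid : i ≤ d) :
    (m * p + i).factorial * |coeff i (E ^ p)|
      ≤ η * (constantCoeff E ^ p * (3 ^ p * m.factorial ^ p)) * (A ^ i * (p : ℝ) ^ (m * p + i)) := by
  set e := constantCoeff E with he
  have h1 : MajUpTo d E (C e * (1 + C η * expTail m A)) := by
    intro j hj
    rw [coeff_C_mul, map_add, coeff_C_mul, expTail, coeff_mk, coeff_one]
    rcases Nat.eq_zero_or_pos j with rfl | hj0
    · rw [coeff_zero_eq_constantCoeff_apply, ← he, abs_of_pos hE, if_pos rfl]
      have : 0 ≤ e * (η * (m.factorial * A ^ 0 / (m + 0).factorial)) := by positivity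
      linarith
    · rw [if_neg (by omega), zero_add]
      have h2 := h j hj0 hj
      have h3 : (0 : ℝ) < (m + j).factorial := by positivity
      have h4 : e * (η * (m.factorial * A ^ j / (m + j).factorial))
          = η * (e * m.factorial) * A ^ j / (m + j).factorial := by ring
      rw [h4, le_div_iff₀ h3, mul_comm]
      exact h2
  have h2 := h1.pow p i hid
  rw [mul_pow, ← map_pow, coeff_C_mul] at h2
  have h3 := coeff_one_add_expTail_pow (m := m) (p := p) hA hη hη1 hi
  have h4 : (0 : ℝ) < (m * p + i).factorial := by positivity
  calc _ ≤ (m * p + i).factorial * (e ^ p * coeff i ((1 + C η * expTail m A) ^ p)) :=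
        mul_le_mul_of_nonneg_left h2 h4.le
    _ = e ^ p * (coeff i ((1 + C η * expTail m A) ^ p) * (m * p + i).factorial) := by ring
    _ ≤ e ^ p * (η * (3 ^ p * m.factorial ^ p) * (A ^ i * (p : ℝ) ^ (m * p + i))) :=
        mul_le_mul_of_nonneg_left h3 (by positivity)
    _ = _ := by ring

end PowerSeries

namespace PowerSeries

theorem exists_binomCore_eq_sum {q N : ℕ} (hqN : q ≤ N) :
    ∃ α : ℕ → ℝ, ∀ F : PowerSeries ℝ,
      binomCore q N F = ∑ r ∈ Finset.range (N - q + 1), C (α r) * F ^ r := by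
  set P : Polynomial ℝ := binomCore q N Polynomial.X with hP
  have hdeg : P.natDegree < N - q + 1 := by
    refine Nat.lt_succ_of_le (Polynomial.natDegree_sum_le_of_forall_le _ _ fun j hj => ?_)
    have hj' := Finset.mem_Icc.mp hj
    refine Polynomial.natDegree_mul_le.trans ?_
    have h1 : ((N.choose j : Polynomial ℝ) * Polynomial.X ^ (j - q)).natDegree ≤ j - q := by
      rw [← Polynomial.C_eq_natCast]
      exact Polynomial.natDegree_C_mul_X_pow_le _ _
    have h2 : ((1 - Polynomial.X : Polynomial ℝ) ^ (N - j)).natDegree ≤ N - j := by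
      refine Polynomial.natDegree_pow_le.trans ?_
      have : (1 - Polynomial.X : Polynomial ℝ).natDegree ≤ 1 :=
        (Polynomial.natDegree_sub_le _ _).trans (by simp)
      calc _ ≤ (N - j) * 1 := Nat.mul_le_mul_left _ this
        _ = _ := mul_one _
    omega
  refine ⟨P.coeff, fun F => ?_⟩
  have h1 := map_binomCore (Polynomial.eval₂RingHom (C : ℝ →+* PowerSeries ℝ) F) q N Polynomial.X
  rw [Polynomial.coe_eval₂RingHom, Polynomial.eval₂_X, ← hP,
    Polynomial.eval₂_eq_sum_range' _ hdeg] at h1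
  exact h1.symm

/-- The hypothesis propagated by the recursion: `E` grows at most like an exponential. -/
def ExpBound (m : ℕ) (E : PowerSeries ℝ) (η A : ℝ) (d : ℕ) : Prop :=
  ∀ i, 1 ≤ i → i ≤ d →
    (m + i).factorial * |coeff i E| ≤ η * (constantCoeff E * m.factorial) * A ^ i

theorem exists_abs_coeff_pow_mul_binomCore_le {q N m : ℕ} (hq : 1 ≤ q) (hqN : q ≤ N) (hm : 1 ≤ m)
    {E : PowerSeries ℝ} (hE : 0 < constantCoeff E) :
    ∃ K : ℝ, 0 < K ∧ ∀ (A η : ℝ) (d i : ℕ), 1 ≤ A → 0 ≤ η → η ≤ 1 → ExpBound m E η A d →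
      1 ≤ i → i ≤ d →
      (m * q + i).factorial * |coeff i (E ^ q * binomCore q N (X ^ m * E))|
        ≤ K * (A ^ i * (η * (q : ℝ) ^ (m * q + i) + A⁻¹ * (N : ℝ) ^ (m * q + i))) := by
  obtain ⟨α, hα⟩ := exists_binomCore_eq_sum hqN
  set e := constantCoeff E with he
  set B : ℕ → ℝ := fun r =>
    e ^ (q + r) * (3 ^ (q + r) * m.factorial ^ (q + r)) + e ^ (q + r) * (m * (q + r)).factorial
    with hB
  have hB0 : ∀ r, 0 ≤ B r := fun r => by positivity
  refine ⟨∑ r ∈ Finset.range (N - q + 1), |α r| * B r + 1,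
    add_pos_of_nonneg_of_pos (Finset.sum_nonneg fun r _ => mul_nonneg (abs_nonneg _) (hB0 r))
      one_pos, fun A η d i hA hη hη1 hbd hi hid => ?_⟩
  have hA0 : 0 < A := by linarith
  set S : ℝ := A ^ i * (η * (q : ℝ) ^ (m * q + i) + A⁻¹ * (N : ℝ) ^ (m * q + i)) with hS
  have hS0 : 0 ≤ S := by positivity
  have hterm : ∀ r ∈ Finset.range (N - q + 1),
      (m * q + i).factorial * |coeff i (X ^ (m * r) * E ^ (q + r))| ≤ B r * S := by
    intro r hr
    have hrN : q + r ≤ N := by have := Finset.mem_range.mp hr; omega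
    have hN1 : (1 : ℝ) ≤ N := by exact_mod_cast (by omega : 1 ≤ N)
    rcases Nat.eq_zero_or_pos r with rfl | hr0
    · rw [mul_zero, pow_zero, one_mul, add_zero]
      have h1 := abs_coeff_pow_le (p := q) hA0 hη hη1 hE hbd hi hid
      refine h1.trans ?_
      have h2 : e ^ q * (3 ^ q * m.factorial ^ q) ≤ B 0 := by
        simp only [hB, add_zero, le_add_iff_nonneg_right]; positivity
      have h3 : A ^ i * (η * (q : ℝ) ^ (m * q + i)) ≤ S :=
        mul_le_mul_of_nonneg_left (le_add_of_nonneg_right (by positivity)) (by positivity)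
      calc _ = (e ^ q * (3 ^ q * m.factorial ^ q)) * (A ^ i * (η * (q : ℝ) ^ (m * q + i))) := by
            ring
        _ ≤ _ := mul_le_mul h2 h3 (by positivity) (hB0 0)
    · have hAS : A ^ (i - 1) * (N : ℝ) ^ (m * q + i) ≤ S := by
        have e1 : A ^ i = A ^ (i - 1) * A := by rw [← pow_succ]; congr 1; omega
        calc _ = A ^ i * (A⁻¹ * (N : ℝ) ^ (m * q + i)) := by rw [e1]; field_simp
          _ ≤ _ := mul_le_mul_of_nonneg_left (le_add_of_nonneg_left (by positivity)) (by positivity)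
      rw [coeff_X_pow_mul']
      have hmr : 1 ≤ m * r := Nat.mul_pos hm hr0
      split_ifs with hle
      · have efac : m * q + i = m * (q + r) + (i - m * r) := by rw [Nat.mul_add]; omega
        rcases hle.eq_or_lt with heq | hlt
        · rw [← heq, Nat.sub_self, coeff_zero_eq_constantCoeff_apply, map_pow, ← he,
            abs_of_pos (by positivity), ← Nat.mul_add]
          have h1 : (1 : ℝ) ≤ A ^ (i - 1) * (N : ℝ) ^ (m * q + i) :=
            one_le_mul_of_one_le_of_one_le (one_le_pow₀ hA) (one_le_pow₀ hN1)
          have h2 : e ^ (q + r) * (m * (q + r)).factorial ≤ B r := by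
            simp only [hB, le_add_iff_nonneg_left]; positivity
          calc _ = e ^ (q + r) * (m * (q + r)).factorial * 1 := by ring
            _ ≤ B r * S := mul_le_mul h2 (h1.trans hAS) zero_le_one (hB0 r)
        · have h1 := abs_coeff_pow_le (p := q + r) (i := i - m * r) hA0 hη hη1 hE hbd (by omega)
            (by omega)
          rw [← efac] at h1
          refine h1.trans ?_
          have h2 : e ^ (q + r) * (3 ^ (q + r) * m.factorial ^ (q + r)) ≤ B r := by
            simp only [hB, le_add_iff_nonneg_right]; positivity
          have h3 : A ^ (i - m * r) ≤ A ^ (i - 1) := pow_le_pow_right₀ hA (by omega)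
          have h4 : ((q + r : ℕ) : ℝ) ^ (m * q + i) ≤ (N : ℝ) ^ (m * q + i) :=
            pow_le_pow_left₀ (by positivity) (by exact_mod_cast hrN) _
          have h5 : A ^ (i - m * r) * ((q + r : ℕ) : ℝ) ^ (m * q + i) ≤ S :=
            (mul_le_mul h3 h4 (by positivity) (by positivity)).trans hAS
          calc _ ≤ (e ^ (q + r) * (3 ^ (q + r) * m.factorial ^ (q + r))) *
                (A ^ (i - m * r) * ((q + r : ℕ) : ℝ) ^ (m * q + i)) := by
                refine mul_le_mul_of_nonneg_right ?_ (by positivity)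
                exact mul_le_of_le_one_left (by positivity) hη1
            _ ≤ B r * S := mul_le_mul h2 h5 (by positivity) (hB0 r)
      · rw [abs_zero, mul_zero]
        exact mul_nonneg (hB0 r) hS0
  have hexp : E ^ q * binomCore q N (X ^ m * E)
      = ∑ r ∈ Finset.range (N - q + 1), C (α r) * (X ^ (m * r) * E ^ (q + r)) := by
    rw [hα, Finset.mul_sum]
    refine Finset.sum_congr rfl fun r _ => ?_
    rw [mul_pow, ← pow_mul, pow_add]; ring
  rw [hexp, map_sum]
  simp_rw [coeff_C_mul]
  have hf : (0 : ℝ) ≤ (m * q + i).factorial := by positivity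
  calc _ ≤ (m * q + i).factorial * ∑ r ∈ Finset.range (N - q + 1),
          |α r * coeff i (X ^ (m * r) * E ^ (q + r))| :=
        mul_le_mul_of_nonneg_left (Finset.abs_sum_le_sum_abs _ _) hf
    _ = ∑ r ∈ Finset.range (N - q + 1),
          |α r| * ((m * q + i).factorial * |coeff i (X ^ (m * r) * E ^ (q + r))|) := by
        rw [Finset.mul_sum]
        refine Finset.sum_congr rfl fun r _ => ?_
        rw [abs_mul]; ring
    _ ≤ ∑ r ∈ Finset.range (N - q + 1), |α r| * (B r * S) :=
        Finset.sum_le_sum fun r hr => mul_le_mul_of_nonneg_left (hterm r hr) (abs_nonneg _)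
    _ = (∑ r ∈ Finset.range (N - q + 1), |α r| * B r) * S := by
        rw [Finset.sum_mul]
        refine Finset.sum_congr rfl fun r _ => ?_
        ring
    _ ≤ _ := mul_le_mul_of_nonneg_right (by linarith) hS0

set_option maxHeartbeats 1000000 in
/-- One step of the recursion for the coefficients of a solution. -/
theorem IsOrderStatSolution.exists_step {k n m : ℕ} (hk : 2 ≤ k) (hkn : k < n) (hm : 1 ≤ m)
    {E : PowerSeries ℝ} (hE : 0 < constantCoeff E) (h : IsOrderStatSolution k n (X ^ m * E)) :
    ∃ K : ℝ, 0 < K ∧ ∀ (A η : ℝ) (d : ℕ), 1 ≤ A → 0 ≤ η → η ≤ 1 → A⁻¹ ≤ η → 1 ≤ d →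
      ExpBound m E η A d → (m + d).factorial * |coeff d E|
        ≤ K * A ^ d * (η * (((n - 1 : ℕ) : ℝ) / n) ^ d + A⁻¹ + η ^ 2) := by
  obtain ⟨K₁, hK₁, hU⟩ := exists_abs_coeff_pow_mul_binomCore_le (q := k - 1) (N := n - 1)
    (by omega) (by omega) hm hE
  obtain ⟨K₂, hK₂, hW⟩ := exists_abs_coeff_pow_mul_binomCore_le (q := k) (N := n)
    (by omega) (by omega) hm hE
  set e := constantCoeff E with he
  set U := E ^ (k - 1) * binomCore (k - 1) (n - 1) (X ^ m * E) with hUdef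
  set W := E ^ k * binomCore k n (X ^ m * E) with hWdef
  have hU0 : constantCoeff U = e ^ (k - 1) * (n - 1).choose (k - 1) :=
    coeff_zero_mul_binomCore hm (by omega) E
  have hUpos : 0 < constantCoeff U := by
    rw [hU0]
    have : 0 < (n - 1).choose (k - 1) := Nat.choose_pos (by omega)
    positivity
  set u := constantCoeff U with hu
  set i0 := m * (k - 1) with hi0
  have hn1 : (1 : ℝ) ≤ n := by exact_mod_cast (by omega : 1 ≤ n)
  have hn0 : (0 : ℝ) < n := by linarith
  set ρ : ℝ := ((n - 1 : ℕ) : ℝ) / n with hρ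
  have hρ0 : 0 ≤ ρ := by positivity
  have hρ1 : ρ < 1 := by
    rw [hρ, div_lt_one hn0]
    exact_mod_cast (by omega : n - 1 < n)
  have hρn : ρ * n = ((n - 1 : ℕ) : ℝ) := div_mul_cancel₀ _ hn0.ne'
  have hkρ : (k : ℝ) ≤ ρ * n := by rw [hρn]; exact_mod_cast (by omega : k ≤ n - 1)
  have hk1ρ : (((k - 1 : ℕ)) : ℝ) ≤ ρ * n := by rw [hρn]; exact_mod_cast (by omega : k - 1 ≤ n - 1)
  set b : ℝ := i0.factorial * u with hb
  have hb0 : 0 < b := by positivity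
  set N₀ : ℝ := e * m.factorial with hN₀
  have hN₀pos : 0 < N₀ := by positivity
  set M : ℝ := K₂ * (n : ℝ) ^ (m * k) + 2 * K₁ * (n : ℝ) ^ i0 * N₀ * (1 + (1 - ρ)⁻¹) with hM
  have h1ρ : 0 < 1 - ρ := by linarith
  refine ⟨M / b, by positivity, fun A η d hA hη hη1 hAη hd hbd => ?_⟩
  have hA0 : 0 < A := by linarith
  have hAi : 0 < A⁻¹ := inv_pos.mpr hA0
  have heq := h.coeff_eq (by omega) d
  rw [← hUdef, ← hWdef, ← hi0] at heq
  have hmem : ((0, d) : ℕ × ℕ) ∈ Finset.HasAntidiagonal.antidiagonal d :=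
    Finset.HasAntidiagonal.mem_antidiagonal.mpr (by simp)
  rw [← Finset.add_sum_erase _ _ hmem] at heq
  simp only [add_zero, coeff_zero_eq_constantCoeff_apply] at heq
  rw [← hu] at heq
  have hWd : (m * k + d).factorial * |coeff d W|
      ≤ K₂ * (n : ℝ) ^ (m * k) * ((n : ℝ) ^ d * A ^ d * (η * ρ ^ d + A⁻¹)) := by
    refine (hW A η d d hA hη hη1 hbd hd le_rfl).trans ?_
    have h1 : (k : ℝ) ^ (m * k + d) ≤ (n : ℝ) ^ (m * k) * ((n : ℝ) ^ d * ρ ^ d) := by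
      rw [pow_add, ← mul_pow, mul_comm (n : ℝ) ρ]
      refine mul_le_mul (pow_le_pow_left₀ (by positivity) ?_ _)
        (pow_le_pow_left₀ (by positivity) hkρ _) (by positivity) (by positivity)
      exact_mod_cast hkn.le
    calc _ ≤ K₂ * (A ^ d * (η * ((n : ℝ) ^ (m * k) * ((n : ℝ) ^ d * ρ ^ d))
          + A⁻¹ * (n : ℝ) ^ (m * k + d))) := by gcongr
      _ = _ := by rw [pow_add]; ring
  have hUi : ∀ i, 1 ≤ i → i ≤ d → (i0 + i).factorial * |coeff i U|
      ≤ 2 * K₁ * (n : ℝ) ^ i0 * (η * (A ^ i * ((n : ℝ) ^ i * ρ ^ i))) := by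
    intro i hi hid
    refine (hU A η d i hA hη hη1 hbd hi hid).trans ?_
    have h1 : ∀ x : ℝ, 0 ≤ x → x ≤ ρ * n → x ^ (i0 + i) ≤ (n : ℝ) ^ i0 * ((n : ℝ) ^ i * ρ ^ i) := by
      intro x hx0 hx
      rw [pow_add, ← mul_pow, mul_comm (n : ℝ) ρ]
      refine mul_le_mul (pow_le_pow_left₀ hx0 (hx.trans ?_) _)
        (pow_le_pow_left₀ hx0 hx _) (by positivity) (by positivity)
      exact mul_le_of_le_one_left hn0.le hρ1.le
    have h2 := h1 _ (by positivity) hk1ρ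
    have h3 := h1 (((n - 1 : ℕ)) : ℝ) (by positivity) hρn.ge
    set Q := (n : ℝ) ^ i0 * ((n : ℝ) ^ i * ρ ^ i) with hQ
    calc _ ≤ K₁ * (A ^ i * (η * Q + η * Q)) := by gcongr
      _ = _ := by rw [hQ]; ring
  have hterm : ∀ p ∈ (Finset.HasAntidiagonal.antidiagonal d).erase (0, d),
      |((i0 + p.1).factorial * (m + p.2).factorial : ℝ) * (n : ℝ) ^ (m + p.2) *
        (coeff p.1 U * coeff p.2 E)|
      ≤ 2 * K₁ * (n : ℝ) ^ i0 * N₀ * ((n : ℝ) ^ (m + d) * A ^ d) *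
        (if p.2 = 0 then η * ρ ^ d else η ^ 2 * ρ ^ p.1) := by
    rintro ⟨i, j⟩ hp
    rw [Finset.mem_erase, Finset.HasAntidiagonal.mem_antidiagonal] at hp
    obtain ⟨hne, hij⟩ := hp
    simp only at hij ⊢
    have hi : 1 ≤ i := by
      rcases Nat.eq_zero_or_pos i with rfl | hi
      · exact absurd (by rw [← hij, zero_add]) hne
      · exact hi
    have h1 := hUi i hi (by omega)
    have e1 : |((i0 + i).factorial * (m + j).factorial : ℝ) * (n : ℝ) ^ (m + j) *
        (coeff i U * coeff j E)| = ((i0 + i).factorial * |coeff i U|) * (n : ℝ) ^ (m + j) *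
          ((m + j).factorial * |coeff j E|) := by
      rw [abs_mul, abs_mul, abs_mul (coeff i U), abs_of_nonneg (by positivity : (0 : ℝ) ≤
        (i0 + i).factorial * (m + j).factorial), abs_of_nonneg (by positivity : (0 : ℝ) ≤
        (n : ℝ) ^ (m + j))]
      ring
    rw [e1]
    split_ifs with hj
    · subst hj
      have hid : i = d := by omega
      subst hid
      rw [coeff_zero_eq_constantCoeff_apply, ← he, abs_of_pos hE, add_zero]
      calc _ ≤ (2 * K₁ * (n : ℝ) ^ i0 * (η * (A ^ i * ((n : ℝ) ^ i * ρ ^ i)))) * (n : ℝ) ^ m *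
            (m.factorial * e) := by gcongr
        _ = _ := by rw [hN₀, pow_add]; ring
    · have h2 := hbd j (by omega) (by omega)
      rw [← he, ← hN₀] at h2
      calc _ ≤ (2 * K₁ * (n : ℝ) ^ i0 * (η * (A ^ i * ((n : ℝ) ^ i * ρ ^ i)))) *
            (n : ℝ) ^ (m + j) * (η * N₀ * A ^ j) := by gcongr
        _ = _ := by rw [← hij, pow_add, pow_add, pow_add, pow_add]; ring
  have hsum : ∑ p ∈ (Finset.HasAntidiagonal.antidiagonal d).erase (0, d),
      (if p.2 = 0 then η * ρ ^ d else η ^ 2 * ρ ^ p.1) ≤ η * ρ ^ d + η ^ 2 * (1 - ρ)⁻¹ := by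
    have hpos : ∀ p : ℕ × ℕ, 0 ≤ (if p.2 = 0 then η * ρ ^ d else 0) + η ^ 2 * ρ ^ p.1 := by
      intro p
      split_ifs <;> positivity
    calc _ ≤ ∑ p ∈ Finset.HasAntidiagonal.antidiagonal d,
          ((if p.2 = 0 then η * ρ ^ d else 0) + η ^ 2 * ρ ^ p.1) := by
          refine (Finset.sum_le_sum fun p _ => ?_).trans
            (Finset.sum_le_sum_of_subset_of_nonneg (Finset.erase_subset _ _) fun p _ _ => hpos p)
          split_ifs
          · exact le_add_of_nonneg_right (by positivity)
          · rw [zero_add]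
      _ = η * ρ ^ d + η ^ 2 * ∑ i ∈ Finset.range (d + 1), ρ ^ i := by
          rw [Finset.sum_add_distrib, ← Finset.mul_sum,
            Finset.Nat.sum_antidiagonal_eq_sum_range_succ (fun i _ => ρ ^ i),
            Finset.Nat.sum_antidiagonal_eq_sum_range_succ
              (fun _ j => if j = 0 then η * ρ ^ d else 0)]
          congr 1
          rw [Finset.sum_eq_single d]
          · simp
          · intro i hi hid
            have := Finset.mem_range.mp hi
            rw [if_neg (by omega)]
          · intro hnm
            exact absurd (Finset.mem_range.mpr (Nat.lt_succ_self d)) hnm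
      _ ≤ _ := by
          gcongr
          rw [← tsum_geometric_of_lt_one hρ0 hρ1]
          exact (summable_geometric_of_lt_one hρ0 hρ1).sum_le_tsum _ fun _ _ => by positivity
  set x : ℝ := (m + d).factorial * |coeff d E| with hx
  have hmain : b * (n : ℝ) ^ (m + d) * x
      ≤ K₂ * (n : ℝ) ^ (m * k) * ((n : ℝ) ^ d * A ^ d * (η * ρ ^ d + A⁻¹)) +
        2 * K₁ * (n : ℝ) ^ i0 * N₀ * ((n : ℝ) ^ (m + d) * A ^ d) *
          (η * ρ ^ d + η ^ 2 * (1 - ρ)⁻¹) := by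
    have h1 : b * (n : ℝ) ^ (m + d) * x = |(i0.factorial * (m + d).factorial : ℝ) *
        (n : ℝ) ^ (m + d) * (u * coeff d E)| := by
      rw [abs_mul, abs_mul, abs_mul u, abs_of_pos hUpos, abs_of_nonneg (by positivity : (0 : ℝ) ≤
        i0.factorial * (m + d).factorial), abs_of_nonneg (by positivity : (0 : ℝ) ≤
        (n : ℝ) ^ (m + d)), hb, hx]
      ring
    rw [h1, eq_sub_of_add_eq heq]
    refine (abs_sub _ _).trans (add_le_add ?_ ?_)
    · rw [abs_mul, abs_of_nonneg (by positivity : (0 : ℝ) ≤ (m * k + d).factorial)]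
      exact hWd
    · refine (Finset.abs_sum_le_sum_abs _ _).trans ((Finset.sum_le_sum hterm).trans ?_)
      rw [← Finset.mul_sum]
      exact mul_le_mul_of_nonneg_left hsum (by positivity)
  set Y : ℝ := η * ρ ^ d + A⁻¹ + η ^ 2 with hY
  have hY0 : 0 ≤ Y := by positivity
  have hnd : (n : ℝ) ^ d ≤ (n : ℝ) ^ (m + d) := pow_le_pow_right₀ hn1 (by omega)
  have hfin : b * (n : ℝ) ^ (m + d) * x ≤ (M * A ^ d * Y) * (n : ℝ) ^ (m + d) := by
    refine hmain.trans ?_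
    have h1 : η * ρ ^ d + A⁻¹ ≤ Y := le_add_of_nonneg_right (by positivity)
    have h2 : η * ρ ^ d + η ^ 2 * (1 - ρ)⁻¹ ≤ (1 + (1 - ρ)⁻¹) * Y := by
      have h3 : 0 < (1 - ρ)⁻¹ := inv_pos.mpr h1ρ
      have h4 : 0 ≤ η * ρ ^ d := by positivity
      have h5 : 0 ≤ η ^ 2 := by positivity
      rw [hY]
      nlinarith [mul_nonneg h3.le h4, mul_nonneg h3.le hAi.le]
    calc _ ≤ K₂ * (n : ℝ) ^ (m * k) * ((n : ℝ) ^ (m + d) * A ^ d * Y) +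
        2 * K₁ * (n : ℝ) ^ i0 * N₀ * ((n : ℝ) ^ (m + d) * A ^ d) * ((1 + (1 - ρ)⁻¹) * Y) := by
          gcongr
      _ = _ := by rw [hM]; ring
  have hnp : 0 < (n : ℝ) ^ (m + d) := by positivity
  have h6 : b * x ≤ M * A ^ d * Y := by
    refine le_of_mul_le_mul_right ?_ hnp
    calc _ = b * (n : ℝ) ^ (m + d) * x := by ring
      _ ≤ _ := hfin
  rw [div_mul_eq_mul_div, div_mul_eq_mul_div, le_div_iff₀ hb0]
  linarith

/-- A solution that is flat at the origin is an entire function of exponential type. -/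
theorem IsOrderStatSolution.exists_exponentialType {k n m : ℕ} (hk : 2 ≤ k) (hkn : k < n)
    (hm : 1 ≤ m) {E : PowerSeries ℝ} (hE : 0 < constantCoeff E)
    (h : IsOrderStatSolution k n (X ^ m * E)) :
    ∃ C A : ℝ, 0 < C ∧ 1 ≤ A ∧ ∀ i, (m + i).factorial * |coeff i E| ≤ C * A ^ i := by
  obtain ⟨K, hK, hstep⟩ := h.exists_step hk hkn hm hE
  set N₀ : ℝ := constantCoeff E * m.factorial with hN₀
  have hN₀pos : 0 < N₀ := by positivity
  have hn0 : (0 : ℝ) < n := by exact_mod_cast (by omega : 0 < n)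
  set ρ : ℝ := ((n - 1 : ℕ) : ℝ) / n with hρ
  have hρ0 : 0 ≤ ρ := by positivity
  have hρ1 : ρ < 1 := by
    rw [hρ, div_lt_one hn0]
    exact_mod_cast (by omega : n - 1 < n)
  set η : ℝ := min 1 (N₀ / (8 * K)) with hη
  have hη0 : 0 < η := lt_min one_pos (by positivity)
  have hη1 : η ≤ 1 := min_le_left _ _
  have hηK : K * η ≤ N₀ / 8 := by
    have := min_le_right 1 (N₀ / (8 * K))
    rw [← hη, le_div_iff₀ (by positivity)] at this
    linarith
  obtain ⟨d₀, hd₀⟩ := exists_pow_lt_of_lt_one (show 0 < N₀ / (8 * K) by positivity) hρ1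
  obtain ⟨A₀, hA₀1, hA₀2, hA₀⟩ : ∃ A : ℝ, 1 ≤ A ∧ max η⁻¹ (8 * K / (η * N₀)) ≤ A ∧
      ∀ i < d₀, (m + i).factorial * |coeff i E| / (η * N₀) ≤ A := by
    obtain ⟨B, hB⟩ := ((Finset.range d₀).image fun i =>
      (m + i).factorial * |coeff i E| / (η * N₀)).bddAbove
    refine ⟨max 1 (max B (max η⁻¹ (8 * K / (η * N₀)))), le_max_left _ _,
      le_max_of_le_right (le_max_right _ _), fun i hi => ?_⟩
    refine le_max_of_le_right (le_max_of_le_left (hB ?_))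
    simp only [Finset.coe_image, Set.mem_image, Finset.coe_range, Set.mem_Iio]
    exact ⟨i, hi, rfl⟩
  have hhalf : ∀ A : ℝ, A₀ ≤ A → ∀ d, 1 ≤ d → d₀ ≤ d → ExpBound m E η A d →
      (m + d).factorial * |coeff d E| ≤ η * N₀ * A ^ d / 2 := by
    intro A hA d hd hdd hbd
    have hA1 : 1 ≤ A := hA₀1.trans hA
    have hA0 : 0 < A := by linarith
    have hAη : A⁻¹ ≤ η := inv_le_of_inv_le₀ hη0 ((le_max_left _ _).trans (hA₀2.trans hA))
    have hAK : K * A⁻¹ ≤ η * N₀ / 8 := by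
      have h1 := (le_max_right _ _).trans (hA₀2.trans hA)
      rw [div_le_iff₀ (by positivity)] at h1
      rw [← div_eq_mul_inv, div_le_iff₀ hA0]
      linarith
    have hρd : K * ρ ^ d ≤ N₀ / 8 := by
      have h1 := (pow_le_pow_of_le_one hρ0 hρ1.le hdd).trans hd₀.le
      rw [le_div_iff₀ (by positivity)] at h1
      linarith
    refine (hstep A η d hA1 hη0.le hη1 hAη hd hbd).trans ?_
    have h2 : K * (η * ρ ^ d + A⁻¹ + η ^ 2) ≤ η * N₀ / 2 := by
      have h3 := mul_le_mul_of_nonneg_left hρd hη0.le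
      have h4 := mul_le_mul_of_nonneg_left hηK hη0.le
      nlinarith [mul_pos hη0 hN₀pos]
    calc _ = K * (η * ρ ^ d + A⁻¹ + η ^ 2) * A ^ d := by ring
      _ ≤ η * N₀ / 2 * A ^ d := mul_le_mul_of_nonneg_right h2 (by positivity)
      _ = _ := by ring
  have hA₀0 : 0 < A₀ := by linarith
  have hall : ∀ d, 1 ≤ d → (m + d).factorial * |coeff d E| ≤ η * N₀ * A₀ ^ d := by
    intro d
    induction d using Nat.strong_induction_on with
    | _ d ih =>
    intro hd
    rcases lt_or_ge d d₀ with hlt | hge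
    · have h1 := hA₀ d hlt
      rw [div_le_iff₀ (by positivity)] at h1
      have h2 : A₀ ≤ A₀ ^ d := le_self_pow₀ hA₀1 (by omega)
      calc _ ≤ A₀ * (η * N₀) := h1
        _ ≤ A₀ ^ d * (η * N₀) := mul_le_mul_of_nonneg_right h2 (by positivity)
        _ = _ := by ring
    · by_contra hcon
      rw [not_le] at hcon
      set t : ℝ := (m + d).factorial * |coeff d E| / (η * N₀) with ht
      have ht1 : A₀ ^ d < t := by rw [ht, lt_div_iff₀ (by positivity)]; linarith
      have ht0 : 0 < t := lt_trans (by positivity) ht1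
      set A := t ^ ((d : ℝ)⁻¹) with hA
      have hAd : A ^ d = t := Real.rpow_inv_natCast_pow ht0.le (by omega)
      have hA0 : 0 < A := Real.rpow_pos_of_pos ht0 _
      have hAA : A₀ ≤ A := by
        rw [← hAd] at ht1
        exact (lt_of_pow_lt_pow_left₀ d hA0.le ht1).le
      have hbd : ExpBound m E η A d := by
        intro i hi hid
        rcases hid.eq_or_lt with rfl | hlt
        · rw [hAd, ht, ← hN₀]
          apply le_of_eq
          field_simp
        · refine (ih i hlt hi).trans ?_
          gcongr
      have h1 := hhalf A hAA d hd hge hbd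
      rw [hAd, ht, mul_div_cancel₀ _ (by positivity : η * N₀ ≠ 0)] at h1
      have : 0 < η * N₀ * A₀ ^ d := by positivity
      linarith
  refine ⟨N₀, A₀, hN₀pos, hA₀1, fun i => ?_⟩
  rcases Nat.eq_zero_or_pos i with rfl | hi
  · rw [coeff_zero_eq_constantCoeff_apply, abs_of_pos hE, add_zero, pow_zero, mul_one, hN₀,
      mul_comm]
  · refine (hall i hi).trans ?_
    rw [mul_assoc]
    exact mul_le_of_le_one_left (by positivity) hη1

end PowerSeries

/-- The Laplace transform of a function on the positive half-line. -/
noncomputable def laplace (h : ℝ → ℝ) (s : ℂ) : ℂ :=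
  ∫ x in Set.Ioi (0 : ℝ), Complex.exp (-(s * x)) * h x

theorem norm_exp_neg_mul (s : ℂ) (x : ℝ) : ‖Complex.exp (-(s * x))‖ = Real.exp (-(s.re * x)) := by
  rw [Complex.norm_exp]
  simp

theorem norm_exp_neg_mul_le_one {s : ℂ} (hs : 0 ≤ s.re) {x : ℝ} (hx : 0 < x) :
    ‖Complex.exp (-(s * x))‖ ≤ 1 := by
  rw [norm_exp_neg_mul, Real.exp_le_one_iff]
  have := mul_nonneg hs hx.le
  linarith

theorem integrable_laplace {h : ℝ → ℝ} (hh : IntegrableOn h (Set.Ioi 0)) {s : ℂ} (hs : 0 ≤ s.re) :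
    IntegrableOn (fun x : ℝ => Complex.exp (-(s * x)) * h x) (Set.Ioi 0) := by
  refine Integrable.mono (g := h) hh ?_ ?_
  · exact (Continuous.aestronglyMeasurable (by fun_prop)).mul
      (Complex.continuous_ofReal.comp_aestronglyMeasurable hh.aestronglyMeasurable)
  · filter_upwards [ae_restrict_mem measurableSet_Ioi] with x hx
    rw [norm_mul, Complex.norm_real]
    exact mul_le_of_le_one_left (norm_nonneg _) (norm_exp_neg_mul_le_one hs hx)

theorem differentiableOn_laplace {h : ℝ → ℝ} (hh : IntegrableOn h (Set.Ioi 0)) :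
    DifferentiableOn ℂ (laplace h) {s | 0 < s.re} := by
  intro s₀ hs₀
  have hs₀' : 0 < s₀.re := hs₀
  set ε := s₀.re / 2 with hε
  have hε0 : 0 < ε := by positivity
  have hopen : {s : ℂ | ε < s.re} ∈ nhds s₀ :=
    (isOpen_lt continuous_const Complex.continuous_re).mem_nhds (by
      change ε < s₀.re
      linarith)
  have hm : ∀ s : ℂ, AEStronglyMeasurable (fun x : ℝ => Complex.exp (-(s * x)) * h x)
      (volume.restrict (Set.Ioi 0)) := fun s =>
    (Continuous.aestronglyMeasurable (by fun_prop)).mul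
      (Complex.continuous_ofReal.comp_aestronglyMeasurable hh.aestronglyMeasurable)
  have := hasDerivAt_integral_of_dominated_loc_of_deriv_le
    (μ := volume.restrict (Set.Ioi (0 : ℝ))) (bound := fun x => ε⁻¹ * ‖h x‖)
    (F := fun (s : ℂ) (x : ℝ) => Complex.exp (-(s * x)) * h x)
    (F' := fun (s : ℂ) (x : ℝ) => Complex.exp (-(s * x)) * (-x) * h x)
    hopen (Filter.Eventually.of_forall hm) (integrable_laplace hh hs₀'.le) ?_ ?_
    (hh.norm.const_mul _) ?_
  · exact this.2.differentiableAt.differentiableWithinAt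
  · exact ((Continuous.aestronglyMeasurable (by fun_prop)).mul
      (Complex.continuous_ofReal.comp_aestronglyMeasurable hh.aestronglyMeasurable))
  · filter_upwards [ae_restrict_mem measurableSet_Ioi] with x hx s hs
    have hx0 : 0 < x := hx
    have hs' : ε < s.re := hs
    rw [norm_mul, norm_mul, norm_exp_neg_mul, norm_neg, Complex.norm_real, Complex.norm_real]
    refine mul_le_mul_of_nonneg_right ?_ (norm_nonneg _)
    rw [Real.norm_eq_abs, abs_of_pos hx0]
    have h1 : Real.exp (-(s.re * x)) ≤ Real.exp (-(ε * x)) := by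
      rw [Real.exp_le_exp]; nlinarith
    have h2 : ε * x ≤ Real.exp (ε * x) := by linarith [Real.add_one_le_exp (ε * x)]
    calc _ ≤ Real.exp (-(ε * x)) * x := mul_le_mul_of_nonneg_right h1 hx0.le
      _ ≤ ε⁻¹ := by
        rw [Real.exp_neg, inv_mul_le_iff₀ (Real.exp_pos _), ← div_eq_mul_inv, le_div_iff₀ hε0]
        linarith
  · refine Filter.Eventually.of_forall fun x s _ => ?_
    have h1 : HasDerivAt (fun s : ℂ => -(s * x)) (-x : ℂ) s := by
      have h0 : HasDerivAt (fun s : ℂ => s * x) (x : ℂ) s := hasDerivAt_mul_const _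
      exact h0.neg
    exact (h1.cexp).mul_const _

theorem tendsto_laplace {h : ℝ → ℝ} (hh : IntegrableOn h (Set.Ioi 0)) (y : ℝ) :
    Filter.Tendsto (fun ε : ℝ => laplace h (ε + y * Complex.I)) (nhdsWithin 0 (Set.Ioi 0))
      (nhds (laplace h (y * Complex.I))) := by
  refine tendsto_integral_filter_of_dominated_convergence (fun x => ‖h x‖) ?_ ?_ hh.norm ?_
  · exact Filter.Eventually.of_forall fun ε =>
      (Continuous.aestronglyMeasurable (by fun_prop)).mul
      (Complex.continuous_ofReal.comp_aestronglyMeasurable hh.aestronglyMeasurable)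
  · filter_upwards [self_mem_nhdsWithin] with ε hε
    filter_upwards [ae_restrict_mem measurableSet_Ioi] with x hx
    rw [norm_mul, Complex.norm_real]
    refine mul_le_of_le_one_left (norm_nonneg _) (norm_exp_neg_mul_le_one ?_ hx)
    simpa using (show (0 : ℝ) < ε from hε).le
  · refine Filter.Eventually.of_forall fun x => ?_
    have : Continuous fun ε : ℝ => Complex.exp (-((ε + y * Complex.I) * x)) * (h x : ℂ) := by
      fun_prop
    have h2 := (this.tendsto 0).mono_left (nhdsWithin_le_nhds (s := Set.Ioi (0 : ℝ)))
    simpa using h2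

theorem integral_pow_mul_exp_neg_mul (q : ℕ) {r : ℝ} (hr : 0 < r) :
    ∫ x in Set.Ioi (0 : ℝ), x ^ q * Real.exp (-(r * x)) = q.factorial / r ^ (q + 1) := by
  have h := Real.integral_rpow_mul_exp_neg_mul_Ioi (a := q + 1) (r := r) (by positivity) hr
  rw [Real.Gamma_nat_eq_factorial] at h
  simp only [add_sub_cancel_right, Real.rpow_natCast] at h
  rw [h, ← Nat.cast_succ, Real.rpow_natCast, one_div, inv_pow]
  field_simp

theorem integrableOn_pow_mul_exp_neg_mul (q : ℕ) {r : ℝ} (hr : 0 < r) :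
    IntegrableOn (fun x : ℝ => x ^ q * Real.exp (-(r * x))) (Set.Ioi 0) := by
  have h := integrableOn_rpow_mul_exp_neg_mul_rpow (p := 1) (s := q) (b := r)
    (by linarith [(Nat.cast_nonneg q : (0 : ℝ) ≤ q)]) one_pos hr
  simpa using h

/-- The Laplace transform of an even power series of exponential type, for large real argument. -/
theorem hasSum_laplace_ofReal {h : ℝ → ℝ} {t : ℕ → ℝ} {C A : ℝ} (hA : 0 < A)
    (hsum : ∀ x : ℝ, 0 < x → HasSum (fun j : ℕ => t j * x ^ (2 * j)) (h x))
    (hbd : ∀ j, (2 * j).factorial * |t j| ≤ C * A ^ (2 * j)) {r : ℝ} (hr : A < r) :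
    HasSum (fun j : ℕ => ((t j * (2 * j).factorial : ℝ) : ℂ) / (r : ℂ) ^ (2 * j + 1))
      (laplace h r) := by
  have hr0 : 0 < r := hA.trans hr
  have hint : ∀ j, IntegrableOn (fun x : ℝ => t j * (x ^ (2 * j) * Real.exp (-(r * x))))
      (Set.Ioi 0) := fun j => (integrableOn_pow_mul_exp_neg_mul _ hr0).const_mul _
  have hnorm : ∀ j, ∫ x in Set.Ioi (0 : ℝ), ‖t j * (x ^ (2 * j) * Real.exp (-(r * x)))‖
      = |t j| * ((2 * j).factorial / r ^ (2 * j + 1)) := by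
    intro j
    rw [← integral_pow_mul_exp_neg_mul _ hr0, ← integral_const_mul]
    refine setIntegral_congr_fun measurableSet_Ioi fun x hx => ?_
    have hx0 : (0 : ℝ) < x := hx
    simp only [norm_mul, Real.norm_eq_abs]
    rw [abs_of_pos (pow_pos hx0 _), abs_of_pos (Real.exp_pos _)]
  have hsummable : Summable fun j => ∫ x in Set.Ioi (0 : ℝ),
      ‖t j * (x ^ (2 * j) * Real.exp (-(r * x)))‖ := by
    simp_rw [hnorm]
    have hgeo : Summable fun j : ℕ => C / r * ((A / r) ^ 2) ^ j := by
      refine (summable_geometric_of_lt_one (by positivity) ?_).mul_left _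
      exact pow_lt_one₀ (by positivity) (by rwa [div_lt_one hr0]) two_ne_zero
    refine Summable.of_nonneg_of_le (fun j => by positivity) (fun j => ?_) hgeo
    calc _ = ((2 * j).factorial * |t j|) / r ^ (2 * j + 1) := by ring
      _ ≤ (C * A ^ (2 * j)) / r ^ (2 * j + 1) :=
        div_le_div_of_nonneg_right (hbd j) (by positivity)
      _ = _ := by
        rw [← pow_mul, div_pow, pow_succ]
        field_simp
  have hmain := hasSum_integral_of_summable_integral_norm hint hsummable
  have e1 : ∫ x in Set.Ioi (0 : ℝ), ∑' j, t j * (x ^ (2 * j) * Real.exp (-(r * x)))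
      = ∫ x in Set.Ioi (0 : ℝ), Real.exp (-(r * x)) * h x := by
    refine setIntegral_congr_fun measurableSet_Ioi fun x hx => ?_
    have := (hsum x hx).mul_left (Real.exp (-(r * x)))
    rw [← this.tsum_eq]
    refine tsum_congr fun j => ?_
    ring
  have e2 : laplace h r = ((∫ x in Set.Ioi (0 : ℝ), Real.exp (-(r * x)) * h x : ℝ) : ℂ) := by
    rw [laplace, ← integral_complex_ofReal]
    congr 1
    ext x
    push_cast
    rfl
  rw [e2, ← e1]
  have h3 := Complex.hasSum_ofReal.mpr hmain
  refine (congrArg (HasSum · _) (funext fun j => ?_)).mpr h3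
  rw [integral_const_mul, integral_pow_mul_exp_neg_mul _ hr0]
  push_cast
  ring

theorem re_laplace_mul_I {h : ℝ → ℝ} (hh : IntegrableOn h (Set.Ioi 0)) (y : ℝ) :
    (laplace h (y * Complex.I)).re = ∫ x in Set.Ioi (0 : ℝ), h x * Real.cos (y * x) := by
  have h1 := integral_re (𝕜 := ℂ) (integrable_laplace hh (s := y * Complex.I) (by simp))
  rw [laplace]
  refine h1.symm.trans (integral_congr_ae (Filter.Eventually.of_forall fun x => ?_))
  have : (-(y * Complex.I * x) : ℂ) = ((-(y * x) : ℝ) : ℂ) * Complex.I := by push_cast; ring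
  simp only [this, RCLike.re_eq_complex_re, Complex.re_mul_ofReal, Complex.exp_ofReal_mul_I_re,
    Real.cos_neg]
  ring

/-- An even entire function of exponential type that is integrable on the half-line has a cosine
transform of compact support. -/
theorem integral_mul_cos_eq_zero {h : ℝ → ℝ} (hh : IntegrableOn h (Set.Ioi 0)) {t : ℕ → ℝ}
    {C A : ℝ} (hA : 0 < A)
    (hsum : ∀ x : ℝ, 0 < x → HasSum (fun j : ℕ => t j * x ^ (2 * j)) (h x))
    (hbd : ∀ j, (2 * j).factorial * |t j| ≤ C * A ^ (2 * j)) {y : ℝ} (hy : 2 * A < y) :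
    ∫ x in Set.Ioi (0 : ℝ), h x * Real.cos (y * x) = 0 := by
  set B : ℂ → ℂ := fun s => ∑' j : ℕ, ((t j * (2 * j).factorial : ℝ) : ℂ) / s ^ (2 * j + 1) with hB
  set V : Set ℂ := {s | 2 * A < s.re + s.im} with hV
  have hVo : IsOpen V :=
    isOpen_lt continuous_const (Complex.continuous_re.add Complex.continuous_im)
  have hVn : ∀ s ∈ V, √2 * A ≤ ‖s‖ := by
    intro s hs
    have hs' : 2 * A < s.re + s.im := hs
    have h1 : (√2 * A) ^ 2 ≤ ‖s‖ ^ 2 := by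
      rw [mul_pow, Real.sq_sqrt (by norm_num), Complex.sq_norm, Complex.normSq_apply]
      nlinarith [sq_nonneg (s.re - s.im)]
    exact le_of_sq_le_sq h1 (norm_nonneg _)
  have hs2 : (1 : ℝ) < √2 := by
    rw [Real.lt_sqrt (by norm_num)]; norm_num
  have hbound : ∀ j, ∀ s ∈ V, ‖((t j * (2 * j).factorial : ℝ) : ℂ) / s ^ (2 * j + 1)‖
      ≤ C / (√2 * A) * ((1 / √2) ^ 2) ^ j := by
    intro j s hs
    have h1 := hVn s hs
    have h2 : 0 < √2 * A := by positivity
    rw [norm_div, norm_pow, Complex.norm_real, Real.norm_eq_abs, abs_mul, Nat.abs_cast, mul_comm]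
    calc _ ≤ (2 * j).factorial * |t j| / (√2 * A) ^ (2 * j + 1) := by gcongr
      _ ≤ (C * A ^ (2 * j)) / (√2 * A) ^ (2 * j + 1) :=
        div_le_div_of_nonneg_right (hbd j) (by positivity)
      _ = _ := by
        rw [← pow_mul, one_div, inv_pow, pow_succ, mul_pow]
        field_simp
  have hgeo : Summable fun j : ℕ => C / (√2 * A) * ((1 / √2) ^ 2) ^ j := by
    refine (summable_geometric_of_lt_one (by positivity) ?_).mul_left _
    exact pow_lt_one₀ (by positivity) (by rwa [div_lt_one (by positivity)]) two_ne_zero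
  have hV0 : ∀ s ∈ V, s ≠ 0 := by
    rintro s hs rfl
    have := hVn 0 hs
    rw [norm_zero] at this
    have : 0 < √2 * A := by positivity
    linarith
  have hBd : DifferentiableOn ℂ B V :=
    Complex.differentiableOn_tsum_of_summable_norm hgeo (fun j =>
      DifferentiableOn.div (by fun_prop) (by fun_prop) fun s hs => pow_ne_zero _ (hV0 s hs))
      hVo hbound
  set U : Set ℂ := {s | 0 < s.re} ∩ V with hU
  have hUo : IsOpen U := (isOpen_lt continuous_const Complex.continuous_re).inter hVo
  have hUc : Convex ℝ U := by
    refine (convex_halfSpace_re_gt 0).inter ?_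
    have := convex_halfSpace_gt (𝕜 := ℝ) (f := fun s : ℂ => s.re + s.im)
      ⟨fun a b => by simp; ring, fun c a => by simp; ring⟩ (2 * A)
    exact this
  have hpt : ((3 * A : ℝ) : ℂ) ∈ U := by
    refine ⟨?_, ?_⟩
    · simpa using hA
    · simp only [hV, Set.mem_ofPred_eq, Complex.ofReal_re, Complex.ofReal_im]
      linarith
  have hfreq : ∃ᶠ s in nhdsWithin ((3 * A : ℝ) : ℂ) {((3 * A : ℝ) : ℂ)}ᶜ, laplace h s = B s := by
    have ht : Filter.Tendsto (fun r : ℝ => (r : ℂ)) (nhdsWithin (3 * A) (Set.Ioi (3 * A)))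
        (nhdsWithin ((3 * A : ℝ) : ℂ) {((3 * A : ℝ) : ℂ)}ᶜ) := by
      refine tendsto_nhdsWithin_iff.mpr ⟨?_, ?_⟩
      · exact (Complex.continuous_ofReal.tendsto _).mono_left nhdsWithin_le_nhds
      · filter_upwards [self_mem_nhdsWithin] with r hr
        exact fun h => (ne_of_gt hr : r ≠ 3 * A) (Complex.ofReal_injective h)
    refine ht.frequently (Filter.Eventually.frequently ?_)
    filter_upwards [self_mem_nhdsWithin] with r hr
    have hr' : 3 * A < r := hr
    exact (hasSum_laplace_ofReal hA hsum hbd (by linarith)).tsum_eq.symm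
  have heq : Set.EqOn (laplace h) B U :=
    AnalyticOnNhd.eqOn_of_preconnected_of_frequently_eq
      (((differentiableOn_laplace hh).mono Set.inter_subset_left).analyticOnNhd hUo)
      ((hBd.mono Set.inter_subset_right).analyticOnNhd hUo) hUc.isPreconnected hpt hfreq
  have hyV : (y * Complex.I : ℂ) ∈ V := by
    simpa [hV] using hy
  have hBc : Filter.Tendsto (fun ε : ℝ => B (ε + y * Complex.I)) (nhdsWithin 0 (Set.Ioi 0))
      (nhds (B (y * Complex.I))) := by
    have h1 : ContinuousAt B (y * Complex.I) := (hBd.differentiableAt (hVo.mem_nhds hyV)).continuousAt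
    have h2 : Continuous fun ε : ℝ => (ε + y * Complex.I : ℂ) := by fun_prop
    have h3 : Filter.Tendsto (fun ε : ℝ => (ε + y * Complex.I : ℂ)) (nhdsWithin 0 (Set.Ioi 0))
        (nhds (y * Complex.I)) := by
      have := (h2.tendsto 0).mono_left (nhdsWithin_le_nhds (s := Set.Ioi (0 : ℝ)))
      simpa using this
    exact h1.tendsto.comp h3
  have hev : (fun ε : ℝ => laplace h (ε + y * Complex.I)) =ᶠ[nhdsWithin 0 (Set.Ioi 0)]
      fun ε : ℝ => B (ε + y * Complex.I) := by
    filter_upwards [self_mem_nhdsWithin] with ε hε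
    have hε' : 0 < ε := hε
    refine heq ⟨by simpa using hε', ?_⟩
    simp only [hV, Set.mem_ofPred_eq, Complex.add_re, Complex.add_im, Complex.ofReal_re,
      Complex.ofReal_im, Complex.re_ofReal_mul, Complex.im_ofReal_mul, Complex.I_re, Complex.I_im]
    linarith
  have hlim : laplace h (y * Complex.I) = B (y * Complex.I) :=
    tendsto_nhds_unique (tendsto_laplace hh y) (hBc.congr' hev.symm)
  have hre : (B (y * Complex.I)).re = 0 := by
    have hs : Summable fun j : ℕ =>
        ((t j * (2 * j).factorial : ℝ) : ℂ) / (y * Complex.I : ℂ) ^ (2 * j + 1) :=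
      Summable.of_norm_bounded hgeo fun j => hbound j _ hyV
    rw [hB, Complex.re_tsum hs]
    refine (tsum_congr fun j => ?_).trans tsum_zero
    rw [pow_succ, pow_mul, mul_pow, Complex.I_sq]
    have : ((t j * (2 * j).factorial : ℝ) : ℂ) / (((y : ℂ) ^ 2 * -1) ^ j * (y * Complex.I))
        = ((-(t j * (2 * j).factorial / ((y ^ 2 * -1) ^ j * y)) : ℝ) : ℂ) * Complex.I := by
      push_cast
      have hy0 : (y : ℂ) ≠ 0 := by
        exact_mod_cast (by linarith : (0 : ℝ) < y).ne'
      rw [div_eq_iff (by simp [hy0])]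
      field_simp
      rw [Complex.I_sq]
      ring
    rw [this, Complex.re_ofReal_mul, Complex.I_re, mul_zero]
  rw [← re_laplace_mul_I hh, hlim, hre]

/-- The cosine transform of a function on the positive half-line. -/
noncomputable def cosTransform (h : ℝ → ℝ) (y : ℝ) : ℝ :=
  ∫ x in Set.Ioi (0 : ℝ), h x * Real.cos (y * x)

theorem cosTransform_neg (h : ℝ → ℝ) (y : ℝ) : cosTransform h (-y) = cosTransform h y := by
  simp [cosTransform]

theorem cosTransform_abs (h : ℝ → ℝ) (y : ℝ) : cosTransform h |y| = cosTransform h y := by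
  rcases abs_choice y with hy | hy <;> rw [hy]
  exact cosTransform_neg h y

theorem integrableOn_mul_cos {h : ℝ → ℝ} (hh : IntegrableOn h (Set.Ioi 0)) (y : ℝ) :
    IntegrableOn (fun x => h x * Real.cos (y * x)) (Set.Ioi 0) := by
  have hc : Continuous fun x => Real.cos (y * x) := by fun_prop
  refine Integrable.mono (g := h) hh (hh.aestronglyMeasurable.mul hc.aestronglyMeasurable) ?_
  refine Filter.Eventually.of_forall fun x => ?_
  rw [norm_mul]
  exact mul_le_of_le_one_right (norm_nonneg _) (Real.abs_cos_le_one _)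

theorem continuous_cosTransform {h : ℝ → ℝ} (hh : IntegrableOn h (Set.Ioi 0)) :
    Continuous (cosTransform h) := by
  refine continuous_of_dominated (bound := fun x => ‖h x‖) (fun y => ?_) (fun y => ?_) hh.norm ?_
  · exact (integrableOn_mul_cos hh y).aestronglyMeasurable
  · refine Filter.Eventually.of_forall fun x => ?_
    rw [norm_mul]
    exact mul_le_of_le_one_right (norm_nonneg _) (Real.abs_cos_le_one _)
  · exact Filter.Eventually.of_forall fun x => by fun_prop

theorem integrable_comp_abs {h : ℝ → ℝ} (hh : IntegrableOn h (Set.Ioi 0)) :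
    Integrable fun x => h |x| := by
  rw [← integrableOn_univ, ← Set.Iic_union_Ioi (a := (0 : ℝ)), integrableOn_union]
  have h2 : IntegrableOn (fun x => h |x|) (Set.Ioi 0) :=
    hh.congr_fun (fun x hx => by simp only [abs_of_pos (show (0 : ℝ) < x from hx)]) measurableSet_Ioi
  refine ⟨?_, h2⟩
  rw [integrableOn_Iic_iff_integrableOn_Iio]
  have h3 : IntegrableOn (fun x => h |x|) (Set.Ioi (-0)) := by rwa [neg_zero]
  simpa using h3.comp_neg_Iio

open FourierTransform in
theorem fourier_comp_abs {h : ℝ → ℝ} (hh : IntegrableOn h (Set.Ioi 0)) (w : ℝ) :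
    𝓕 (fun x : ℝ => (h |x| : ℂ)) w = ((2 * cosTransform h (2 * Real.pi * w) : ℝ) : ℂ) := by
  have hi := integrable_comp_abs hh
  rw [Real.fourier_real_eq]
  set c : ℝ → ℝ := fun v => h |v| * Real.cos (2 * Real.pi * w * v) with hc
  set d : ℝ → ℝ := fun v => -(h |v| * Real.sin (2 * Real.pi * w * v)) with hd
  have hpt : ∀ v : ℝ, (Real.fourierChar (-(v * w)) • (h |v| : ℂ)) =
      (c v : ℂ) + (d v : ℂ) * Complex.I := by
    intro v
    rw [Circle.smul_def, Real.fourierChar_apply, Complex.exp_ofReal_mul_I, smul_eq_mul,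
      show 2 * Real.pi * -(v * w) = -(2 * Real.pi * w * v) by ring, Real.cos_neg,
      Real.sin_neg, hc, hd]
    push_cast
    ring
  have hcc : Continuous fun v => Real.cos (2 * Real.pi * w * v) := by fun_prop
  have hcs : Continuous fun v => Real.sin (2 * Real.pi * w * v) := by fun_prop
  have hci : Integrable c := by
    refine hi.mono (hi.aestronglyMeasurable.mul hcc.aestronglyMeasurable)
      (Filter.Eventually.of_forall fun x => ?_)
    rw [hc, norm_mul]
    exact mul_le_of_le_one_right (norm_nonneg _) (Real.abs_cos_le_one _)
  have hdi : Integrable d := by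
    refine hi.mono (hi.aestronglyMeasurable.mul hcs.aestronglyMeasurable).neg
      (Filter.Eventually.of_forall fun x => ?_)
    rw [hd, norm_neg, norm_mul]
    exact mul_le_of_le_one_right (norm_nonneg _) (Real.abs_sin_le_one _)
  have hd0 : ∫ v, d v = 0 := by
    have h1 := integral_neg_eq_self d volume
    have h2 : ∀ v, d (-v) = -d v := fun v => by simp [hd]
    simp only [h2, integral_neg] at h1
    linarith
  have hc0 : ∫ v, c v = 2 * cosTransform h (2 * Real.pi * w) := by
    rw [cosTransform, ← integral_comp_abs]
    refine integral_congr_ae (Filter.Eventually.of_forall fun v => ?_)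
    simp only [hc]
    rcases abs_choice v with hv | hv <;> rw [hv]
    rw [mul_neg, Real.cos_neg]
  simp_rw [hpt]
  rw [integral_add hci.ofReal (hdi.ofReal.mul_const _), integral_mul_const, integral_complex_ofReal,
    integral_complex_ofReal, hd0, hc0]
  simp

open FourierTransform in
/-- Inversion of the cosine transform. -/
theorem eq_cosTransform_cosTransform {h : ℝ → ℝ} (hc : Continuous h)
    (hh : IntegrableOn h (Set.Ioi 0)) (hC : IntegrableOn (cosTransform h) (Set.Ioi 0)) {x : ℝ}
    (hx : 0 ≤ x) : h x = 2 / Real.pi * cosTransform (cosTransform h) x := by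
  set g : ℝ → ℂ := fun x : ℝ => (h |x| : ℂ) with hg
  set h2 : ℝ → ℝ := fun w => 2 * cosTransform h (2 * Real.pi * w) with hh2
  have hpi : (0 : ℝ) < 2 * Real.pi := by positivity
  have hi2 : IntegrableOn h2 (Set.Ioi 0) := by
    refine Integrable.const_mul ?_ _
    have := (integrableOn_Ioi_comp_mul_left_iff (cosTransform h) 0 hpi).mpr (by simpa using hC)
    exact this
  have hFg : 𝓕 g = fun w : ℝ => (h2 |w| : ℂ) := by
    funext w
    rw [hg, fourier_comp_abs hh, hh2, ← cosTransform_abs, abs_mul, abs_of_pos hpi]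
  have hgc : Continuous g := by fun_prop
  have hgi : Integrable g := (integrable_comp_abs hh).ofReal
  have hinv := congrFun (hgc.fourierInv_fourier_eq hgi
    (by rw [hFg]; exact (integrable_comp_abs hi2).ofReal)) x
  rw [Real.fourierInv_eq_fourier_neg, hFg, fourier_comp_abs hi2, hg] at hinv
  simp only [abs_of_nonneg hx] at hinv
  rw [← Complex.ofReal_injective hinv, mul_neg, cosTransform_neg]
  have h4 := integral_comp_mul_left_Ioi (fun u => 2 * (cosTransform h u * Real.cos (x * u))) 0 hpi
  rw [mul_zero] at h4
  rw [cosTransform, cosTransform]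
  have h5 : ∀ v, h2 v * Real.cos (2 * Real.pi * x * v)
      = 2 * (cosTransform h (2 * Real.pi * v) * Real.cos (x * (2 * Real.pi * v))) := by
    intro v
    rw [hh2, show 2 * Real.pi * x * v = x * (2 * Real.pi * v) by ring]
    ring
  simp_rw [h5]
  rw [h4, smul_eq_mul, integral_const_mul]
  field_simp

theorem integrable_of_cosTransform_eq_zero {h : ℝ → ℝ} (hh : IntegrableOn h (Set.Ioi 0)) {M : ℝ}
    (hM : ∀ y, M < y → cosTransform h y = 0) : Integrable (cosTransform h) := by
  refine (continuous_cosTransform hh).integrable_of_hasCompactSupport ?_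
  refine HasCompactSupport.intro (isCompact_Icc (a := -M) (b := M)) fun y hy => ?_
  rw [← cosTransform_abs]
  refine hM _ ?_
  by_contra! hle
  exact hy (abs_le.mp hle)

theorem eq_integral_cosTransform_mul_cos {h : ℝ → ℝ} (hc : Continuous h)
    (hh : IntegrableOn h (Set.Ioi 0)) (hC : Integrable (cosTransform h)) {x : ℝ}
    (hx : 0 ≤ x) : h x = 1 / Real.pi * ∫ u, cosTransform h u * Real.cos (u * x) := by
  rw [eq_cosTransform_cosTransform hc hh hC.integrableOn hx]
  have : ∫ u, cosTransform h u * Real.cos (u * x)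
      = ∫ u, (fun v => cosTransform h v * Real.cos (x * v)) |u| := by
    refine integral_congr_ae (Filter.Eventually.of_forall fun v => ?_)
    simp only [cosTransform_abs]
    rcases abs_choice v with hv | hv <;> rw [hv]
    · rw [mul_comm x]
    · rw [mul_neg, Real.cos_neg, mul_comm x]
  rw [this, integral_comp_abs (f := fun v => cosTransform h v * Real.cos (x * v))]
  simp only [cosTransform]
  ring

/-- The cosine transform turns products into convolutions. -/
theorem cosTransform_mul {h g : ℝ → ℝ} (hc : Continuous h) (hh : IntegrableOn h (Set.Ioi 0))
    (hg : IntegrableOn g (Set.Ioi 0)) (hC : Integrable (cosTransform h)) (w : ℝ) :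
    cosTransform (fun x => h x * g x) w
      = 1 / Real.pi * ∫ u, cosTransform h u * cosTransform g (w - u) := by
  set Φ : ℝ → ℝ → ℝ := fun x u => cosTransform h u * (g x * (Real.cos (u * x) * Real.cos (w * x)))
    with hΦ
  have hΦi : Integrable (Function.uncurry Φ) ((volume.restrict (Set.Ioi 0)).prod volume) := by
    have h0 := Integrable.mul_prod hg hC
    have hcont : Continuous fun p : ℝ × ℝ => Real.cos (p.2 * p.1) * Real.cos (w * p.1) := by fun_prop
    refine (h0.mul_bdd (c := 1) hcont.aestronglyMeasurable
      (Filter.Eventually.of_forall fun p => ?_)).congr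
      (Filter.Eventually.of_forall fun p => ?_)
    · rw [norm_mul]
      exact mul_le_one₀ (Real.abs_cos_le_one _) (norm_nonneg _) (Real.abs_cos_le_one _)
    · simp only [hΦ, Function.uncurry]
      ring
  have h1 : cosTransform (fun x => h x * g x) w
      = 1 / Real.pi * ∫ x in Set.Ioi (0 : ℝ), ∫ u, Φ x u := by
    rw [cosTransform, ← integral_const_mul]
    refine setIntegral_congr_fun measurableSet_Ioi fun x hx => ?_
    have hx0 : (0 : ℝ) < x := hx
    rw [eq_integral_cosTransform_mul_cos hc hh hC hx0.le, mul_assoc, mul_assoc,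
      ← integral_mul_const]
    congr 2
    funext u
    simp only [hΦ]
    ring
  have h2 : ∀ u, ∫ x in Set.Ioi (0 : ℝ), Φ x u
      = 1 / 2 * (cosTransform h u * cosTransform g (w - u))
        + 1 / 2 * (cosTransform h u * cosTransform g (w + u)) := by
    intro u
    simp only [hΦ]
    rw [integral_const_mul, ← mul_add, ← mul_add, cosTransform.eq_def g, cosTransform.eq_def g,
      ← integral_add (integrableOn_mul_cos hg _) (integrableOn_mul_cos hg _), mul_left_comm]
    congr 1
    rw [← integral_const_mul]
    congr 1
    funext x
    rw [sub_mul, add_mul, Real.cos_sub, Real.cos_add]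
    ring
  have hb : ∀ y, ‖cosTransform g y‖ ≤ ∫ x in Set.Ioi (0 : ℝ), ‖g x‖ := by
    intro y
    refine (norm_integral_le_integral_norm _).trans (integral_mono (integrableOn_mul_cos hg y).norm
      hg.norm fun x => ?_)
    simp only [norm_mul]
    exact mul_le_of_le_one_right (norm_nonneg _) (Real.abs_cos_le_one _)
  have hi1 : Integrable fun u => cosTransform h u * cosTransform g (w - u) :=
    hC.mul_bdd ((continuous_cosTransform hg).comp (by fun_prop)).aestronglyMeasurable
      (Filter.Eventually.of_forall fun u => hb _)
  have hi2 : Integrable fun u => cosTransform h u * cosTransform g (w + u) :=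
    hC.mul_bdd ((continuous_cosTransform hg).comp (by fun_prop)).aestronglyMeasurable
      (Filter.Eventually.of_forall fun u => hb _)
  have h3 : ∫ u, cosTransform h u * cosTransform g (w + u)
      = ∫ u, cosTransform h u * cosTransform g (w - u) := by
    rw [← integral_neg_eq_self]
    refine integral_congr_ae (Filter.Eventually.of_forall fun u => ?_)
    simp only [cosTransform_neg, sub_eq_add_neg]
  rw [h1, integral_integral_swap hΦi]
  simp_rw [h2]
  rw [integral_add (hi1.const_mul _) (hi2.const_mul _), integral_const_mul, integral_const_mul, h3]
  ring

/-- A cosine transform vanishing beyond `R` vanishes at `R` to the order of the moments. -/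
theorem abs_cosTransform_sub_le {h : ℝ → ℝ} {N : ℕ} (hh : IntegrableOn h (Set.Ioi 0))
    (hN : IntegrableOn (fun x => x ^ N * h x) (Set.Ioi 0)) {R : ℝ}
    (hR : ∀ y, R ≤ y → cosTransform h y = 0) {t : ℝ} (ht : 0 ≤ t) :
    |cosTransform h (R - t)| ≤ t ^ N * ∫ x in Set.Ioi (0 : ℝ), ‖x ^ N * h x‖ := by
  have hexp : ∀ x : ℝ, ∑ j ∈ Finset.range (N + 1),
      ((-1 : ℝ) ^ j * N.choose j) * (h x * Real.cos ((R - t + j * t) * x))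
      = h x * (Complex.exp (((R - t) * x : ℝ) * Complex.I)
        * (1 - Complex.exp ((t * x : ℝ) * Complex.I)) ^ N).re := by
    intro x
    rw [sub_eq_neg_add 1, add_pow, Finset.mul_sum, Complex.re_sum, Finset.mul_sum]
    refine Finset.sum_congr rfl fun j _ => ?_
    rw [one_pow, mul_one, neg_pow (Complex.exp _), ← Complex.exp_nat_mul]
    have e1 : Complex.exp (((R - t) * x : ℝ) * Complex.I) * ((-1) ^ j
        * Complex.exp (j * ((t * x : ℝ) * Complex.I)) * (N.choose j : ℂ))
        = (((-1 : ℝ) ^ j * N.choose j : ℝ) : ℂ)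
          * Complex.exp (((R - t + j * t) * x : ℝ) * Complex.I) := by
      have : ((((R - t + j * t) * x : ℝ) : ℂ) * Complex.I)
          = ((R - t) * x : ℝ) * Complex.I + j * ((t * x : ℝ) * Complex.I) := by
        push_cast
        ring
      rw [this, Complex.exp_add]
      push_cast
      ring
    rw [e1, Complex.re_ofReal_mul, Complex.exp_ofReal_mul_I_re]
    ring
  have hsum : cosTransform h (R - t) = ∫ x in Set.Ioi (0 : ℝ),
      h x * (Complex.exp (((R - t) * x : ℝ) * Complex.I)
        * (1 - Complex.exp ((t * x : ℝ) * Complex.I)) ^ N).re := by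
    simp_rw [← hexp]
    rw [integral_finsetSum _ fun j _ => (integrableOn_mul_cos hh _).const_mul _]
    simp_rw [integral_const_mul]
    rw [Finset.sum_range_succ']
    rw [Finset.sum_eq_zero]
    · simp [cosTransform]
    · intro j _
      have := hR (R - t + (j + 1 : ℕ) * t) (by
        push_cast
        nlinarith [(Nat.cast_nonneg j : (0 : ℝ) ≤ j)])
      rw [cosTransform] at this
      rw [this, mul_zero]
  rw [hsum, ← integral_const_mul, ← Real.norm_eq_abs]
  refine norm_integral_le_of_norm_le (hN.norm.const_mul _) ?_
  filter_upwards [ae_restrict_mem measurableSet_Ioi] with x hx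
  have hx0 : (0 : ℝ) < x := hx
  have h1 : ‖(1 - Complex.exp ((t * x : ℝ) * Complex.I))‖ ≤ t * x := by
    rw [norm_sub_rev, mul_comm]
    refine (Real.norm_exp_I_mul_ofReal_sub_one_le).trans ?_
    rw [Real.norm_eq_abs, abs_of_nonneg (by positivity)]
  have h2 : ‖(Complex.exp (((R - t) * x : ℝ) * Complex.I)
      * (1 - Complex.exp ((t * x : ℝ) * Complex.I)) ^ N).re‖ ≤ (t * x) ^ N := by
    refine (Complex.abs_re_le_norm _).trans ?_
    rw [norm_mul, Complex.norm_exp_ofReal_mul_I, one_mul, norm_pow]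
    exact pow_le_pow_left₀ (norm_nonneg _) h1 N
  rw [norm_mul, norm_mul, norm_pow, Real.norm_eq_abs x, abs_of_pos hx0]
  calc _ ≤ ‖h x‖ * (t * x) ^ N := mul_le_mul_of_nonneg_left h2 (norm_nonneg _)
    _ = _ := by ring

theorem integrableOn_exp_neg_mul {s : ℂ} (hs : 0 < s.re) :
    IntegrableOn (fun x : ℝ => Complex.exp (-(s * x))) (Set.Ioi 0) := by
  have := integrableOn_exp_mul_complex_Ioi (a := -s) (by simpa using hs) 0
  simpa only [neg_mul] using this

theorem integral_exp_neg_mul {s : ℂ} (hs : 0 < s.re) :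
    ∫ x in Set.Ioi (0 : ℝ), Complex.exp (-(s * x)) = 1 / s := by
  have := integral_exp_mul_complex_Ioi (a := -s) (by simpa using hs) 0
  simpa [neg_mul] using this

theorem integral_exp_neg_mul_mul_cos {s : ℂ} (hs : 0 < s.re) (u : ℝ) :
    ∫ x in Set.Ioi (0 : ℝ), Complex.exp (-(s * x)) * Real.cos (u * x) = s / (s ^ 2 + u ^ 2) := by
  have h1 : 0 < (s - u * Complex.I).re := by simpa using hs
  have h2 : 0 < (s + u * Complex.I).re := by simpa using hs
  have e : ∀ x : ℝ, Complex.exp (-(s * x)) * Real.cos (u * x)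
      = 1 / 2 * Complex.exp (-((s - u * Complex.I) * x))
        + 1 / 2 * Complex.exp (-((s + u * Complex.I) * x)) := by
    intro x
    rw [Complex.ofReal_cos, Complex.cos,
      show -((s - u * Complex.I) * x) = -(s * x) + ((u * x : ℝ) : ℂ) * Complex.I by push_cast; ring,
      show -((s + u * Complex.I) * x) = -(s * x) + -((u * x : ℝ) : ℂ) * Complex.I by push_cast; ring,
      Complex.exp_add, Complex.exp_add]
    ring
  simp_rw [e]
  rw [integral_add ((integrableOn_exp_neg_mul h1).const_mul _)
    ((integrableOn_exp_neg_mul h2).const_mul _), integral_const_mul, integral_const_mul,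
    integral_exp_neg_mul h1, integral_exp_neg_mul h2]
  have n1 : s - u * Complex.I ≠ 0 := fun h => by rw [h] at h1; simp at h1
  have n2 : s + u * Complex.I ≠ 0 := fun h => by rw [h] at h2; simp at h2
  have n3 : s ^ 2 + (u : ℂ) ^ 2 = (s - u * Complex.I) * (s + u * Complex.I) := by
    ring_nf
    rw [Complex.I_sq]
    ring
  rw [n3]
  field_simp
  ring

theorem laplace_eq_integral_cosTransform {g : ℝ → ℝ} (hc : Continuous g)
    (hg : IntegrableOn g (Set.Ioi 0)) (hC : Integrable (cosTransform g)) {s : ℂ} (hs : 0 < s.re) :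
    laplace g s = 1 / Real.pi * ∫ u, (cosTransform g u : ℂ) * (s / (s ^ 2 + u ^ 2)) := by
  set Φ : ℝ → ℝ → ℂ := fun x u =>
    (cosTransform g u : ℂ) * (Complex.exp (-(s * x)) * Real.cos (u * x)) with hΦ
  have hΦi : Integrable (Function.uncurry Φ) ((volume.restrict (Set.Ioi 0)).prod volume) := by
    have h0 := Integrable.mul_prod (integrableOn_exp_neg_mul hs) (hC.ofReal (𝕜 := ℂ))
    have hcont : Continuous fun p : ℝ × ℝ => (Real.cos (p.2 * p.1) : ℂ) := by fun_prop
    refine (h0.mul_bdd (c := 1) hcont.aestronglyMeasurable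
      (Filter.Eventually.of_forall fun p => ?_)).congr
      (Filter.Eventually.of_forall fun p => ?_)
    · rw [Complex.norm_real]
      exact Real.abs_cos_le_one _
    · simp only [hΦ, Function.uncurry, RCLike.ofReal_eq_complex_ofReal]
      ring
  have h1 : laplace g s = 1 / Real.pi * ∫ x in Set.Ioi (0 : ℝ), ∫ u, Φ x u := by
    rw [laplace, ← integral_const_mul]
    refine setIntegral_congr_fun measurableSet_Ioi fun x hx => ?_
    have hx0 : (0 : ℝ) < x := hx
    have e : (∫ u, Φ x u) = Complex.exp (-(s * x))
        * ((∫ u, cosTransform g u * Real.cos (u * x) : ℝ) : ℂ) := by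
      rw [← integral_complex_ofReal, ← integral_const_mul]
      congr 1
      funext u
      simp only [hΦ]
      push_cast
      ring
    simp only [e]
    rw [eq_integral_cosTransform_mul_cos hc hg hC hx0.le]
    push_cast
    ring
  rw [h1, integral_integral_swap hΦi]
  simp only [hΦ, integral_const_mul, integral_exp_neg_mul_mul_cos hs]

theorem one_sub_le_norm_one_add {M r u : ℝ} {w : ℂ} (hu : |u| ≤ M) (hw : ‖w‖ ≤ r) :
    1 - M ^ 2 * r ^ 2 ≤ ‖1 + (u : ℂ) ^ 2 * w ^ 2‖ := by
  have h1 : ‖(u : ℂ) ^ 2 * w ^ 2‖ ≤ M ^ 2 * r ^ 2 := by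
    rw [norm_mul, norm_pow, norm_pow, Complex.norm_real, Real.norm_eq_abs]
    gcongr
  have h2 := norm_sub_norm_le (1 : ℂ) (-((u : ℂ) ^ 2 * w ^ 2))
  rw [norm_one, norm_neg, sub_neg_eq_add] at h2
  linarith

theorem differentiableOn_integral_div {C : ℝ → ℝ} (hC : Integrable C) {M : ℝ} (hM : 0 < M)
    (h0 : ∀ u, M < |u| → C u = 0) :
    DifferentiableOn ℂ (fun w : ℂ => ∫ u, (C u : ℂ) / (1 + (u : ℂ) ^ 2 * w ^ 2))
      (Metric.ball 0 (1 / M)) := by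
  intro w₀ hw₀
  rw [mem_ball_zero_iff] at hw₀
  obtain ⟨r, hr1, hr2⟩ := exists_between hw₀
  have hr0 : 0 ≤ r := (norm_nonneg _).trans hr1.le
  have hMr : M * r < 1 := by rwa [lt_div_iff₀ hM, mul_comm] at hr2
  set κ := 1 - M ^ 2 * r ^ 2 with hκ
  have hκ0 : 0 < κ := by
    have := mul_nonneg hM.le hr0
    rw [hκ, ← mul_pow]
    nlinarith
  have hopen : Metric.ball (0 : ℂ) r ∈ nhds w₀ :=
    Metric.isOpen_ball.mem_nhds (by rwa [mem_ball_zero_iff])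
  have hlow : ∀ u : ℝ, |u| ≤ M → ∀ w ∈ Metric.ball (0 : ℂ) r, κ ≤ ‖1 + (u : ℂ) ^ 2 * w ^ 2‖ :=
    fun u hu w hw => one_sub_le_norm_one_add hu (mem_ball_zero_iff.mp hw).le
  have hm : ∀ w : ℂ, AEStronglyMeasurable (fun u : ℝ => (C u : ℂ) / (1 + (u : ℂ) ^ 2 * w ^ 2))
      volume := fun w =>
    ((Complex.measurable_ofReal.comp_aemeasurable hC.aemeasurable).div
      (Measurable.aemeasurable (by fun_prop))).aestronglyMeasurable
  have := hasDerivAt_integral_of_dominated_loc_of_deriv_le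
    (μ := volume) (bound := fun u => M ^ 2 * (2 * r) / κ ^ 2 * ‖C u‖)
    (F := fun (w : ℂ) (u : ℝ) => (C u : ℂ) / (1 + (u : ℂ) ^ 2 * w ^ 2))
    (F' := fun (w : ℂ) (u : ℝ) => -((C u : ℂ) * ((u : ℂ) ^ 2 * (2 * w)))
      / (1 + (u : ℂ) ^ 2 * w ^ 2) ^ 2)
    hopen (Filter.Eventually.of_forall hm) ?_ ?_ ?_ (hC.norm.const_mul _) ?_
  · exact this.2.differentiableAt.differentiableWithinAt
  · refine Integrable.mono (hC.norm.const_mul (1 / κ)) (hm w₀) (Filter.Eventually.of_forall fun u => ?_)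
    rcases le_or_gt |u| M with hu | hu
    · have := hlow u hu w₀ (by rwa [mem_ball_zero_iff])
      rw [norm_div, Complex.norm_real, norm_mul, norm_norm,
        Real.norm_of_nonneg (one_div_pos.mpr hκ0).le, one_div, inv_mul_eq_div]
      gcongr
    · simp [h0 u hu]
  · exact ((((Complex.measurable_ofReal.comp_aemeasurable hC.aemeasurable).mul
      (Measurable.aemeasurable (by fun_prop))).neg).div
      (Measurable.aemeasurable (by fun_prop))).aestronglyMeasurable
  · refine Filter.Eventually.of_forall fun u w hw => ?_
    rcases le_or_gt |u| M with hu | hu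
    · have h1 := hlow u hu w hw
      have h2 := (mem_ball_zero_iff.mp hw).le
      rw [norm_div, norm_neg, norm_mul, norm_mul, norm_mul, norm_pow, norm_pow, Complex.norm_real,
        Complex.norm_real, Complex.norm_ofNat, Real.norm_eq_abs u]
      calc _ ≤ ‖C u‖ * (M ^ 2 * (2 * r)) / κ ^ 2 := by gcongr
        _ = _ := by ring
    · simp [h0 u hu]
  · refine Filter.Eventually.of_forall fun u w hw => ?_
    rcases le_or_gt |u| M with hu | hu
    · have h1 := hlow u hu w hw
      have hne : 1 + (u : ℂ) ^ 2 * w ^ 2 ≠ 0 := fun h => by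
        rw [h, norm_zero] at h1
        linarith
      have hd : HasDerivAt (fun w : ℂ => 1 + (u : ℂ) ^ 2 * w ^ 2) ((u : ℂ) ^ 2 * (2 * w)) w := by
        simpa using ((hasDerivAt_pow 2 w).const_mul ((u : ℂ) ^ 2)).const_add 1
      have hd2 := (hasDerivAt_const w (C u : ℂ)).div hd hne
      exact hd2.congr_deriv (by rw [zero_mul, zero_sub])
    · simp only [h0 u hu, Complex.ofReal_zero, zero_div, zero_mul, neg_zero]
      exact hasDerivAt_const _ _

/-- On the imaginary axis, beyond the support of the cosine transform of `g`, the function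
`1 - s * laplace g s` has zeros of finite order only. -/
theorem exists_pow_le_norm_one_sub_laplace {g : ℝ → ℝ} (hc : Continuous g)
    (hg : IntegrableOn g (Set.Ioi 0)) {M : ℝ} (hM : 0 < M) (h0 : ∀ y, M < y → cosTransform g y = 0)
    (hne : ∀ r : ℝ, 0 < r → 1 - r * laplace g r ≠ 0) {y₀ : ℝ} (hy₀ : M < y₀) :
    ∃ c : ℝ, 0 < c ∧ ∃ N : ℕ, ∃ δ : ℝ, 0 < δ ∧ ∀ y, y₀ - δ < y → y < y₀ →
      c * (y₀ - y) ^ N ≤ ‖1 - y * Complex.I * laplace g (y * Complex.I)‖ := by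
  have hC := integrable_of_cosTransform_eq_zero hg h0
  have h0' : ∀ u, M < |u| → cosTransform g u = 0 := fun u hu => by
    rw [← cosTransform_abs, h0 _ hu]
  set Θ : ℂ → ℂ := fun w =>
    1 - 1 / Real.pi * ∫ u, (cosTransform g u : ℂ) / (1 + (u : ℂ) ^ 2 * w ^ 2) with hΘ
  have hΘd : DifferentiableOn ℂ Θ (Metric.ball 0 (1 / M)) :=
    ((differentiableOn_integral_div hC hM h0').const_mul _).const_sub 1
  have hΘa : AnalyticOnNhd ℂ Θ (Metric.ball 0 (1 / M)) := hΘd.analyticOnNhd Metric.isOpen_ball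
  have hΘs : ∀ s : ℂ, 0 < s.re → 1 - s * laplace g s = Θ (1 / s) := by
    intro s hs
    have hs0 : s ≠ 0 := fun h => by simp [h] at hs
    rw [laplace_eq_integral_cosTransform hc hg hC hs, hΘ, mul_left_comm, ← integral_const_mul]
    congr 3
    funext u
    rcases eq_or_ne (s ^ 2 + (u : ℂ) ^ 2) 0 with h | h
    · have : 1 + (u : ℂ) ^ 2 * (1 / s) ^ 2 = 0 := by
        rw [one_div, inv_pow, ← div_eq_mul_inv, one_add_div (pow_ne_zero 2 hs0), h, zero_div]
      rw [h, this, div_zero, div_zero, mul_zero, mul_zero]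
    · have : 1 + (u : ℂ) ^ 2 * (1 / s) ^ 2 = (s ^ 2 + (u : ℂ) ^ 2) / s ^ 2 := by
        field_simp
      rw [this]
      field_simp
  have hball : ∀ y : ℝ, M < y → (1 / (y * Complex.I) : ℂ) ∈ Metric.ball (0 : ℂ) (1 / M) := by
    intro y hy
    have : 0 < y := hM.trans hy
    rw [mem_ball_zero_iff, norm_div, norm_mul, Complex.norm_I, Complex.norm_real, mul_one, norm_one,
      Real.norm_of_nonneg this.le]
    exact one_div_lt_one_div_of_lt hM hy
  have hΘy : ∀ y : ℝ, M < y →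
      1 - y * Complex.I * laplace g (y * Complex.I) = Θ (1 / (y * Complex.I)) := by
    intro y hy
    have hy0 : (y * Complex.I : ℂ) ≠ 0 := by
      simpa using (hM.trans hy).ne'
    have hε : Filter.Tendsto (fun ε : ℝ => (ε + y * Complex.I : ℂ)) (nhdsWithin 0 (Set.Ioi 0))
        (nhds (y * Complex.I)) := by
      have h2 : Continuous fun ε : ℝ => (ε + y * Complex.I : ℂ) := by fun_prop
      have := (h2.tendsto 0).mono_left (nhdsWithin_le_nhds (s := Set.Ioi (0 : ℝ)))
      simpa using this
    have l1 := (hε.mul (tendsto_laplace hg y)).const_sub 1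
    have l2 : Filter.Tendsto (fun ε : ℝ => Θ (1 / (ε + y * Complex.I)))
        (nhdsWithin 0 (Set.Ioi 0)) (nhds (Θ (1 / (y * Complex.I)))) :=
      (hΘa _ (hball y hy)).continuousAt.tendsto.comp (tendsto_const_nhds.div hε hy0)
    refine tendsto_nhds_unique l1 (l2.congr' ?_)
    filter_upwards [self_mem_nhdsWithin] with ε hε
    exact (hΘs _ (by simpa using (show (0 : ℝ) < ε from hε))).symm
  set w₀ : ℂ := 1 / (y₀ * Complex.I) with hw₀
  have hw₀b := hball y₀ hy₀
  have hnz : ¬ ∀ᶠ w in nhds w₀, Θ w = 0 := by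
    intro h
    have hz := hΘa.eqOn_zero_of_preconnected_of_eventuallyEq_zero
      (convex_ball _ _).isPreconnected hw₀b h
    have hr : 0 < M + 1 := by linarith
    refine hne (M + 1) hr ?_
    rw [hΘs _ (by simpa using hr)]
    refine hz ?_
    rw [mem_ball_zero_iff, norm_div, Complex.norm_real, norm_one, Real.norm_of_nonneg hr.le]
    exact one_div_lt_one_div_of_lt hM (by linarith)
  obtain ⟨N, G, hGa, hG0, hGe⟩ :=
    (hΘa _ hw₀b).exists_eventuallyEq_pow_smul_nonzero_iff.mpr hnz
  have hGn : ∀ᶠ w in nhds w₀, ‖G w₀‖ / 2 < ‖G w‖ :=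
    hGa.continuousAt.norm.eventually_const_lt (by linarith [norm_pos_iff.mpr hG0])
  have hy₀0 : 0 < y₀ := hM.trans hy₀
  have hcont : Filter.Tendsto (fun y : ℝ => (1 / (y * Complex.I) : ℂ)) (nhds y₀) (nhds w₀) := by
    refine tendsto_const_nhds.div ?_ (by simpa using hy₀0.ne')
    exact Continuous.tendsto (by fun_prop : Continuous fun y : ℝ => (y * Complex.I : ℂ)) y₀
  have hall := (hcont.eventually (hGn.and hGe)).and (lt_mem_nhds hy₀)
  obtain ⟨δ, hδ, hball'⟩ := Metric.eventually_nhds_iff.mp hall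
  refine ⟨‖G w₀‖ / 2 / (y₀ ^ 2) ^ N, by have := norm_pos_iff.mpr hG0; positivity, N, δ, hδ,
    fun y hy1 hy2 => ?_⟩
  obtain ⟨⟨hy3, hy4⟩, hy5⟩ := hball' (y := y) (by
    rw [Real.dist_eq, abs_lt]
    constructor <;> linarith)
  rw [hΘy y hy5, hy4, norm_smul, norm_pow]
  have hy0 : 0 < y := hM.trans hy5
  have hdist : (y₀ - y) / y₀ ^ 2 ≤ ‖(1 / (y * Complex.I) : ℂ) - w₀‖ := by
    have : (1 / (y * Complex.I) : ℂ) - w₀ = (((y₀ - y) / (y * y₀) : ℝ) : ℂ) / Complex.I := by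
      have a1 : (y : ℂ) ≠ 0 := by exact_mod_cast hy0.ne'
      have a2 : (y₀ : ℂ) ≠ 0 := by exact_mod_cast hy₀0.ne'
      rw [hw₀]
      push_cast
      field_simp
    rw [this, norm_div, Complex.norm_I, div_one, Complex.norm_real,
      Real.norm_of_nonneg (div_nonneg (by linarith) (by positivity))]
    refine div_le_div_of_nonneg_left (by linarith) (by positivity) ?_
    nlinarith
  calc _ = ((y₀ - y) / y₀ ^ 2) ^ N * (‖G w₀‖ / 2) := by
        rw [div_pow]
        field_simp
    _ ≤ _ := by
      have : 0 ≤ (y₀ - y) / y₀ ^ 2 := div_nonneg (by linarith) (by positivity)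
      gcongr

theorem integrableOn_pow_of_abs_le_one {T : ℝ → ℝ} (hT : IntegrableOn T (Set.Ioi 0))
    (h1 : ∀ x, 0 < x → |T x| ≤ 1) (j : ℕ) :
    IntegrableOn (fun x => T x ^ (j + 1)) (Set.Ioi 0) := by
  refine Integrable.mono (g := T) hT (hT.aestronglyMeasurable.pow _) ?_
  filter_upwards [ae_restrict_mem measurableSet_Ioi] with x hx
  rw [pow_succ, norm_mul, norm_pow]
  exact mul_le_of_le_one_left (norm_nonneg _) (pow_le_one₀ (norm_nonneg _) (h1 x hx))

theorem cosTransform_pow_succ {T : ℝ → ℝ} (hc : Continuous T) (hT : IntegrableOn T (Set.Ioi 0))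
    (h1 : ∀ x, 0 < x → |T x| ≤ 1) {R : ℝ} (hR : ∀ y, R ≤ y → cosTransform T y = 0) (j : ℕ) (y : ℝ) :
    cosTransform (fun x => T x ^ (j + 2)) y = 1 / Real.pi *
      ∫ τ, cosTransform T (R - τ) * cosTransform (fun x => T x ^ (j + 1)) (y - (R - τ)) := by
  have h := cosTransform_mul hc hT (integrableOn_pow_of_abs_le_one hT h1 j)
    (integrable_of_cosTransform_eq_zero hT fun y hy => hR y hy.le) y
  simp_rw [← pow_succ'] at h
  rw [h, ← integral_sub_left_eq_self _ _ R]

/-- The support of the cosine transform of a power. -/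
theorem cosTransform_pow_eq_zero {T : ℝ → ℝ} (hc : Continuous T) (hT : IntegrableOn T (Set.Ioi 0))
    (h1 : ∀ x, 0 < x → |T x| ≤ 1) {R : ℝ} (hR : ∀ y, R ≤ y → cosTransform T y = 0) (j : ℕ) :
    ∀ y, (j + 1) * R ≤ y → cosTransform (fun x => T x ^ (j + 1)) y = 0 := by
  induction j with
  | zero => simpa using hR
  | succ j ih =>
    intro y hy
    rw [cosTransform_pow_succ hc hT h1 hR]
    refine mul_eq_zero_of_right _ ?_
    refine integral_eq_zero_of_ae (Filter.Eventually.of_forall fun τ => ?_)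
    rcases le_total τ 0 with hτ | hτ
    · simp [hR (R - τ) (by linarith)]
    · simp only [Pi.zero_apply]
      rw [ih _ (by push_cast at hy ⊢; linarith), mul_zero]

theorem abs_cosTransform_pow_succ_le {T : ℝ → ℝ} (hc : Continuous T)
    (hT : IntegrableOn T (Set.Ioi 0)) (h1 : ∀ x, 0 < x → |T x| ≤ 1) {R : ℝ}
    (hR : ∀ y, R ≤ y → cosTransform T y = 0) (j : ℕ) {r B : ℝ} (hr : 0 ≤ r) (hr1 : r ≤ 1)
    (hB : ∀ τ, 0 ≤ τ → τ ≤ r → |cosTransform T (R - τ)|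
      * |cosTransform (fun x => T x ^ (j + 1)) ((j + 1) * R - (r - τ))| ≤ B) :
    |cosTransform (fun x => T x ^ (j + 2)) ((j + 2) * R - r)| ≤ B := by
  rw [cosTransform_pow_succ hc hT h1 hR]
  set Ψ : ℝ → ℝ := fun τ => cosTransform T (R - τ)
    * cosTransform (fun x => T x ^ (j + 1)) ((j + 2) * R - r - (R - τ)) with hΨ
  have hB0 : 0 ≤ B := (by positivity : (0 : ℝ) ≤ _).trans (hB 0 le_rfl hr)
  have hout : ∀ τ, τ ∉ Set.Icc 0 r → Ψ τ = 0 := by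
    intro τ hτ
    rw [Set.mem_Icc, not_and_or, not_le, not_le] at hτ
    simp only [hΨ]
    rcases hτ with hτ | hτ
    · rw [hR (R - τ) (by linarith), zero_mul]
    · rw [cosTransform_pow_eq_zero hc hT h1 hR j _ (by linarith), mul_zero]
  rw [← setIntegral_eq_integral_of_forall_compl_eq_zero hout, abs_mul]
  have hbd : ‖∫ τ in Set.Icc 0 r, Ψ τ‖ ≤ B * volume.real (Set.Icc 0 r) := by
    refine norm_setIntegral_le_of_norm_le_const (by simp) fun τ hτ => ?_
    rw [hΨ, norm_mul, show ((j : ℝ) + 2) * R - r - (R - τ) = (j + 1) * R - (r - τ) by ring]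
    exact hB τ hτ.1 hτ.2
  rw [Real.volume_real_Icc, max_eq_left (by linarith), sub_zero] at hbd
  have hpi : |1 / Real.pi| ≤ 1 := by
    rw [abs_of_nonneg (by positivity), div_le_one Real.pi_pos]
    linarith [Real.two_le_pi]
  calc _ ≤ 1 * (B * r) := mul_le_mul hpi hbd (abs_nonneg _) zero_le_one
    _ ≤ B := by nlinarith

/-- Near the end of its support, the cosine transform of a power is much smaller than that of the
function itself. -/
theorem abs_cosTransform_pow_le {T : ℝ → ℝ} (hc : Continuous T)
    (hT : IntegrableOn T (Set.Ioi 0)) (h1 : ∀ x, 0 < x → |T x| ≤ 1) {R : ℝ}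
    (hR : ∀ y, R ≤ y → cosTransform T y = 0) {n : ℕ} (hn : 2 ≤ n) {t D S : ℝ} (ht : 0 ≤ t)
    (hnt : n * t ≤ 1) (hS1 : S ≤ 1)
    (hD : ∀ τ, 0 ≤ τ → τ ≤ t → |cosTransform T (R - τ)| ≤ D)
    (hS : ∀ τ, 0 ≤ τ → τ ≤ n * t → |cosTransform T (R - τ)| ≤ S) :
    |cosTransform (fun x => T x ^ n) (n * R - n * t)| ≤ D * S := by
  have hD0 : 0 ≤ D := (abs_nonneg _).trans (hD 0 le_rfl ht)
  have hS0 : 0 ≤ S := (abs_nonneg _).trans (hS 0 le_rfl (by positivity))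
  have hwide : ∀ j : ℕ, ∀ r, 0 ≤ r → r ≤ n * t →
      |cosTransform (fun x => T x ^ (j + 1)) ((j + 1) * R - r)| ≤ S := by
    intro j
    induction j with
    | zero => simpa using hS
    | succ j ih =>
      intro r hr0 hr1
      have := abs_cosTransform_pow_succ_le hc hT h1 hR j hr0 (hr1.trans hnt) (B := S)
        fun τ hτ0 hτ1 => by
          have a1 := hS τ hτ0 (hτ1.trans hr1)
          have a2 := ih (r - τ) (by linarith) (by linarith)
          calc _ ≤ S * S := mul_le_mul a1 a2 (abs_nonneg _) hS0
            _ ≤ S := mul_le_of_le_one_right hS0 hS1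
      convert this using 3
      push_cast
      ring
  have hstep : ∀ j : ℕ, j + 2 ≤ n → (∀ r, 0 ≤ r → r ≤ (j + 1) * t →
      |cosTransform (fun x => T x ^ (j + 1)) ((j + 1) * R - r)| ≤ D) → ∀ r, 0 ≤ r →
      r ≤ (j + 2) * t →
      |cosTransform (fun x => T x ^ (j + 2)) ((j + 2) * R - r)| ≤ D * S := by
    intro j hj ih r hr0 hr1
    have hjn : ((j : ℝ) + 2) ≤ n := by exact_mod_cast hj
    have hrn : r ≤ n * t := hr1.trans (mul_le_mul_of_nonneg_right hjn ht)
    refine abs_cosTransform_pow_succ_le hc hT h1 hR j hr0 (hrn.trans hnt) fun τ hτ0 hτ1 => ?_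
    rcases le_total τ t with hτ | hτ
    · exact mul_le_mul (hD τ hτ0 hτ) (hwide j _ (by linarith) (by linarith)) (abs_nonneg _) hD0
    · rw [mul_comm D]
      exact mul_le_mul (hS τ hτ0 (hτ1.trans hrn)) (ih _ (by linarith) (by linarith)) (abs_nonneg _)
        hS0
  have hnarrow : ∀ j : ℕ, j + 1 ≤ n → ∀ r, 0 ≤ r → r ≤ (j + 1) * t →
      |cosTransform (fun x => T x ^ (j + 1)) ((j + 1) * R - r)| ≤ D := by
    intro j
    induction j with
    | zero => intro _; simpa using hD
    | succ j ih =>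
      intro hj r hr0 hr1
      have := hstep j hj (ih (by omega)) r hr0 (by push_cast at hr1; linarith)
      refine le_trans ?_ (this.trans (mul_le_of_le_one_right hD0 hS1))
      refine le_of_eq ?_
      congr 2
      push_cast
      ring
  obtain ⟨j, rfl⟩ := Nat.exists_eq_add_of_le' hn
  have := hstep j le_rfl (hnarrow j (by omega)) ((j + 2 : ℕ) * t) (by positivity)
    (by push_cast; linarith)
  simpa using this

theorem exists_cosTransform_eq_zero_of_pow_le {T : ℝ → ℝ} (hc : Continuous T)
    (hT : ∀ N : ℕ, IntegrableOn (fun x => x ^ N * T x) (Set.Ioi 0))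
    (h1 : ∀ x, 0 < x → |T x| ≤ 1) {R : ℝ}
    (hR : ∀ y, R ≤ y → cosTransform T y = 0) {n : ℕ} (hn : 2 ≤ n) {c K δ : ℝ} (hc0 : 0 < c)
    (hK : 0 ≤ K) (hδ : 0 < δ) {N : ℕ}
    (hle : ∀ t, 0 < t → t < δ → c * t ^ N * |cosTransform T (R - t)|
      ≤ K * |cosTransform (fun x => T x ^ n) (n * R - n * t)|) :
    ∃ t, 0 < t ∧ ∀ τ, 0 ≤ τ → τ ≤ t → cosTransform T (R - τ) = 0 := by
  have hT0 : IntegrableOn T (Set.Ioi 0) := by simpa using hT 0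
  set I := ∫ x in Set.Ioi (0 : ℝ), ‖x ^ (N + 1) * T x‖ with hI
  have hI0 : 0 ≤ I := integral_nonneg fun x => norm_nonneg _
  have hmom : ∀ t, 0 ≤ t → |cosTransform T (R - t)| ≤ t ^ (N + 1) * I := fun t ht =>
    abs_cosTransform_sub_le hT0 (hT (N + 1)) hR ht
  have hn0 : (0 : ℝ) < n := by exact_mod_cast (by omega : 0 < n)
  obtain ⟨t₀, ht₀, ht₀δ, ht₀1, ht₀2, ht₀3⟩ : ∃ t₀ : ℝ, 0 < t₀ ∧ t₀ < δ ∧ n * t₀ ≤ 1 ∧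
      (n * t₀) ^ (N + 1) * I ≤ 1 ∧ K * (n ^ (N + 1) * I) * t₀ ≤ c / 2 := by
    have e1 : ∀ᶠ t : ℝ in nhdsWithin 0 (Set.Ioi 0), t < δ :=
      nhdsWithin_le_nhds (gt_mem_nhds hδ)
    have e2 : ∀ᶠ t : ℝ in nhdsWithin 0 (Set.Ioi 0), n * t < 1 := by
      refine nhdsWithin_le_nhds (Filter.Tendsto.eventually_lt_const
        (u := 1) (v := (n : ℝ) * 0) (by simp) (Continuous.tendsto (by fun_prop) 0))
    have e3 : ∀ᶠ t : ℝ in nhdsWithin 0 (Set.Ioi 0), (n * t) ^ (N + 1) * I < 1 := by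
      refine nhdsWithin_le_nhds (Filter.Tendsto.eventually_lt_const
        (u := 1) (v := ((n : ℝ) * 0) ^ (N + 1) * I) (by simp) (Continuous.tendsto
        (by fun_prop : Continuous fun t : ℝ => (n * t) ^ (N + 1) * I) 0))
    have e4 : ∀ᶠ t : ℝ in nhdsWithin 0 (Set.Ioi 0), K * (n ^ (N + 1) * I) * t < c / 2 := by
      refine nhdsWithin_le_nhds (Filter.Tendsto.eventually_lt_const
        (u := c / 2) (v := K * (n ^ (N + 1) * I) * 0) (by simpa using hc0) (Continuous.tendsto
        (by fun_prop : Continuous fun t : ℝ => K * (n ^ (N + 1) * I) * t) 0))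
    have e5 : ∀ᶠ t : ℝ in nhdsWithin 0 (Set.Ioi 0), 0 < t := self_mem_nhdsWithin
    obtain ⟨t, h5, h1, h2, h3, h4⟩ := (e5.and (e1.and (e2.and (e3.and e4)))).exists
    exact ⟨t, h5, h1, h2.le, h3.le, h4.le⟩
  have hcont : Continuous fun τ => |cosTransform T (R - τ)| :=
    ((continuous_cosTransform hT0).comp (by fun_prop)).abs
  obtain ⟨t, ⟨ht0, ht1⟩, hmax⟩ := isCompact_Icc.exists_isMaxOn
    (Set.nonempty_Icc.mpr ht₀.le) hcont.continuousOn
  suffices h : |cosTransform T (R - t)| = 0 by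
    refine ⟨t₀, ht₀, fun τ hτ0 hτ1 => abs_eq_zero.mp (le_antisymm ?_ (abs_nonneg _))⟩
    rw [← h]
    exact hmax (Set.mem_Icc.mpr ⟨hτ0, hτ1⟩)
  rcases ht0.eq_or_lt with rfl | ht0
  · rw [hR _ (by linarith), abs_zero]
  set D := |cosTransform T (R - t)| with hD
  have hb := abs_cosTransform_pow_le hc hT0 h1 hR hn (t := t) (D := D) (S := (n * t) ^ (N + 1) * I)
    ht0.le ((mul_le_mul_of_nonneg_left ht1 hn0.le).trans ht₀1)
    (le_trans (by gcongr) ht₀2) (fun τ h0 h1 => hmax (Set.mem_Icc.mpr ⟨h0, h1.trans ht1⟩))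
    (fun τ h0 h1 => (hmom τ h0).trans (by gcongr))
  have hl := hle t ht0 (ht1.trans_lt ht₀δ)
  have hD0 : 0 ≤ D := abs_nonneg _
  have h2 : t ^ N * (c * D) ≤ t ^ N * (c / 2 * D) :=
    calc t ^ N * (c * D) = c * t ^ N * D := by ring
      _ ≤ K * (D * ((n * t) ^ (N + 1) * I)) := hl.trans (mul_le_mul_of_nonneg_left hb hK)
      _ = t ^ N * (K * (n ^ (N + 1) * I) * t * D) := by ring
      _ ≤ t ^ N * (c / 2 * D) := by
        refine mul_le_mul_of_nonneg_left (mul_le_mul_of_nonneg_right (le_trans ?_ ht₀3) hD0)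
          (by positivity)
        gcongr
  have h3 := le_of_mul_le_mul_left h2 (by positivity)
  nlinarith

theorem integral_exp_neg_mul_measure {ρ : Measure ℝ} [IsProbabilityMeasure ρ] (h0 : cdf ρ 0 = 0)
    {s : ℂ} (hs : 0 < s.re) :
    ∫ b, Complex.exp (-(s * b)) ∂ρ = 1 - s * laplace (fun x => 1 - cdf ρ x) s := by
  have hs0 : s ≠ 0 := fun h => by simp [h] at hs
  set Φ : ℝ → ℝ → ℂ := fun x b => (Set.Iio b).indicator (fun x : ℝ => Complex.exp (-(s * x))) x
    with hΦ
  have hΦi : Integrable (Function.uncurry Φ) ((volume.restrict (Set.Ioi 0)).prod ρ) := by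
    have h1 := Integrable.mul_prod (integrableOn_exp_neg_mul hs) (integrable_const (1 : ℂ) (μ := ρ))
    refine (h1.indicator (measurableSet_lt measurable_fst measurable_snd)).congr
      (Filter.Eventually.of_forall fun p => ?_)
    simp only [hΦ, Function.uncurry, Set.indicator_apply, mul_one]
    rfl
  have hleft : ∀ x, ∫ b, Φ x b ∂ρ = Complex.exp (-(s * x)) * ((1 - cdf ρ x : ℝ) : ℂ) := by
    intro x
    have e : (fun b => Φ x b) = (Set.Ioi x).indicator fun _ => Complex.exp (-(s * x)) := by
      ext b
      simp [hΦ, Set.indicator_apply]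
    rw [e, integral_indicator_const _ measurableSet_Ioi, ← Set.compl_Iic,
      probReal_compl_eq_one_sub measurableSet_Iic, ← cdf_eq_real, Complex.real_smul, mul_comm]
  have hright : ∀ b, 0 < b → ∫ x in Set.Ioi (0 : ℝ), Φ x b = (1 - Complex.exp (-(s * b))) / s := by
    intro b hb
    simp only [hΦ]
    rw [setIntegral_indicator measurableSet_Iio, Set.Ioi_inter_Iio, ← integral_Ioc_eq_integral_Ioo,
      ← intervalIntegral.integral_of_le hb.le]
    have := integral_exp_mul_complex (a := 0) (b := b) (neg_ne_zero.mpr hs0)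
    simp only [neg_mul] at this
    rw [this]
    simp only [Complex.ofReal_zero, mul_zero, neg_zero, Complex.exp_zero]
    rw [div_neg, ← neg_div, neg_sub]
  have hbi : Integrable (fun b : ℝ => Complex.exp (-(s * b))) ρ := by
    refine Integrable.mono' (integrable_const (1 : ℝ))
      (Continuous.aestronglyMeasurable (by fun_prop)) ?_
    filter_upwards [ae_Ioi_zero_of_cdf h0] with b hb
    exact norm_exp_neg_mul_le_one hs.le hb
  have hl : laplace (fun x => 1 - cdf ρ x) s = (1 - ∫ b, Complex.exp (-(s * b)) ∂ρ) / s := by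
    rw [laplace]
    simp_rw [← hleft]
    rw [integral_integral_swap hΦi]
    have : ∫ b, (∫ x in Set.Ioi (0 : ℝ), Φ x b) ∂ρ = ∫ b, (1 - Complex.exp (-(s * b))) / s ∂ρ := by
      refine integral_congr_ae ?_
      filter_upwards [ae_Ioi_zero_of_cdf h0] with b hb
      exact hright b hb
    rw [this, integral_div, integral_sub (integrable_const _) hbi]
    simp
  rw [hl]
  field_simp
  ring

theorem one_sub_mul_laplace_ne_zero {ρ : Measure ℝ} [IsProbabilityMeasure ρ] (h0 : cdf ρ 0 = 0)
    {r : ℝ} (hr : 0 < r) : 1 - r * laplace (fun x => 1 - cdf ρ x) r ≠ 0 := by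
  rw [← integral_exp_neg_mul_measure h0 (by simpa using hr)]
  have e : ∀ b : ℝ, Complex.exp (-((r : ℂ) * b)) = ((Real.exp (-(r * b)) : ℝ) : ℂ) := by
    intro b
    push_cast
    rfl
  simp_rw [e]
  rw [integral_complex_ofReal, Complex.ofReal_ne_zero]
  refine (integral_exp_pos ?_).ne'
  refine Integrable.mono' (integrable_const (1 : ℝ))
    (Continuous.aestronglyMeasurable (by fun_prop)) ?_
  filter_upwards [ae_Ioi_zero_of_cdf h0] with b hb
  have hb0 : (0 : ℝ) < b := hb
  rw [Real.norm_of_nonneg (Real.exp_pos _).le, Real.exp_le_one_iff]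
  have := mul_pos hr hb0
  linarith

/-- The Laplace transforms of the tails of the law of a sum `G + c X`. -/
theorem laplace_map_add_mul {ν γ κ : Measure ℝ} [IsProbabilityMeasure ν] [IsProbabilityMeasure γ]
    [IsProbabilityMeasure κ] {c : ℝ} (hc : 0 < c)
    (hκ : κ = (ν.prod γ).map fun p => p.2 + c * p.1)
    (hν0 : cdf ν 0 = 0) (hγ0 : cdf γ 0 = 0) (hκ0 : cdf κ 0 = 0) {s : ℂ} (hs : 0 < s.re) :
    1 - s * laplace (fun x => 1 - cdf κ x) s = (1 - s * laplace (fun x => 1 - cdf γ x) s)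
      * (1 - c * s * laplace (fun x => 1 - cdf ν x) (c * s)) := by
  rw [← integral_exp_neg_mul_measure hκ0 hs, ← integral_exp_neg_mul_measure hγ0 hs,
    ← integral_exp_neg_mul_measure hν0 (by simpa using mul_pos hc hs), hκ,
    integral_map (by fun_prop) (Continuous.aestronglyMeasurable (by fun_prop)), mul_comm,
    ← integral_prod_mul]
  refine integral_congr_ae (Filter.Eventually.of_forall fun p => ?_)
  simp only
  rw [← Complex.exp_add]
  congr 1
  push_cast
  ring

theorem laplace_map_add_mul_I {ν γ κ : Measure ℝ} [IsProbabilityMeasure ν] [IsProbabilityMeasure γ]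
    [IsProbabilityMeasure κ] {c : ℝ} (hc : 0 < c)
    (hκ : κ = (ν.prod γ).map fun p => p.2 + c * p.1)
    (hν0 : cdf ν 0 = 0) (hγ0 : cdf γ 0 = 0) (hκ0 : cdf κ 0 = 0)
    (hνi : IntegrableOn (fun x => 1 - cdf ν x) (Set.Ioi 0))
    (hγi : IntegrableOn (fun x => 1 - cdf γ x) (Set.Ioi 0))
    (hκi : IntegrableOn (fun x => 1 - cdf κ x) (Set.Ioi 0)) (y : ℝ) :
    1 - y * Complex.I * laplace (fun x => 1 - cdf κ x) (y * Complex.I)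
      = (1 - y * Complex.I * laplace (fun x => 1 - cdf γ x) (y * Complex.I))
      * (1 - (c * y : ℝ) * Complex.I
        * laplace (fun x => 1 - cdf ν x) ((c * y : ℝ) * Complex.I)) := by
  have hε : ∀ z : ℝ, Filter.Tendsto (fun ε : ℝ => (ε + z * Complex.I : ℂ))
      (nhdsWithin 0 (Set.Ioi 0)) (nhds (z * Complex.I)) := by
    intro z
    have h2 : Continuous fun ε : ℝ => (ε + z * Complex.I : ℂ) := by fun_prop
    have := (h2.tendsto 0).mono_left (nhdsWithin_le_nhds (s := Set.Ioi (0 : ℝ)))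
    simpa using this
  have hcε : Filter.Tendsto (fun ε : ℝ => c * ε) (nhdsWithin 0 (Set.Ioi 0))
      (nhdsWithin 0 (Set.Ioi 0)) := by
    refine tendsto_nhdsWithin_iff.mpr ⟨?_, ?_⟩
    · have := ((continuous_const_mul c).tendsto 0).mono_left
        (nhdsWithin_le_nhds (s := Set.Ioi (0 : ℝ)))
      simpa using this
    · filter_upwards [self_mem_nhdsWithin] with ε hε
      exact mul_pos hc hε
  have l1 := ((hε y).mul (tendsto_laplace hκi y)).const_sub 1
  have l2 := ((hε y).mul (tendsto_laplace hγi y)).const_sub 1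
  have l3 := (((hε (c * y)).comp hcε).mul ((tendsto_laplace hνi (c * y)).comp hcε)).const_sub 1
  refine tendsto_nhds_unique l1 ((l2.mul l3).congr' ?_)
  filter_upwards [self_mem_nhdsWithin] with ε hε
  have hε' : (0 : ℝ) < ε := hε
  rw [laplace_map_add_mul hc hκ hν0 hγ0 hκ0 (s := ε + y * Complex.I) (by simpa using hε')]
  have e : ((c * ε : ℝ) : ℂ) + (c * y : ℝ) * Complex.I = c * (ε + y * Complex.I) := by
    push_cast
    ring
  simp only [Function.comp, e]

/-- The relation between the cosine transforms of the tails of `G + c X` and `X`, outside the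
support of that of `G`. -/
theorem abs_cosTransform_map_add_mul {ν γ κ : Measure ℝ} [IsProbabilityMeasure ν]
    [IsProbabilityMeasure γ] [IsProbabilityMeasure κ] {c : ℝ} (hc : 0 < c)
    (hκ : κ = (ν.prod γ).map fun p => p.2 + c * p.1)
    (hν0 : cdf ν 0 = 0) (hγ0 : cdf γ 0 = 0) (hκ0 : cdf κ 0 = 0)
    (hνi : IntegrableOn (fun x => 1 - cdf ν x) (Set.Ioi 0))
    (hγi : IntegrableOn (fun x => 1 - cdf γ x) (Set.Ioi 0))
    (hκi : IntegrableOn (fun x => 1 - cdf κ x) (Set.Ioi 0)) {y : ℝ} (hy : 0 < y)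
    (hyγ : cosTransform (fun x => 1 - cdf γ x) y = 0) :
    |cosTransform (fun x => 1 - cdf κ x) y|
      = ‖1 - y * Complex.I * laplace (fun x => 1 - cdf γ x) (y * Complex.I)‖
        * (c * |cosTransform (fun x => 1 - cdf ν x) (c * y)|) := by
  have key := congrArg Complex.im
    (laplace_map_add_mul_I hc hκ hν0 hγ0 hκ0 hνi hγi hκi y)
  have him : ∀ (z : ℝ) (L : ℂ), (1 - z * Complex.I * L).im = -(z * L.re) := by
    intro z L
    simp [Complex.mul_im]
  have hre : ∀ (h : ℝ → ℝ), IntegrableOn h (Set.Ioi 0) → ∀ z : ℝ,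
      (laplace h (z * Complex.I)).re = cosTransform h z := fun h hh z => re_laplace_mul_I hh z
  set w := 1 - y * Complex.I * laplace (fun x => 1 - cdf γ x) (y * Complex.I) with hw
  have hw0 : w.im = 0 := by rw [hw, him, hre _ hγi, hyγ]; simp
  have hwn : ‖w‖ = |w.re| := by
    rw [show w = (w.re : ℂ) from Complex.ext rfl (by simpa using hw0), Complex.norm_real]
    simp
  rw [Complex.mul_im, him, him, hw0, hre _ hκi, hre _ hνi, zero_mul, add_zero] at key
  have h2 : cosTransform (fun x => 1 - cdf κ x) y
      = w.re * (c * cosTransform (fun x => 1 - cdf ν x) (c * y)) := by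
    refine mul_left_cancel₀ hy.ne' ?_
    linarith
  rw [h2, hwn, abs_mul, abs_mul, abs_of_pos hc]

theorem binomTail_zero_left {R : Type*} [CommRing R] (n : ℕ) (u : R) : binomTail 0 n u = 1 := by
  have h := add_pow u (1 - u) n
  rw [add_sub_cancel, one_pow] at h
  rw [h, binomTail, ← Nat.range_succ_eq_Icc_zero]
  exact Finset.sum_congr rfl fun j _ => by ring

theorem one_sub_binomTail_le {k n : ℕ} (hkn : k < n) {u : ℝ} (hu0 : 0 ≤ u) (hu1 : u ≤ 1) :
    1 - binomTail k n u ≤ 2 ^ n * (1 - u) ^ 2 := by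
  have h1 : 0 ≤ 1 - u := by linarith
  have hsplit : binomTail 0 n u
      = (∑ j ∈ Finset.range k, (n.choose j : ℝ) * u ^ j * (1 - u) ^ (n - j)) + binomTail k n u := by
    have hIcc : ∀ k : ℕ, Finset.Icc k n = Finset.Ico k (n + 1) := fun k => by ext; simp
    rw [binomTail, binomTail, hIcc, hIcc, Finset.range_eq_Ico,
      Finset.sum_Ico_consecutive _ (Nat.zero_le _) (by omega)]
  rw [binomTail_zero_left] at hsplit
  calc _ = ∑ j ∈ Finset.range k, (n.choose j : ℝ) * u ^ j * (1 - u) ^ (n - j) := by linarith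
    _ ≤ ∑ j ∈ Finset.range k, (n.choose j : ℝ) * (1 - u) ^ 2 := by
        refine Finset.sum_le_sum fun j hj => ?_
        have hj' := Finset.mem_range.mp hj
        rw [mul_assoc]
        refine mul_le_mul_of_nonneg_left ?_ (Nat.cast_nonneg _)
        calc u ^ j * (1 - u) ^ (n - j) ≤ 1 * (1 - u) ^ 2 := by
              refine mul_le_mul (pow_le_one₀ hu0 hu1)
                (pow_le_pow_of_le_one h1 (by linarith) (by omega)) (by positivity) zero_le_one
          _ = _ := one_mul _
    _ = (∑ j ∈ Finset.range k, (n.choose j : ℝ)) * (1 - u) ^ 2 := (Finset.sum_mul ..).symm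
    _ ≤ 2 ^ n * (1 - u) ^ 2 := by
      refine mul_le_mul_of_nonneg_right ?_ (by positivity)
      have : ∑ j ∈ Finset.range (n + 1), (n.choose j : ℝ) = 2 ^ n := by
        exact_mod_cast Nat.sum_range_choose n
      rw [← this]
      exact Finset.sum_le_sum_of_subset_of_nonneg
        (Finset.range_mono (by omega)) fun _ _ _ => Nat.cast_nonneg _

theorem one_sub_cdf_mul_le {ν γ κ : Measure ℝ} [IsProbabilityMeasure ν]
    [IsProbabilityMeasure γ] [IsProbabilityMeasure κ] {n k : ℕ} (hkn : k < n)
    (hκ : ∀ t, cdf κ t = binomTail k n (cdf ν t))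
    (hsum : κ = (ν.prod γ).map fun p => p.2 + 1 / (n : ℝ) * p.1) (hγ0 : cdf γ 0 = 0) (x : ℝ) :
    1 - cdf ν (n * x) ≤ 2 ^ n * (1 - cdf ν x) ^ 2 := by
  refine le_trans ?_ (one_sub_binomTail_le hkn (cdf_nonneg ν x) (cdf_le_one ν x))
  rw [← hκ]
  have hn : (0 : ℝ) < n := by exact_mod_cast (by omega : 0 < n)
  have hle : cdf κ x ≤ cdf ν (n * x) := by
    rw [cdf_map_add_mul hsum, cdf_eq_real ν, ← integral_indicator_one measurableSet_Iic]
    refine integral_mono_of_nonneg (Filter.Eventually.of_forall fun b => cdf_nonneg _ _)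
      ((integrable_const (1 : ℝ)).indicator measurableSet_Iic)
      (Filter.Eventually.of_forall fun b => ?_)
    by_cases hb : b ∈ Set.Iic ((n : ℝ) * x)
    · simpa [Set.indicator_of_mem hb] using cdf_le_one γ _
    · rw [Set.indicator_of_notMem hb]
      rw [Set.mem_Iic, not_le] at hb
      refine (cdf_eq_zero_of_nonpos hγ0 ?_).le
      rw [one_div_mul_eq_div, sub_nonpos, le_div_iff₀ hn]
      linarith
  linarith

/-- A tail with `T (n x) ≤ K T(x)²` decays faster than every power. -/
theorem exists_pow_mul_le_of_quadratic {T : ℝ → ℝ} (hT0 : ∀ x, 0 ≤ T x) (hT1 : ∀ x, T x ≤ 1)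
    (hanti : Antitone T) (hlim : Filter.Tendsto T Filter.atTop (nhds 0)) {n : ℕ} (hn : 2 ≤ n)
    {K : ℝ} (hK : 0 ≤ K) (hquad : ∀ x, T (n * x) ≤ K * T x ^ 2) (N : ℕ) :
    ∃ C, ∀ x, 0 < x → x ^ N * T x ≤ C := by
  have hn0 : (0 : ℝ) < n := by exact_mod_cast (by omega : 0 < n)
  have hn1 : (1 : ℝ) < n := by exact_mod_cast (by omega : 1 < n)
  have hev : ∀ᶠ x in Filter.atTop, n ^ N * K * T x < 1 :=
    (hlim.const_mul (n ^ N * K)).eventually_lt_const (by simp)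
  obtain ⟨x₀, hx₀, hx₀1⟩ := (hev.and (Filter.eventually_ge_atTop 1)).exists
  have hx₀0 : 0 < x₀ := by linarith
  have hstep : ∀ x, x₀ ≤ x → (n * x) ^ N * T (n * x) ≤ x ^ N * T x := by
    intro x hx
    have hx0 : 0 < x := by linarith
    have h1 : n ^ N * K * T x ≤ 1 :=
      (mul_le_mul_of_nonneg_left (hanti hx) (by positivity)).trans hx₀.le
    calc (n * x) ^ N * T (n * x) ≤ (n * x) ^ N * (K * T x ^ 2) := by
          gcongr
          exact hquad x
      _ = x ^ N * T x * (n ^ N * K * T x) := by ring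
      _ ≤ x ^ N * T x := mul_le_of_le_one_right (mul_nonneg (by positivity) (hT0 x)) h1
  have hind : ∀ i : ℕ, ∀ x, 0 < x → x ≤ n ^ i * (n * x₀) → x ^ N * T x ≤ (n * x₀) ^ N := by
    intro i
    induction i with
    | zero =>
      intro x hx0 hx
      calc x ^ N * T x ≤ x ^ N := mul_le_of_le_one_right (by positivity) (hT1 x)
        _ ≤ _ := by
          rw [pow_zero, one_mul] at hx
          gcongr
    | succ i ih =>
      intro x hx0 hx
      rcases le_total x (n * x₀) with h | h
      · refine le_trans (mul_le_of_le_one_right (by positivity) (hT1 x)) ?_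
        gcongr
      · have e : x = n * (x / n) := by field_simp
        rw [e]
        refine (hstep _ ?_).trans (ih _ (by positivity) ?_)
        · rw [le_div_iff₀ hn0]
          linarith
        · rw [div_le_iff₀ hn0]
          calc x ≤ _ := hx
            _ = _ := by ring
  refine ⟨(n * x₀) ^ N, fun x hx => ?_⟩
  obtain ⟨i, hi⟩ := pow_unbounded_of_one_lt x hn1
  refine hind i x hx (hi.le.trans ?_)
  have : 1 ≤ n * x₀ := by nlinarith
  exact le_mul_of_one_le_right (by positivity) this

theorem integrableOn_of_sq_mul_le {g : ℝ → ℝ} (hg : Measurable g) {C₁ C₂ : ℝ}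
    (h1 : ∀ x, 0 < x → |g x| ≤ C₁) (h2 : ∀ x, 0 < x → x ^ 2 * |g x| ≤ C₂) :
    IntegrableOn g (Set.Ioi 0) := by
  refine Integrable.mono' (integrable_inv_one_add_sq.const_mul (C₁ + C₂)).integrableOn
    hg.aestronglyMeasurable ?_
  filter_upwards [ae_restrict_mem measurableSet_Ioi] with x hx
  have a1 := h1 x hx
  have a2 := h2 x hx
  rw [Real.norm_eq_abs, ← div_eq_mul_inv, le_div_iff₀ (by positivity)]
  linarith

theorem binomTail_one {R : Type*} [CommRing R] {k n : ℕ} (hkn : k ≤ n) :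
    binomTail k n (1 : R) = 1 := by
  rw [binomTail, Finset.sum_eq_single n]
  · simp
  · intro j hj hjn
    have := (Finset.mem_Icc.mp hj).2
    rw [sub_self, zero_pow (by omega), mul_zero]
  · intro h
    exact absurd (Finset.mem_Icc.mpr ⟨hkn, le_rfl⟩) h

/-- The polynomial expressing the tail of an order statistic through the tail of the sample. -/
noncomputable def tailPoly (k n : ℕ) : Polynomial ℝ := 1 - binomTail k n (1 - Polynomial.X)

theorem eval_tailPoly (k n : ℕ) (u : ℝ) : (tailPoly k n).eval u = 1 - binomTail k n (1 - u) := by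
  rw [tailPoly, Polynomial.eval_sub, Polynomial.eval_one, ← Polynomial.coe_evalRingHom,
    map_binomTail]
  simp

theorem natDegree_tailPoly_le (k n : ℕ) : (tailPoly k n).natDegree ≤ n := by
  refine (Polynomial.natDegree_sub_le _ _).trans (max_le (by simp) ?_)
  refine Polynomial.natDegree_sum_le_of_forall_le _ _ fun j hj => ?_
  have hj' := (Finset.mem_Icc.mp hj).2
  rw [sub_sub_cancel]
  have h1 : ((1 : Polynomial ℝ) - Polynomial.X).natDegree ≤ 1 :=
    (Polynomial.natDegree_sub_le _ _).trans (by simp)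
  calc _ ≤ 0 + j * 1 + (n - j) := by
        refine (Polynomial.natDegree_mul_le).trans (add_le_add ?_ (by simp))
        refine (Polynomial.natDegree_mul_le).trans (add_le_add (by simp) ?_)
        exact (Polynomial.natDegree_pow_le).trans (Nat.mul_le_mul_left _ h1)
    _ = n := by omega

theorem eval_tailPoly_eq_sum {k n : ℕ} (hkn : k ≤ n) (u : ℝ) :
    (tailPoly k n).eval u = ∑ j ∈ Finset.range n, (tailPoly k n).coeff (j + 1) * u ^ (j + 1) := by
  rw [Polynomial.eval_eq_sum_range' (Nat.lt_succ_of_le (natDegree_tailPoly_le k n)),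
    Finset.sum_range_succ', Polynomial.coeff_zero_eq_eval_zero, eval_tailPoly, sub_zero,
    binomTail_one hkn]
  simp

theorem integrableOn_tailPoly {T : ℝ → ℝ} (hT : IntegrableOn T (Set.Ioi 0))
    (h1 : ∀ x, 0 < x → |T x| ≤ 1) {k n : ℕ} (hkn : k ≤ n) :
    IntegrableOn (fun x => (tailPoly k n).eval (T x)) (Set.Ioi 0) := by
  simp_rw [eval_tailPoly_eq_sum hkn]
  exact integrable_finsetSum _ fun j _ => (integrableOn_pow_of_abs_le_one hT h1 j).const_mul _

theorem cosTransform_tailPoly {T : ℝ → ℝ} (hT : IntegrableOn T (Set.Ioi 0))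
    (h1 : ∀ x, 0 < x → |T x| ≤ 1) {k n : ℕ} (hkn : k ≤ n) (y : ℝ) :
    cosTransform (fun x => (tailPoly k n).eval (T x)) y = ∑ j ∈ Finset.range n,
      (tailPoly k n).coeff (j + 1) * cosTransform (fun x => T x ^ (j + 1)) y := by
  rw [cosTransform]
  simp_rw [eval_tailPoly_eq_sum hkn, Finset.sum_mul, mul_assoc]
  rw [integral_finsetSum _ fun j _ =>
    (integrableOn_mul_cos (integrableOn_pow_of_abs_le_one hT h1 j) y).const_mul _]
  simp_rw [integral_const_mul]
  rfl

theorem exists_end_of_support {C : ℝ → ℝ} (hc : Continuous C) (heven : ∀ y, C |y| = C y) {M : ℝ}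
    (hM : ∀ y, M < y → C y = 0) (hne : ∃ y, C y ≠ 0) :
    ∃ R, 0 < R ∧ (∀ y, R ≤ y → C y = 0) ∧ ∀ t, 0 < t → ∃ τ, 0 ≤ τ ∧ τ ≤ t ∧ C (R - τ) ≠ 0 := by
  set S : Set ℝ := {y | C y ≠ 0} with hS
  obtain ⟨y₀, hy₀⟩ := hne
  have hy₀S : |y₀| ∈ S := by
    change C |y₀| ≠ 0
    rwa [heven]
  have hbdd : BddAbove S := ⟨M, fun y hy => by
    by_contra! h
    exact hy (hM y h)⟩
  have hgt : ∀ y, sSup S < y → C y = 0 := by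
    intro y hy
    by_contra h
    exact absurd (le_csSup hbdd (show y ∈ S from h)) (not_le.mpr hy)
  have hR0 : C (sSup S) = 0 := by
    have h1 : Filter.Tendsto C (nhdsWithin (sSup S) (Set.Ioi (sSup S))) (nhds (C (sSup S))) :=
      (hc.tendsto _).mono_left nhdsWithin_le_nhds
    refine tendsto_nhds_unique (h1.congr' ?_) tendsto_const_nhds
    filter_upwards [self_mem_nhdsWithin] with y hy
    exact hgt y hy
  have hle := le_csSup hbdd hy₀S
  have hne : |y₀| ≠ sSup S := fun h => hy₀S (by rw [h, hR0])
  refine ⟨sSup S, (abs_nonneg y₀).trans_lt (lt_of_le_of_ne hle hne), fun y hy => ?_,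
    fun t ht => ?_⟩
  · rcases hy.eq_or_lt with rfl | hy
    · exact hR0
    · exact hgt y hy
  · obtain ⟨y, hyS, hy⟩ := exists_lt_of_lt_csSup ⟨_, hy₀S⟩ (show sSup S - t < sSup S by linarith)
    refine ⟨sSup S - y, sub_nonneg.mpr (le_csSup hbdd hyS), by linarith, ?_⟩
    rwa [sub_sub_cancel]

theorem not_cosTransform_eq_zero {h : ℝ → ℝ} (hc : Continuous h) (hh : IntegrableOn h (Set.Ioi 0))
    (h0 : h 0 ≠ 0) : ∃ y, 0 < y ∧ cosTransform h y ≠ 0 := by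
  by_contra! hz
  refine h0 ?_
  rw [eq_cosTransform_cosTransform hc hh
    (integrable_of_cosTransform_eq_zero hh (M := 0) hz).integrableOn le_rfl]
  rw [cosTransform, setIntegral_congr_fun (g := fun _ => (0 : ℝ)) measurableSet_Ioi fun y hy => by
    simp [hz y hy]]
  simp

/-- A sample whose tail has a cosine transform of bounded support cannot satisfy the identity. -/
theorem false_of_cosTransform_eq_zero {ν γ κ : Measure ℝ} [IsProbabilityMeasure ν]
    [IsProbabilityMeasure γ] [IsProbabilityMeasure κ] {n k : ℕ} (hk : 1 < k) (hkn : k ≤ n)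
    (hγ : ∀ t, cdf γ t = binomTail (k - 1) (n - 1) (cdf ν t))
    (hκ : ∀ t, cdf κ t = binomTail k n (cdf ν t))
    (hsum : κ = (ν.prod γ).map fun p => p.2 + 1 / (n : ℝ) * p.1)
    (hcont : Continuous (cdf ν)) (h0 : cdf ν 0 = 0)
    (hT : ∀ N : ℕ, IntegrableOn (fun x => x ^ N * (1 - cdf ν x)) (Set.Ioi 0)) {M : ℝ}
    (hM : ∀ y, M < y → cosTransform (fun x => 1 - cdf ν x) y = 0) : False := by
  set T : ℝ → ℝ := fun x => 1 - cdf ν x with hTdef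
  have hTc : Continuous T := by fun_prop
  have hTi : IntegrableOn T (Set.Ioi 0) := by simpa using hT 0
  have hT1 : ∀ x, 0 < x → |T x| ≤ 1 := fun x _ => by
    rw [hTdef, abs_of_nonneg (by linarith [cdf_le_one ν x])]
    linarith [cdf_nonneg ν x]
  have hn2 : 2 ≤ n := by omega
  have hn0 : (0 : ℝ) < n := by exact_mod_cast (by omega : 0 < n)
  have hγ0 : cdf γ 0 = 0 := by rw [hγ, h0, binomTail_zero (by omega)]
  have hκ0 : cdf κ 0 = 0 := by rw [hκ, h0, binomTail_zero (by omega)]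
  have hTγ : (fun x => 1 - cdf γ x) = fun x => (tailPoly (k - 1) (n - 1)).eval (T x) := by
    funext x
    rw [eval_tailPoly, hγ, hTdef, sub_sub_cancel]
  have hTκ : (fun x => 1 - cdf κ x) = fun x => (tailPoly k n).eval (T x) := by
    funext x
    rw [eval_tailPoly, hκ, hTdef, sub_sub_cancel]
  obtain ⟨y₁, -, hy₁⟩ := not_cosTransform_eq_zero hTc hTi (by simp [hTdef, h0])
  obtain ⟨R, hR0, hR, hRmax⟩ := exists_end_of_support (continuous_cosTransform hTi)
    (cosTransform_abs T) hM ⟨y₁, hy₁⟩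
  have hγi : IntegrableOn (fun x => 1 - cdf γ x) (Set.Ioi 0) := by
    rw [hTγ]
    exact integrableOn_tailPoly hTi hT1 (by omega)
  have hκi : IntegrableOn (fun x => 1 - cdf κ x) (Set.Ioi 0) := by
    rw [hTκ]
    exact integrableOn_tailPoly hTi hT1 hkn
  have hpow : ∀ j : ℕ, j + 1 < n → ∀ y, (n - 1) * R < y →
      cosTransform (fun x => T x ^ (j + 1)) y = 0 := by
    intro j hj y hy
    refine cosTransform_pow_eq_zero hTc hTi hT1 hR j y (le_trans ?_ hy.le)
    have : (j : ℝ) + 2 ≤ n := by exact_mod_cast hj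
    exact mul_le_mul_of_nonneg_right (by linarith) hR0.le
  have hγz : ∀ y, (n - 1) * R < y → cosTransform (fun x => 1 - cdf γ x) y = 0 := by
    intro y hy
    rw [hTγ, cosTransform_tailPoly hTi hT1 (by omega)]
    refine Finset.sum_eq_zero fun j hj => ?_
    have := Finset.mem_range.mp hj
    rw [hpow j (by omega) y hy, mul_zero]
  have hκz : ∀ y, (n - 1) * R < y → cosTransform (fun x => 1 - cdf κ x) y
      = (tailPoly k n).coeff n * cosTransform (fun x => T x ^ n) y := by
    intro y hy
    rw [hTκ, cosTransform_tailPoly hTi hT1 hkn]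
    obtain ⟨j, rfl⟩ := Nat.exists_eq_add_of_le' (show 1 ≤ n by omega)
    rw [Finset.sum_range_succ, Finset.sum_eq_zero, zero_add]
    intro i hi
    have := Finset.mem_range.mp hi
    rw [hpow i (by omega) y hy, mul_zero]
  have hn1 : (1 : ℝ) < n := by exact_mod_cast (by omega : 1 < n)
  obtain ⟨c, hc, N, δ, hδ, hlow⟩ := exists_pow_le_norm_one_sub_laplace (g := fun x => 1 - cdf γ x)
    (by rw [hTγ]; fun_prop) hγi (M := (n - 1) * R) (mul_pos (by linarith) hR0) hγz
    (fun r hr => one_sub_mul_laplace_ne_zero hγ0 hr) (y₀ := n * R) (by linarith)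
  obtain ⟨t, ht, hzero⟩ := exists_cosTransform_eq_zero_of_pow_le hTc hT hT1 hR hn2
    (c := c * n ^ N * (1 / n)) (K := |(tailPoly k n).coeff n|) (δ := min (δ / n) (R / n)) (N := N)
    (by positivity) (abs_nonneg _) (by positivity) fun t ht htδ => by
      have h1 : n * t < δ := by
        have := htδ.trans_le (min_le_left _ _)
        rwa [lt_div_iff₀ hn0, mul_comm] at this
      have h2 : n * t < R := by
        have := htδ.trans_le (min_le_right _ _)
        rwa [lt_div_iff₀ hn0, mul_comm] at this
      have hnt : 0 < n * t := mul_pos hn0 ht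
      have hy : (n - 1) * R < n * R - n * t := by linarith
      have hy0 : 0 < n * R - n * t := lt_of_le_of_lt (mul_nonneg (by linarith) hR0.le) hy
      have h3 := hlow (n * R - n * t) (by linarith) (by linarith)
      have h4 := abs_cosTransform_map_add_mul (one_div_pos.mpr hn0) hsum h0 hγ0 hκ0 hTi hγi hκi hy0
        (hγz _ hy)
      rw [hκz _ hy, abs_mul, show 1 / (n : ℝ) * (n * R - n * t) = R - t by field_simp] at h4
      rw [h4]
      calc _ = c * (n * R - (n * R - n * t)) ^ N * (1 / n * |cosTransform T (R - t)|) := by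
            rw [sub_sub_cancel, mul_pow]
            ring
        _ ≤ _ := mul_le_mul_of_nonneg_right h3 (by positivity)
  obtain ⟨τ, hτ0, hτ1, hτ⟩ := hRmax t ht
  exact hτ (hzero τ hτ0 hτ1)

open PowerSeries in
/-- The expansion of the tail when the distribution function vanishes to order `m ≥ 2` at `0`. -/
theorem PowerSeries.IsOrderStatSolution.hasSum_tail {k n m : ℕ} (hk : 2 ≤ k) (hkn : k ≤ n)
    (hm : 2 ≤ m) {E : PowerSeries ℝ} (hE : constantCoeff E ≠ 0)
    (h : IsOrderStatSolution k n (X ^ m * E)) {F : ℝ → ℝ} (hF : (X ^ m * E).EntireSum F)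
    {x : ℝ} (hx : 0 < x) :
    HasSum (fun j : ℕ => coeff (m * j) (1 - X ^ m * E) * x ^ (m * j)) (1 - F x) := by
  have h1 : (1 - X ^ m * E : PowerSeries ℝ).EntireSum (fun x => 1 - F x) := EntireSum.one.sub hF
  have hinj : Function.Injective fun j : ℕ => m * j :=
    fun a b hab => Nat.eq_of_mul_eq_mul_left (by omega) hab
  refine (hinj.hasSum_iff (f := fun q => coeff q (1 - X ^ m * E) * x ^ q) fun q hq => ?_).mpr
    (h1 x hx)
  have hmq : ¬ m ∣ q := fun ⟨j, hj⟩ => hq ⟨j, hj.symm⟩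
  have hq0 : q ≠ 0 := fun h => hmq (h ▸ dvd_zero m)
  have : coeff q (X ^ m * E) = 0 := by
    rw [coeff_X_pow_mul']
    split_ifs with hle
    · exact h.coeff_eq_zero_of_not_dvd hk hkn hm hE fun hd =>
        hmq ((Nat.dvd_sub_iff_left hle dvd_rfl).mp hd)
    · rfl
  rw [map_sub, coeff_one, if_neg hq0, this, sub_zero, zero_mul]

open PowerSeries in
theorem PowerSeries.factorial_mul_abs_coeff_one_sub_le {m : ℕ} (hm : 1 ≤ m) {E : PowerSeries ℝ}
    {C A : ℝ} (hC : 0 < C) (hA : 1 ≤ A)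
    (h : ∀ i, (m + i).factorial * |coeff i E| ≤ C * A ^ i) (j : ℕ) :
    (m * j).factorial * |coeff (m * j) (1 - X ^ m * E)| ≤ (C + 1) * A ^ (m * j) := by
  rcases Nat.eq_zero_or_pos j with rfl | hj
  · have : coeff 0 (X ^ m * E) = 0 := by
      rw [coeff_X_pow_mul', if_neg (by omega)]
    simp only [mul_zero, Nat.factorial_zero, Nat.cast_one, one_mul, map_sub, pow_zero, mul_one]
    rw [this]
    simp [hC.le]
  · have hle : m ≤ m * j := Nat.le_mul_of_pos_right m hj
    rw [map_sub, coeff_one, if_neg (by positivity), zero_sub, abs_neg, coeff_X_pow_mul', if_pos hle]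
    have h1 := h (m * j - m)
    rw [Nat.add_sub_cancel' hle] at h1
    refine h1.trans (mul_le_mul (by linarith) (pow_le_pow_right₀ hA (Nat.sub_le _ _))
      (by positivity) (by linarith))

theorem factorial_mul_factorial_le {m : ℕ} (hm : 3 ≤ m) (j : ℕ) :
    (2 * j).factorial * j.factorial ≤ (m * j).factorial :=
  (Nat.le_of_dvd (Nat.factorial_pos _) (Nat.factorial_mul_factorial_dvd_factorial_add _ _)).trans
    (Nat.factorial_le (by nlinarith))

theorem factorial_two_mul_mul_le {m : ℕ} (hm : 3 ≤ m) {t : ℕ → ℝ} {C A : ℝ} (hC : 0 ≤ C)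
    (hA : 0 ≤ A) (h : ∀ j, (m * j).factorial * |t j| ≤ C * A ^ (m * j)) {B : ℝ} (hB : 0 < B)
    (j : ℕ) :
    (2 * j).factorial * |t j| ≤ C * Real.exp (A ^ m / B ^ 2) * B ^ (2 * j) := by
  have hj : (0 : ℝ) < j.factorial := by exact_mod_cast Nat.factorial_pos j
  have h1 : (2 * j).factorial * |t j| * j.factorial ≤ C * A ^ (m * j) := by
    refine le_trans ?_ (h j)
    have : ((2 * j).factorial * j.factorial : ℝ) ≤ (m * j).factorial := by
      exact_mod_cast factorial_mul_factorial_le hm j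
    nlinarith [abs_nonneg (t j)]
  have h2 := Real.pow_div_factorial_le_exp (A ^ m / B ^ 2) (by positivity) j
  calc _ ≤ C * A ^ (m * j) / j.factorial := by rwa [le_div_iff₀ hj]
    _ = C * ((A ^ m / B ^ 2) ^ j / j.factorial) * B ^ (2 * j) := by
      rw [div_pow, ← pow_mul, ← pow_mul]
      field_simp
    _ ≤ _ := by gcongr

open PowerSeries in
/-- The distribution function vanishes at `0` to first order only. -/
theorem false_of_two_le_order {ν γ κ : Measure ℝ} [IsProbabilityMeasure ν]
    [IsProbabilityMeasure γ] [IsProbabilityMeasure κ] {n k : ℕ} (hk : 1 < k) (hkn : k ≤ n)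
    (hγ : ∀ t, cdf γ t = binomTail (k - 1) (n - 1) (cdf ν t))
    (hκ : ∀ t, cdf κ t = binomTail k n (cdf ν t))
    (hsum : κ = (ν.prod γ).map fun p => p.2 + 1 / (n : ℝ) * p.1)
    (hcont : Continuous (cdf ν)) (h0 : cdf ν 0 = 0) {m : ℕ} (hm : 2 ≤ m) {E : PowerSeries ℝ}
    (hE : 0 < constantCoeff E) (h : IsOrderStatSolution k n (X ^ m * E))
    (hF : (X ^ m * E).EntireSum (cdf ν)) : False := by
  have hkn' : k < n := by
    have := two_mul_le_of_leading hk (by omega) hm (h.leading hk hkn (by omega) hE.ne')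
    omega
  obtain ⟨C, A, hC, hA, hCA⟩ := h.exists_exponentialType hk hkn' (by omega) hE
  have hbd := factorial_mul_abs_coeff_one_sub_le (by omega) hC hA hCA
  have hser : ∀ x, 0 < x → HasSum _ (1 - cdf ν x) := fun x hx =>
    h.hasSum_tail hk hkn hm hE.ne' hF hx
  set t : ℕ → ℝ := fun j => coeff (m * j) (1 - X ^ m * E) with ht
  set T : ℝ → ℝ := fun x => 1 - cdf ν x with hT
  have hTc : Continuous T := by fun_prop
  have hγ0 : cdf γ 0 = 0 := by rw [hγ, h0, binomTail_zero (by omega)]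
  have hT0 : ∀ x, 0 ≤ T x := fun x => sub_nonneg.mpr (cdf_le_one ν x)
  have hT1 : ∀ x, T x ≤ 1 := fun x => sub_le_self _ (cdf_nonneg ν x)
  have hdecay := exists_pow_mul_le_of_quadratic hT0 hT1
    (fun a b hab => sub_le_sub_left (monotone_cdf ν hab) 1)
    (by simpa [hT] using (tendsto_cdf_atTop ν).const_sub 1) (n := n) (by omega) (K := 2 ^ n)
    (by positivity) (one_sub_cdf_mul_le hkn' hκ hsum hγ0)
  have hTN : ∀ N : ℕ, IntegrableOn (fun x => x ^ N * T x) (Set.Ioi 0) := by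
    intro N
    obtain ⟨C₁, h1⟩ := hdecay N
    obtain ⟨C₂, h2⟩ := hdecay (N + 2)
    have habs : ∀ x, 0 < x → |x ^ N * T x| = x ^ N * T x := fun x hx =>
      abs_of_nonneg (mul_nonneg (by positivity) (hT0 x))
    refine integrableOn_of_sq_mul_le (C₁ := C₁) (C₂ := C₂)
      ((continuous_pow N).mul hTc).measurable (fun x hx => ?_) fun x hx => ?_
    · rw [habs x hx]
      exact h1 x hx
    · rw [habs x hx]
      refine le_trans (le_of_eq ?_) (h2 x hx)
      ring
  rcases hm.eq_or_lt with rfl | hm3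
  · refine false_of_cosTransform_eq_zero hk hkn hγ hκ hsum hcont h0 hTN (M := 2 * A) fun y hy => ?_
    exact integral_mul_cos_eq_zero (by simpa using hTN 0) (by linarith) hser hbd hy
  · have hm0 : (0 : ℝ) < m := by exact_mod_cast (by omega : 0 < m)
    set g : ℝ → ℝ := fun x => T (x ^ (2 / m : ℝ)) with hg
    have hgc : Continuous g := hTc.comp (Real.continuous_rpow_const (by positivity))
    have hrp : ∀ x : ℝ, 0 < x → ∀ j : ℕ, (x ^ (2 / m : ℝ)) ^ (m * j) = x ^ (2 * j) := by
      intro x hx j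
      rw [← Real.rpow_natCast, ← Real.rpow_mul hx.le, ← Real.rpow_natCast]
      congr 1
      push_cast
      field_simp
    have hgi : IntegrableOn g (Set.Ioi 0) := by
      obtain ⟨C₂, h2⟩ := hdecay m
      refine integrableOn_of_sq_mul_le (C₁ := 1) (C₂ := C₂) hgc.measurable (fun x hx => ?_)
        fun x hx => ?_
      · rw [abs_of_nonneg (hT0 _)]
        exact hT1 _
      · rw [abs_of_nonneg (hT0 _)]
        have h3 := h2 (x ^ (2 / m : ℝ)) (by positivity)
        have h4 := hrp x hx 1
        rw [mul_one, mul_one] at h4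
        rwa [h4] at h3
    have hgs : ∀ x : ℝ, 0 < x → HasSum (fun j : ℕ => t j * x ^ (2 * j)) (g x) := by
      intro x hx
      have := hser (x ^ (2 / m : ℝ)) (by positivity)
      simpa only [hrp x hx] using this
    obtain ⟨y, hy0, hy⟩ := not_cosTransform_eq_zero hgc hgi (by
      simp only [hg]
      rw [Real.zero_rpow (by positivity)]
      simp [hT, h0])
    refine hy (integral_mul_cos_eq_zero hgi (A := y / 4) (by positivity) hgs
      (factorial_two_mul_mul_le hm3 (by positivity) (by linarith) hbd (by positivity)) ?_)
    linarith

open PowerSeries in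
theorem PowerSeries.EntireSum.exists_eq_X_pow_mul {P : PowerSeries ℝ} {F : ℝ → ℝ}
    (hP : P.EntireSum F) (hF0 : ∀ x, 0 ≤ F x) (hne : ∃ x, 0 < x ∧ F x ≠ 0) :
    ∃ (m : ℕ) (E : PowerSeries ℝ), P = X ^ m * E ∧ 0 < constantCoeff E := by
  have hP0 : P ≠ 0 := by
    rintro rfl
    obtain ⟨x, hx, hFx⟩ := hne
    refine hFx ((hP x hx).unique ?_)
    simp
  set m := P.order.toNat with hm
  set E := P.divXPowOrder with hE
  have hPE : P = X ^ m * E := X_pow_order_mul_divXPowOrder.symm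
  have hE0 : constantCoeff E ≠ 0 := fun h => hP0 (constantCoeff_divXPowOrder_eq_zero_iff.mp h)
  refine ⟨m, E, hPE, lt_of_le_of_ne ?_ hE0.symm⟩
  have hEs : E.EntireSum fun x => F x / x ^ m := by
    intro x hx
    have h1 := (hasSum_nat_add_iff' m).mpr (hP x hx)
    rw [Finset.sum_eq_zero, sub_zero] at h1
    · refine (congrArg (HasSum · _) (funext fun d => ?_)).mpr (h1.div_const (x ^ m))
      rw [hPE, coeff_X_pow_mul, pow_add]
      field_simp
    · intro i hi
      rw [hPE, coeff_X_pow_mul', if_neg (not_le.mpr (Finset.mem_range.mp hi)), zero_mul]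
  by_contra! hneg
  have hs : Summable fun i : ℕ => |coeff (i + 1) E| := by
    have := (summable_nat_add_iff 1).mpr (hEs.summable_abs zero_le_one)
    simpa using this
  set S := ∑' i : ℕ, |coeff (i + 1) E| with hS
  have hS0 : 0 ≤ S := tsum_nonneg fun _ => abs_nonneg _
  set e := constantCoeff E with he
  obtain ⟨x, hx0, hx1, hxS⟩ : ∃ x : ℝ, 0 < x ∧ x ≤ 1 ∧ x * S < -e := by
    refine ⟨min 1 (-e / (S + 1)), by
      have : 0 < -e := by linarith
      positivity, min_le_left _ _, ?_⟩
    calc min 1 (-e / (S + 1)) * S ≤ -e / (S + 1) * S :=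
          mul_le_mul_of_nonneg_right (min_le_right _ _) hS0
      _ < -e := by
        rw [div_mul_eq_mul_div, div_lt_iff₀ (by positivity)]
        nlinarith
  have h1 := (hasSum_nat_add_iff' 1).mpr (hEs x hx0)
  simp only [Finset.range_one, Finset.sum_singleton, pow_zero, mul_one,
    coeff_zero_eq_constantCoeff_apply] at h1
  have h2 : F x / x ^ m - e ≤ x * S := by
    refine hasSum_le (fun i => ?_) h1 (hs.hasSum.mul_left x)
    calc coeff (i + 1) E * x ^ (i + 1) ≤ |coeff (i + 1) E| * x := by
          refine mul_le_mul (le_abs_self _) ?_ (by positivity) (abs_nonneg _)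
          rw [pow_succ]
          exact mul_le_of_le_one_left hx0.le (pow_le_one₀ hx0.le hx1)
      _ = _ := mul_comm _ _
  have h3 : 0 ≤ F x / x ^ m := div_nonneg (hF0 x) (by positivity)
  linarith

theorem theorem1 {Ω : Type*} [MeasurableSpace Ω] (μ : Measure Ω) [IsProbabilityMeasure μ]
    (ν : Measure ℝ) [IsProbabilityMeasure ν] (hν : InClassF ν)
    (n k : ℕ) (hk : 1 < k) (hkn : k ≤ n)
    (X : Fin n → Ω → ℝ) (hlaw : ∀ i, HasLaw (X i) ν μ) (hindep : iIndepFun X μ)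
    (heq : IdentDistrib
      (fun ω => orderStat (fun i : Fin (n - 1) => X (Fin.castLE (Nat.sub_le n 1) i) ω)
          (k - 1) (by omega) (by omega) + (1 / (n : ℝ)) * X ⟨n - 1, by omega⟩ ω)
      (fun ω => orderStat (fun i : Fin n => X i ω) k (by omega) hkn) μ μ) :
    ∃ r : ℝ, 0 < r ∧ ν = expMeasure r := by
  obtain ⟨γ, κ, hγp, hκp, hγ, hκ, hsum⟩ :=
    exists_laws_of_identDistrib μ ν n k hkn X hlaw hindep _ _ _ _ heq
  obtain ⟨f, P, hfm, hf0, hf, hP0, hP, hPf⟩ := hν.exists_powerSeries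
  have hsol : P.IsOrderStatSolution k n :=
    borelMul_binomTail_eq hk hkn hγ hκ hsum hν.cdf_zero hfm hf0 hf hP0 hP hPf
  have hne : ∃ x, 0 < x ∧ cdf ν x ≠ 0 := by
    obtain ⟨x, hx, hx0⟩ := (((tendsto_cdf_atTop ν).eventually_ne one_ne_zero).and
      (Filter.eventually_gt_atTop 0)).exists
    exact ⟨x, hx0, hx⟩
  obtain ⟨m, E, rfl, hE⟩ := hP.exists_eq_X_pow_mul (cdf_nonneg ν) hne
  obtain hm | rfl | hm : m = 0 ∨ m = 1 ∨ 2 ≤ m := by omega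
  · rw [hm, pow_zero, one_mul] at hP0
    exact absurd hP0 hE.ne'
  · obtain ⟨l, hl⟩ := hsol.exists_eq_expSol hk hkn hE.ne'
    exact eq_expMeasure_of_entireSum_expSol hν.cdf_zero hE (hl ▸ hP)
  · exact (false_of_two_le_order hk hkn hγ hκ hsum hν.continuous_cdf hν.cdf_zero hm hE hsol hP).elim
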